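/- **Setting.** Let $(M,g,k)$ be an initial data set ($M$ a smooth 3-manifold, $g$ a smooth Riemannian metric, $k$ a smooth symmetric 2-tensor, regarded as the second fundamental form $k(v,w)=\langle\nabla_v n,w\rangle$ of $M$ in a spacetime with future unit normal $n$) which is asymptotically flat of order one: outside a compact set there are coordinates $x=(x^1,x^2,x^3)$, identifying it with the exterior of a ball in $\mathbb R^3$, such that with $r=|x|$ $$g_{ij}=\delta_{ij}+\frac{g^{(-1)}_{ij}}{r}+\frac{g^{(-2)}_{ij}}{r^2}+o(r^{-2}),\qquad k_{ij}=\frac{k^{(-2)}_{ij}}{r^2}+\frac{k^{(-3)}_{ij}}{r^3}+o(r^{-3}),$$ where the coefficients are smooth functions on $S^2$, and the first expansion may be differentiated twice and the second once (each derivative improves the remainder by a factor $r^{-1}$). Let $\Sigma_r$ be the coordinate spheres, parametrized by $S^2$ via $\tilde X\mapsto r\tilde X$, with induced metric $\sigma$, mean curvature vector $H$ in the spacetime, and $\alpha_H(\cdot)=\langle\nabla_{(\cdot)}\frac{J}{|H|},\frac{H}{|H|}\rangle$, where $J$ is the reflection of $H$ through the incoming light cone of the normal bundle (the future timelike normal vector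 with $\langle J,H\rangle=0$, $\langle J,J\rangle=-|H|^2$). For an isometric embedding $X$ of $\Sigma_r$ into Minkowski space $\mathbb R^{3,1}$ and a future timelike unit vector $T_0$, let $|H_0|,\alpha_{H_0}$ be the corresponding data of the image of $X$, $\tau=-\langle X,T_0\rangle$, and $$\rho=\frac{\sqrt{|H_0|^2+\frac{(\Delta\tau)^2}{1+|\nabla\tau|^2}}-\sqrt{|H|^2+\frac{(\Delta\tau)^2}{1+|\nabla\tau|^2}}}{\sqrt{1+|\nabla\tau|^2}},\qquad \beta=\rho\nabla\tau-\nabla\Big[\sinh^{-1}\Big(\frac{\rho\,\Delta\tau}{|H_0||H|}\Big)\Big]-\alpha_{H_0}+\alpha_H .$$ The pair $(X,T_0)$ is an optimal isometric embedding if $X$ is a smooth isometric embedding and $\mathrm{div}_\sigma\beta=0$. For a Killing field $K$ of $\mathbb R^{3,1}$ put $$E(\Sigma_r,X,T_0,K)=-\frac1{8\pi}\int_{\Sigma_r}\big[\langle K,T_0\rangle\rho+K^\top\cdot\beta\big]\,d\Sigma_r .$$ Let $(X_r,T_0(r))$, $r$ large, be a family of optimal isometric embeddings of $\Sigma_r$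 with $$X_r^0=(X^0)^{(0)}+\frac{(X^0)^{(-1)}}r+o(r^{-1}),\quad X_r^i=r\tilde X^i+(X^i)^{(0)}+\frac{(X^i)^{(-1)}}r+o(r^{-1}),\quad T_0(r)=(a^0,a^i)+\frac{T_0^{(-1)}}r+o(r^{-1}),$$ where $\tilde X^i$ are the coordinate functions on $S^2$, the coefficients of the first two expansions are smooth on $S^2$, and these two expansions hold together with three derivatives along $S^2$. Let $A(r)$ be Lorentz transformations with $T_0(r)=A(r)(\partial/\partial X^0)$ which converge as $r\to\infty$. Let $$\rho^{(-2)}=\lim_{r\to\infty}r^2\rho,\qquad \alpha_H^{(-1)}=\lim_{r\to\infty}r\,\alpha_H,\qquad m=\frac1{8\pi}\int_{S^2}\rho^{(-2)}\,dS^2 .$$ The total center of mass and the total angular momentum are $$C^i=\frac1m\lim_{r\to\infty}E\Big(\Sigma_r,X_r,T_0(r),A(r)\big(X^i\tfrac{\partial}{\partial X^0}+X^0\tfrac{\partial}{\partial X^i}\big)\Big),$$ $$J_i=\lim_{r\to\infty}\sum_{j,k}\epsilon_{ijk}\,E\Big(\Sigma_r,X_r,T_0(r),A(r)\big(X^j\tfrac{\partial}{\partial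 X^k}-X^k\tfrac{\partial}{\partial X^j}\big)\Big).$$ **Proposition.** Suppose that for $i=1,2,3$ $$\int_{S^2}\tilde X^i\rho^{(-2)}\,dS^2=0\qquad\text{and}\qquad\int_{S^2}\tilde X^i\,\tilde\epsilon^{ab}\tilde\nabla_b(\alpha_H^{(-1)})_a\,dS^2=0,$$ where $\tilde\epsilon$ and $\tilde\nabla$ are the area form and the covariant derivative of the round metric. Then the total center of mass and the total angular momentum are finite: the limits defining $C^i$ and $J_i$ exist in $\mathbb R$ for $i=1,2,3$. (The limits in the definition of $C^i$ exist even if $m=0$, where the factor $1/m$ is meaningless.) -/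

import Mathlib

open Filter Topology MeasureTheory Asymptotics
open scoped ContDiff Manifold Matrix

noncomputable section

namespace CWY

/-! ### Calculus on the unit sphere

The unit sphere `S²` is `Metric.sphere 0 1` in Euclidean three-space.  Functions on `S²` are written
as functions on `E3` of which only the values at unit vectors matter; they are differentiated through
their extension which is constant along rays.  A one-form or a metric on `S²` is written as a function
of a unit vector `x` and of tangent vectors `v ⟂ x`. -/

/-- Euclidean three-space. -/
abbrev E3 : Type := EuclideanSpace ℝ (Fin 3)

/-- The vector space `ℝ⁴`, with the index `0` for time. -/
abbrev Vec4 : Type := Fin 4 → ℝ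

/-- The surface integral `∫_{S²} f dS²` for the round metric. -/
def sphereIntegral (f : E3 → ℝ) : ℝ :=
  ∫ x : Metric.sphere (0 : E3) 1, f x ∂(volume : Measure E3).toSphere

/-- The extension of (the restriction to `S²` of) `f` which is constant along rays. -/
def radialExt {F : Type*} (f : E3 → F) (y : E3) : F := f (‖y‖⁻¹ • y)

/-- `f` is a smooth function on `S²`. -/
def SphereSmooth {F : Type*} [NormedAddCommGroup F] [NormedSpace ℝ F] (f : E3 → F) : Prop :=
  ContDiffOn ℝ ∞ (radialExt f) {0}ᶜ

/-- The differential `df_x(v)` of a function on `S²`, for `v` tangent to `S²` at `x`. -/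
def sphereD {F : Type*} [NormedAddCommGroup F] [NormedSpace ℝ F] (f : E3 → F) (x v : E3) : F :=
  fderiv ℝ (radialExt f) x v

/-- The orthogonal projection of the `i`-th standard basis vector to `T_x S²`.  The three vectors
`tang x i` span `T_x S²`. -/
def tang (x : E3) (i : Fin 3) : E3 := EuclideanSpace.single i (1 : ℝ) - x i • x

/-- The matrix of the metric `σ` at `x ∈ S²`, extended to `E3` by making `x` a unit vector orthogonal
to `T_x S²`.  Its determinant is that of `σ` relative to the round metric, and the inverse matrix
restricts to the inverse metric `σ^{ab}` on `T_x S²`. -/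
def gram (σ : E3 → E3 → E3 → ℝ) (x : E3) : Matrix (Fin 3) (Fin 3) ℝ :=
  Matrix.of fun i j => σ x (tang x i) (tang x j) + x i * x j

/-- The density `dΣ / dS²` of the area form of `σ`. -/
def areaDensity (σ : E3 → E3 → E3 → ℝ) (x : E3) : ℝ := Real.sqrt (gram σ x).det

/-- The contraction `σ^{ab} β_a γ_b` of two covectors at `x`. -/
def contract (σ : E3 → E3 → E3 → ℝ) (x : E3) (β γ : E3 → ℝ) : ℝ :=
  ∑ i, ∑ j, (gram σ x)⁻¹ i j * β (tang x i) * γ (tang x j)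

/-- The divergence `div_σ β = ∇^a β_a` of a one-form `β`, namely
`(√det σ)⁻¹ ∂_a (√det σ σ^{ab} β_b)`, where the determinant is relative to the round metric and the
outer divergence is that of the round metric. -/
def divOneForm (σ : E3 → E3 → E3 → ℝ) (β : E3 → E3 → ℝ) (x : E3) : ℝ :=
  (areaDensity σ x)⁻¹ * ∑ i, sphereD
    (fun y => areaDensity σ y * ∑ j, (gram σ y)⁻¹ i j * β y (tang y j)) x (tang x i)

/-- The Laplace operator of `σ` on functions. -/
def laplacian (σ : E3 → E3 → E3 → ℝ) (f : E3 → ℝ) (x : E3) : ℝ :=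
  divOneForm σ (fun y v => sphereD f y v) x

/-- The Levi-Civita symbol with three indices. -/
def levi (i j k : Fin 3) : ℝ :=
  (((j : ℕ) : ℝ) - ((i : ℕ) : ℝ)) * (((k : ℕ) : ℝ) - ((i : ℕ) : ℝ)) *
    (((k : ℕ) : ℝ) - ((j : ℕ) : ℝ)) / 2

/-- The scalar `ε̃^{ab} ∇̃_b α_a` of a one-form `α` on the round sphere, with area form
`ε̃(v, w) = det(x, v, w)`. -/
def roundCurl (α : E3 → E3 → ℝ) (x : E3) : ℝ :=
  ∑ l, ∑ i, ∑ j, levi l i j * x l * sphereD (fun y => α y (tang y i)) x (tang x j)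

/-! ### Spacelike surfaces in a spacetime -/

/-- An immersed sphere in a spacetime, described by the pull-back to `S²` of the tangent bundle of
the spacetime in a global frame whose vector with index `0` is future timelike: the metric, the
connection form of the Levi-Civita connection, and the differential of the immersion. -/
structure SurfaceInSpacetime where
  /-- Matrix of the spacetime metric in the frame. -/
  metric : E3 → Matrix (Fin 4) (Fin 4) ℝ
  /-- Connection form, evaluated on a tangent vector of `S²`. -/
  conn : E3 → E3 → Matrix (Fin 4) (Fin 4) ℝ
  /-- Differential of the immersion. -/
  diff : E3 → E3 → Vec4

namespace SurfaceInSpacetime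

variable (S : SurfaceInSpacetime)

/-- The spacetime inner product `⟨u, w⟩` along the surface. -/
def ip (x : E3) (u w : Vec4) : ℝ := u ⬝ᵥ (S.metric x *ᵥ w)

/-- The induced metric. -/
def induced (x v w : E3) : ℝ := S.ip x (S.diff x v) (S.diff x w)

/-- The component of a spacetime vector normal to the surface. -/
def normalPart (x : E3) (w : Vec4) : Vec4 :=
  w - ∑ i, ∑ j, ((gram S.induced x)⁻¹ i j * S.ip x w (S.diff x (tang x i))) • S.diff x (tang x j)

/-- The spacetime covariant derivative `∇_v s` of a vector field `s` along the surface. -/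
def covD (s : E3 → Vec4) (x v : E3) : Vec4 := sphereD s x v + S.conn x v *ᵥ s x

/-- The mean curvature vector `H`, the trace of the second fundamental form `(∇_v w)^⊥`. -/
def meanCurv (x : E3) : Vec4 :=
  S.normalPart x (∑ i, ∑ j, (gram S.induced x)⁻¹ i j •
    S.covD (fun y => S.diff y (tang y j)) x (tang x i))

/-- The norm `|H|` of the mean curvature vector. -/
def normH (x : E3) : ℝ := Real.sqrt (S.ip x (S.meanCurv x) (S.meanCurv x))

/-- A future timelike normal vector orthogonal to `H`. -/
def timeNormal (x : E3) : Vec4 :=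
  S.normalPart x (Pi.single 0 1) -
    (S.ip x (Pi.single 0 1) (S.meanCurv x) / S.ip x (S.meanCurv x) (S.meanCurv x)) • S.meanCurv x

/-- The vector `J`: the future timelike normal vector with `⟨J, H⟩ = 0` and `⟨J, J⟩ = -⟨H, H⟩`.  For `H`
spacelike and inward pointing, as on large coordinate spheres, this is the reflection of `H` through
the incoming light cone of the normal bundle. -/
def J (x : E3) : Vec4 :=
  (S.normH x / Real.sqrt (-S.ip x (S.timeNormal x) (S.timeNormal x))) • S.timeNormal x

/-- The connection one-form in mean curvature gauge `α_H(v) = ⟨∇_v (J/|H|), H/|H|⟩`. -/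
def alphaH (x v : E3) : ℝ :=
  S.ip x (S.covD (fun y => (S.normH y)⁻¹ • S.J y) x v) ((S.normH x)⁻¹ • S.meanCurv x)

end SurfaceInSpacetime

/-! ### Minkowski space -/

/-- The Minkowski metric `diag(-1, 1, 1, 1)`. -/
def minkowski : Matrix (Fin 4) (Fin 4) ℝ := Matrix.diagonal (Fin.cons (-1) fun _ => 1)

/-- The Minkowski inner product. -/
def mink (u w : Vec4) : ℝ := u ⬝ᵥ (minkowski *ᵥ w)

/-- The image of `X : S² → ℝ^{3,1}`. -/
def minkowskiSurface (X : E3 → Vec4) : SurfaceInSpacetime where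
  metric := fun _ => minkowski
  conn := fun _ _ => 0
  diff := fun x v => sphereD X x v

/-- Lorentz transformations. -/
def IsLorentz (A : Matrix (Fin 4) (Fin 4) ℝ) : Prop := Aᵀ * minkowski * A = minkowski

/-- The Killing field `X^i ∂/∂X^0 + X^0 ∂/∂X^i`. -/
def boostField (i : Fin 3) (X : Vec4) : Vec4 :=
  X i.succ • Pi.single 0 1 + X 0 • Pi.single i.succ 1

/-- The vector field `X^i ∂/∂X^j - X^j ∂/∂X^i`. -/
def rotationField (i j : Fin 3) (X : Vec4) : Vec4 :=
  X i.succ • Pi.single j.succ 1 - X j.succ • Pi.single i.succ 1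

/-- The image `A(K)` of a vector field `K` under the linear transformation `A`. -/
def pushField (A : Matrix (Fin 4) (Fin 4) ℝ) (K : Vec4 → Vec4) (X : Vec4) : Vec4 :=
  A *ᵥ K (A⁻¹ *ᵥ X)

/-! ### Quasi-local conserved quantities

Here `S` is the physical surface, `X` an isometric embedding of it into Minkowski space and `T₀` the
observer. -/

/-- The time function `τ = -⟨X, T₀⟩`. -/
def timeFun (X : E3 → Vec4) (T₀ : Vec4) (x : E3) : ℝ := -mink (X x) T₀

/-- The quasi-local mass density `ρ`. -/
def massDensity (S : SurfaceInSpacetime) (X : E3 → Vec4) (T₀ : Vec4) (x : E3) : ℝ :=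
  let H₀ := (minkowskiSurface X).normH x
  let H := S.normH x
  let Δτ := laplacian S.induced (timeFun X T₀) x
  let W := 1 + contract S.induced x (sphereD (timeFun X T₀) x) (sphereD (timeFun X T₀) x)
  (Real.sqrt (H₀ ^ 2 + Δτ ^ 2 / W) - Real.sqrt (H ^ 2 + Δτ ^ 2 / W)) / Real.sqrt W

/-- The one-form `ρ ∇τ - ∇ sinh⁻¹(ρ Δτ / (|H₀| |H|)) - α_{H₀} + α_H`. -/
def currentForm (S : SurfaceInSpacetime) (X : E3 → Vec4) (T₀ : Vec4) (x v : E3) : ℝ :=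
  massDensity S X T₀ x * sphereD (timeFun X T₀) x v
    - sphereD (fun y => Real.arsinh (massDensity S X T₀ y * laplacian S.induced (timeFun X T₀) y /
        ((minkowskiSurface X).normH y * S.normH y))) x v
    - (minkowskiSurface X).alphaH x v + S.alphaH x v

/-- `(X, T₀)` is an optimal isometric embedding of `S`: `X` is a smooth embedding of the sphere which
induces the metric of `S`, `T₀` is a future timelike unit vector, and the optimal isometric embedding
equation holds. -/
structure IsOptimalIsometricEmbedding (S : SurfaceInSpacetime) (X : E3 → Vec4) (T₀ : Vec4) :
    Prop where
  smooth : SphereSmooth X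
  injective : Set.InjOn X (Metric.sphere 0 1)
  isometric : ∀ x ∈ Metric.sphere (0 : E3) 1, ∀ v w : E3, inner ℝ x v = 0 → inner ℝ x w = 0 →
    mink (sphereD X x v) (sphereD X x w) = S.induced x v w
  unit : mink T₀ T₀ = -1
  future : 0 < T₀ 0
  equation : ∀ x ∈ Metric.sphere (0 : E3) 1, divOneForm S.induced (currentForm S X T₀) x = 0

/-- The quasi-local conserved quantity `E(Σ, X, T₀, K)`; the second summand of the integrand is
`K^⊤ · β = σ^{ab} ⟨K, ∂_a X⟩ β_b`. -/
def conservedQuantity (S : SurfaceInSpacetime) (X : E3 → Vec4) (T₀ : Vec4) (K : Vec4 → Vec4) : ℝ :=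
  -1 / (8 * Real.pi) * sphereIntegral fun x =>
    (mink (K (X x)) T₀ * massDensity S X T₀ x +
      contract S.induced x (fun v => mink (K (X x)) (sphereD X x v)) (currentForm S X T₀ x)) *
    areaDensity S.induced x

/-! ### Asymptotically flat initial data sets -/

/-- An initial data set `(g, k)` on a smooth three-manifold `M`: a Riemannian metric and a symmetric
two-tensor. -/
structure InitialDataSet (M : Type*) [TopologicalSpace M] [ChartedSpace E3 M]
    [IsManifold 𝓘(ℝ, E3) ∞ M] where
  /-- The Riemannian metric. -/
  g : Bundle.ContMDiffRiemannianMetric 𝓘(ℝ, E3) ∞ E3 (fun p : M => TangentSpace 𝓘(ℝ, E3) p)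
  /-- The symmetric two-tensor. -/
  k : ∀ p : M, TangentSpace 𝓘(ℝ, E3) p →L[ℝ] TangentSpace 𝓘(ℝ, E3) p →L[ℝ] ℝ
  k_symm : ∀ (p : M) (v w : TangentSpace 𝓘(ℝ, E3) p), k p v w = k p w v
  k_smooth : ContMDiff 𝓘(ℝ, E3) (𝓘(ℝ, E3).prod 𝓘(ℝ, E3 →L[ℝ] E3 →L[ℝ] ℝ)) ∞
    (fun p => Bundle.TotalSpace.mk' (E3 →L[ℝ] E3 →L[ℝ] ℝ)
      (E := fun p : M => TangentSpace 𝓘(ℝ, E3) p →L[ℝ] TangentSpace 𝓘(ℝ, E3) p →L[ℝ] ℝ) p (k p))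

/-- The expansion `q = c₀ + c₁(x/r) r^{-a} + c₂(x/r) r^{-a-1} + o(r^{-a-1})` at infinity, with smooth
coefficients on `S²`, which may be differentiated `n` times. -/
def HasExpansionAtInfinity (q : E3 → ℝ) (c₀ : ℝ) (a n : ℕ) : Prop :=
  ∃ c₁ c₂ : E3 → ℝ, SphereSmooth c₁ ∧ SphereSmooth c₂ ∧ ∀ m ≤ n,
    (fun y => iteratedFDeriv ℝ m (fun z => q z - c₀ - radialExt c₁ z / ‖z‖ ^ a -
      radialExt c₂ z / ‖z‖ ^ (a + 1)) y) =o[Bornology.cobounded E3]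
      fun y => (‖y‖ ^ (a + 1 + m))⁻¹

namespace InitialDataSet

variable {M : Type*} [TopologicalSpace M] [ChartedSpace E3 M] [IsManifold 𝓘(ℝ, E3) ∞ M]

/-- The coordinate vector field `∂/∂x^i` of the chart `Φ` at the point with coordinates `y`. -/
def coordVec (Φ : OpenPartialHomeomorph M E3) (y : E3) (i : Fin 3) :
    TangentSpace 𝓘(ℝ, E3) (Φ.symm y) :=
  mfderiv 𝓘(ℝ, E3) 𝓘(ℝ, E3) Φ.symm y (EuclideanSpace.single i (1 : ℝ) : E3)

/-- The Cartesian components `g_{ij}`. -/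
def gComp (D : InitialDataSet M) (Φ : OpenPartialHomeomorph M E3) (y : E3) :
    Matrix (Fin 3) (Fin 3) ℝ :=
  Matrix.of fun i j => D.g.inner (Φ.symm y) (coordVec Φ y i) (coordVec Φ y j)

/-- The Cartesian components `k_{ij}`. -/
def kComp (D : InitialDataSet M) (Φ : OpenPartialHomeomorph M E3) (y : E3) :
    Matrix (Fin 3) (Fin 3) ℝ :=
  Matrix.of fun i j => D.k (Φ.symm y) (coordVec Φ y i) (coordVec Φ y j)

/-- `(M, g, k)` is asymptotically flat of order one, with asymptotically Euclidean coordinates `Φ`: the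
chart `Φ` maps the complement of a compact set diffeomorphically onto the complement of a ball, and
`g = δ + g^{(-1)}/r + g^{(-2)}/r² + o(r^{-2})`, `k = k^{(-2)}/r² + k^{(-3)}/r³ + o(r^{-3})`, where the
first expansion may be differentiated twice and the second once.  (The smoothness of the components
is a consequence of that of `g` and `k` and is recorded for convenience.) -/
structure IsAsymptoticallyFlat (D : InitialDataSet M) (Φ : OpenPartialHomeomorph M E3) :
    Prop where
  chart : Φ ∈ IsManifold.maximalAtlas 𝓘(ℝ, E3) ∞ M
  compact : IsCompact Φ.sourceᶜ
  target : ∃ R : ℝ, 0 < R ∧ Φ.target = (Metric.closedBall 0 R)ᶜ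
  g_smooth : ∀ i j, ContDiffOn ℝ ∞ (fun y => D.gComp Φ y i j) Φ.target
  k_smooth : ∀ i j, ContDiffOn ℝ ∞ (fun y => D.kComp Φ y i j) Φ.target
  g_expansion : ∀ i j, HasExpansionAtInfinity (fun y => D.gComp Φ y i j) (if i = j then 1 else 0) 1 2
  k_expansion : ∀ i j, HasExpansionAtInfinity (fun y => D.kComp Φ y i j) 0 2 1

/-- The Christoffel symbols `Γ^i_{jl}` of `g` in the coordinates `Φ`. -/
def christoffel (D : InitialDataSet M) (Φ : OpenPartialHomeomorph M E3) (y : E3)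
    (i j l : Fin 3) : ℝ :=
  let dg : Fin 3 → Fin 3 → Fin 3 → ℝ := fun a b c =>
    fderiv ℝ (fun z => D.gComp Φ z b c) y (EuclideanSpace.single a (1 : ℝ))
  1 / 2 * ∑ s, (D.gComp Φ y)⁻¹ i s * (dg j l s + dg l j s - dg s j l)

/-- The spacetime metric along `M` in the frame `(n, ∂₁, ∂₂, ∂₃)`, where `n` is the future unit normal
of `M`. -/
def spacetimeMetric (D : InitialDataSet M) (Φ : OpenPartialHomeomorph M E3) (y : E3) :
    Matrix (Fin 4) (Fin 4) ℝ :=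
  Matrix.of (Fin.cons (Fin.cons (-1) fun _ => 0) fun i => Fin.cons 0 fun j => D.gComp Φ y i j)

/-- The connection form of the spacetime connection along `M` in the frame `(n, ∂₁, ∂₂, ∂₃)`:
`∇_v n = k(v)^♯` and `∇_v ∂_j = Γ(v, ∂_j) + k(v, ∂_j) n`, so that `k(v, w) = ⟨∇_v n, w⟩` is the second
fundamental form of `M` in the spacetime. -/
def spacetimeConn (D : InitialDataSet M) (Φ : OpenPartialHomeomorph M E3) (y v : E3) :
    Matrix (Fin 4) (Fin 4) ℝ :=
  Matrix.of (Fin.cons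
    (Fin.cons 0 fun j => ∑ l, v l * D.kComp Φ y l j)
    fun i => Fin.cons
      (∑ s, ∑ l, (D.gComp Φ y)⁻¹ i s * v l * D.kComp Φ y l s)
      fun j => ∑ l, v l * D.christoffel Φ y i l j)

/-- The coordinate sphere `Σ_r`, parametrized by `x ↦ r x` for `x ∈ S²`, as a surface in the spacetime
that contains the initial data set. -/
def coordSphere (D : InitialDataSet M) (Φ : OpenPartialHomeomorph M E3) (r : ℝ) :
    SurfaceInSpacetime where
  metric := fun x => D.spacetimeMetric Φ (r • x)
  conn := fun x v => D.spacetimeConn Φ (r • x) (r • v)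
  diff := fun _ v => Fin.cons 0 fun i => r * v i

end InitialDataSet

/-! ### Total conserved quantities -/

/-- The expansion `X^0(r) = (X^0)^{(0)} + (X^0)^{(-1)}/r + o(r^{-1})`,
`X^i(r) = r X̃^i + (X^i)^{(0)} + (X^i)^{(-1)}/r + o(r^{-1})` of a family of maps from `S²`, with smooth
coefficients on `S²`, which may be differentiated three times along `S²`. -/
def HasEmbeddingExpansion (X : ℝ → E3 → Vec4) : Prop :=
  ∃ Y₀ Y₁ : E3 → Vec4, SphereSmooth Y₀ ∧ SphereSmooth Y₁ ∧
    ∀ m ≤ 3, ∀ ε > (0 : ℝ), ∀ᶠ r : ℝ in atTop, ∀ x ∈ Metric.sphere (0 : E3) 1,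
      ‖iteratedFDeriv ℝ m (radialExt fun y => X r y - r • (Fin.cons 0 fun i => y i : Vec4) -
        Y₀ y - r⁻¹ • Y₁ y) x‖ ≤ ε * r⁻¹

/-- The expansion `T₀(r) = (a^0, a^i) + T₀^{(-1)}/r + o(r^{-1})`. -/
def HasObserverExpansion (T₀ : ℝ → Vec4) : Prop :=
  ∃ a b : Vec4, (fun r => T₀ r - a - r⁻¹ • b) =o[atTop] fun r : ℝ => r⁻¹

/-- `C` is the total center of mass of the family of surfaces `S r`, with optimal isometric embeddings
`X r`, observers `T₀ r` and Lorentz transformations `A r`, where `m` is the total mass: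
`C^i = (1/m) lim E(Σ_r, X_r, T₀(r), A(r)(X^i ∂_0 + X^0 ∂_i))`, the limit being required to exist. -/
def IsTotalCenterOfMass (S : ℝ → SurfaceInSpacetime) (X : ℝ → E3 → Vec4) (T₀ : ℝ → Vec4)
    (A : ℝ → Matrix (Fin 4) (Fin 4) ℝ) (m : ℝ) (C : Fin 3 → ℝ) : Prop :=
  ∀ i, ∃ L : ℝ, Tendsto
    (fun r => conservedQuantity (S r) (X r) (T₀ r) (pushField (A r) (boostField i))) atTop (𝓝 L) ∧
    C i = 1 / m * L

/-- `𝓙` is the total angular momentum: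
`J_i = lim ε_{ijk} E(Σ_r, X_r, T₀(r), A(r)(X^j ∂_k - X^k ∂_j))`. -/
def IsTotalAngularMomentum (S : ℝ → SurfaceInSpacetime) (X : ℝ → E3 → Vec4) (T₀ : ℝ → Vec4)
    (A : ℝ → Matrix (Fin 4) (Fin 4) ℝ) (𝓙 : Fin 3 → ℝ) : Prop :=
  ∀ i, Tendsto (fun r => ∑ j, ∑ k, levi i j k *
    conservedQuantity (S r) (X r) (T₀ r) (pushField (A r) (rotationField j k))) atTop (𝓝 (𝓙 i))

end CWY

end

open CWY

/-! After every length on `Σ_r` is divided by `r`, the surfaces converge to the round unit sphere in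
a spacelike hyperplane, and all geometric data have expansions in `1/r` with smooth coefficients on
`S²`. A linear Killing field grows like `r` and the area like `r²`, while `ρ` is `O(r⁻²)` and `β`,
as a one-form on `S²`, is `O(r⁻¹)`; a conserved quantity is therefore a priori `O(r)`. More
precisely (`conservedQuantity_eq`) it is a finite combination, with convergent coefficients, of
terms `r ∫ f_r` with `f_r = c + d/r + o(1/r)`. Such a term converges as soon as `∫ c = 0`
(`Ex.exists_tendsto_mul_integral`), so only leading coefficients matter.

In the pairing with `ρ` the leading coefficient is `X̃^i ρ^{(-2)}`, or zero for the time component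
because `X^0` stays bounded. The first hypothesis handles this. In the pairing with `β` the
components involving `X^0` drop out again, and what remains is an infinitesimal rotation of `S²`
paired with the covector `ρ dτ - du - dφ + α`, where `u` comes from the `sinh⁻¹` term, `dφ` from
`α_{H₀}` and `α` from `α_H`. Each term is treated separately (`sphereIntegral_leading_rotation`): -
Rotations preserve the round measure, so exact forms integrate to zero against rotation fields
(`sphereIntegral_rotD`). - To leading order `τ/r` is the restriction of a linear function, so `ρ dτ`
produces only first moments of `ρ`. - Integration by parts identifies the pairings of `α` with
rotation fields with the first moments of its curl, which vanish by the second hypothesis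
(`sphereIntegral_rotation_of_curl`).

It remains to see that `α_{H₀}` is exact to leading order (`exists_potential_alphaH`). If the unit
timelike normal is `∂_0 + n/r + …` and `X^0 = y₀ + …`, then `r α_{H₀}` tends to `-x·dn`, while
orthogonality of the normal to the surface gives `dy₀ = n·dx`. Hence the limit is `d(y₀ - x·n)`.

The predicate `Ex N n` keeps track of the order `N` of the expansion and the number `n` of
tangential derivatives. Second order in the rescaled data is needed because `r²ρ` is `r(|H₀|² -
|H|²)`, in rescaled norms, times a regular factor, so one order is lost to the factor `r`. Of the
two derivatives available on the induced metric, `|H|` keeps one and `α_H` none. -/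

namespace CWY

/-! ### Differential calculus on the sphere -/

/-- The unit sphere. -/
abbrev S2 : Set E3 := Metric.sphere 0 1

/-- The derivative of a function on the sphere along the `i`-th tangential field. -/
noncomputable def sd (i : Fin 3) (f : E3 → ℝ) (x : E3) : ℝ := sphereD f x (tang x i)

lemma norm_eq_one_of_mem {x : E3} (hx : x ∈ S2) : ‖x‖ = 1 := by simpa using hx

lemma ne_zero_of_mem {x : E3} (hx : x ∈ S2) : x ≠ 0 := by
  intro h; have := norm_eq_one_of_mem hx; simp [h] at this

lemma normalize_mem {y : E3} (hy : y ≠ 0) : ‖y‖⁻¹ • y ∈ S2 := by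
  simp [norm_smul, inv_mul_cancel₀ (norm_ne_zero_iff.mpr hy)]

lemma radialExt_of_mem {F : Type*} (f : E3 → F) {x : E3} (hx : x ∈ S2) : radialExt f x = f x := by
  simp [radialExt, norm_eq_one_of_mem hx]

lemma radialExt_congr {F : Type*} {f g : E3 → F} (h : ∀ x ∈ S2, f x = g x) {y : E3} (hy : y ≠ 0) :
    radialExt f y = radialExt g y := h _ (normalize_mem hy)

lemma radialExt_eventuallyEq {F : Type*} {f g : E3 → F} (h : ∀ x ∈ S2, f x = g x) {y : E3}
    (hy : y ≠ 0) : radialExt f =ᶠ[𝓝 y] radialExt g := by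
  filter_upwards [isOpen_ne.mem_nhds hy] with z hz using radialExt_congr h hz

lemma sphereD_congr {F : Type*} [NormedAddCommGroup F] [NormedSpace ℝ F] {f g : E3 → F}
    (h : ∀ x ∈ S2, f x = g x) {x : E3} (hx : x ∈ S2) (v : E3) : sphereD f x v = sphereD g x v := by
  unfold sphereD
  rw [(radialExt_eventuallyEq h (ne_zero_of_mem hx)).fderiv_eq]

lemma sd_congr {f g : E3 → ℝ} (h : ∀ x ∈ S2, f x = g x) {x : E3} (hx : x ∈ S2) (i : Fin 3) :
    sd i f x = sd i g x := sphereD_congr h hx _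

/-- Differentiability at a point of a function on the sphere. -/
def SDiff {F : Type*} [NormedAddCommGroup F] [NormedSpace ℝ F] (f : E3 → F) (x : E3) : Prop :=
  DifferentiableAt ℝ (radialExt f) x

section SDiff
variable {f g : E3 → ℝ} {x : E3}

lemma SDiff.congr (hf : SDiff f x) (hx : x ∈ S2) (h : ∀ x ∈ S2, f x = g x) : SDiff g x :=
  DifferentiableAt.congr_of_eventuallyEq hf
    (radialExt_eventuallyEq (fun y hy => (h y hy).symm) (ne_zero_of_mem hx))

lemma SDiff.add (hf : SDiff f x) (hg : SDiff g x) : SDiff (fun y => f y + g y) x :=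
  DifferentiableAt.add hf hg

lemma SDiff.mul (hf : SDiff f x) (hg : SDiff g x) : SDiff (fun y => f y * g y) x :=
  DifferentiableAt.mul hf hg

lemma SDiff.inv (hf : SDiff f x) (hx : x ∈ S2) (h : f x ≠ 0) : SDiff (fun y => (f y)⁻¹) x :=
  DifferentiableAt.inv (h := radialExt f) hf (by rwa [radialExt_of_mem f hx])

lemma SDiff.sqrt (hf : SDiff f x) (hx : x ∈ S2) (h : f x ≠ 0) : SDiff (fun y => √(f y)) x :=
  DifferentiableAt.sqrt (f := radialExt f) hf (by rwa [radialExt_of_mem f hx])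

lemma sDiff_const (a : ℝ) : SDiff (fun _ => a) x := by
  unfold SDiff radialExt; fun_prop

lemma sd_add (hf : SDiff f x) (hg : SDiff g x) (i : Fin 3) :
    sd i (fun y => f y + g y) x = sd i f x + sd i g x := by
  have := fderiv_add hf hg
  change fderiv ℝ (radialExt f + radialExt g) x _ = _
  rw [this]; rfl

lemma sd_mul (hf : SDiff f x) (hg : SDiff g x) (hx : x ∈ S2) (i : Fin 3) :
    sd i (fun y => f y * g y) x = sd i f x * g x + f x * sd i g x := by
  have := fderiv_mul hf hg
  change fderiv ℝ (radialExt f * radialExt g) x _ = _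
  rw [this, radialExt_of_mem _ hx, radialExt_of_mem _ hx]
  simp only [add_apply, smul_apply, smul_eq_mul]
  unfold sd sphereD; ring

lemma sd_const (a : ℝ) (i : Fin 3) : sd i (fun _ => a) x = 0 := by
  have : radialExt (fun _ : E3 => a) = fun _ => a := rfl
  simp [sd, sphereD, this]

lemma sd_const_mul (a : ℝ) (i : Fin 3) : sd i (fun y => a * f y) x = a * sd i f x := by
  have : radialExt (fun y => a * f y) = a • radialExt f := rfl
  simp only [sd, sphereD, this]
  rw [fderiv_const_smul_field]; rfl

lemma sd_inv (hf : SDiff f x) (hx : x ∈ S2) (h : f x ≠ 0) (i : Fin 3) :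
    sd i (fun y => (f y)⁻¹) x = -(sd i f x * ((f x)⁻¹ * (f x)⁻¹)) := by
  have h' : radialExt f x ≠ 0 := by rwa [radialExt_of_mem f hx]
  have := (hasDerivAt_inv h').comp_hasFDerivAt x (DifferentiableAt.hasFDerivAt hf)
  change fderiv ℝ (Inv.inv ∘ radialExt f) x _ = _
  rw [this.fderiv, radialExt_of_mem f hx]
  simp only [smul_apply, smul_eq_mul, sd, sphereD]
  field_simp

lemma sd_sqrt (hf : SDiff f x) (hx : x ∈ S2) (h : f x ≠ 0) (i : Fin 3) :
    sd i (fun y => √(f y)) x = (1 / 2) * (sd i f x * (√(f x))⁻¹) := by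
  have h' : radialExt f x ≠ 0 := by rwa [radialExt_of_mem f hx]
  have := (DifferentiableAt.hasFDerivAt hf).sqrt h'
  change fderiv ℝ (fun y => √(radialExt f y)) x _ = _
  rw [this.fderiv, radialExt_of_mem f hx]
  simp only [smul_apply, smul_eq_mul, sd, sphereD]
  field_simp

lemma sd_arsinh (hf : SDiff f x) (hx : x ∈ S2) (i : Fin 3) :
    sd i (fun y => Real.arsinh (f y)) x = (√(1 + f x ^ 2))⁻¹ * sd i f x := by
  have := (DifferentiableAt.hasFDerivAt hf).arsinh
  change fderiv ℝ (fun y => Real.arsinh (radialExt f y)) x _ = _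
  rw [this.fderiv, radialExt_of_mem f hx]
  simp only [smul_apply, smul_eq_mul, sd, sphereD]

end SDiff

/-! ### Smooth functions on the sphere -/

lemma contDiffOn_normalize : ContDiffOn ℝ ∞ (fun y : E3 => ‖y‖⁻¹ • y) {0}ᶜ := by
  intro y hy
  have hy' : y ≠ 0 := by simpa using hy
  exact (((contDiffAt_norm ℝ hy').inv (norm_ne_zero_iff.mpr hy')).smul
    contDiffAt_id).contDiffWithinAt

lemma isOpen_compl_zero : IsOpen ({0}ᶜ : Set E3) := isOpen_compl_singleton

section Smooth
variable {f g : E3 → ℝ}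

lemma SphereSmooth.sDiff {F : Type*} [NormedAddCommGroup F] [NormedSpace ℝ F] {f : E3 → F}
    (hf : SphereSmooth f) {x : E3} (hx : x ∈ S2) : SDiff f x :=
  (ContDiffOn.contDiffAt hf (isOpen_compl_zero.mem_nhds (ne_zero_of_mem hx))).differentiableAt
    (by simp)

lemma SphereSmooth.continuousOn {F : Type*} [NormedAddCommGroup F] [NormedSpace ℝ F] {f : E3 → F}
    (hf : SphereSmooth f) : ContinuousOn f S2 := by
  have h1 : ContinuousOn (radialExt f) S2 :=
    (ContDiffOn.continuousOn hf).mono fun x hx => ne_zero_of_mem hx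
  exact h1.congr fun x hx => (radialExt_of_mem f hx).symm

lemma SphereSmooth.congr {F : Type*} [NormedAddCommGroup F] [NormedSpace ℝ F] {f g : E3 → F}
    (hf : SphereSmooth f) (h : ∀ x ∈ S2, f x = g x) : SphereSmooth g :=
  ContDiffOn.congr hf fun _ hy => (radialExt_congr h hy).symm

lemma sphereSmooth_of_contDiffOn {F : Type*} [NormedAddCommGroup F] [NormedSpace ℝ F] {f : E3 → F}
    (hf : ContDiffOn ℝ ∞ f {0}ᶜ) : SphereSmooth f :=
  hf.comp contDiffOn_normalize fun _ hy => ne_zero_of_mem (normalize_mem hy)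

lemma sphereSmooth_const (a : ℝ) : SphereSmooth (fun _ : E3 => a) :=
  sphereSmooth_of_contDiffOn contDiffOn_const

lemma sphereSmooth_coord (i : Fin 3) : SphereSmooth (fun x : E3 => x i) :=
  sphereSmooth_of_contDiffOn (by fun_prop)

lemma SphereSmooth.add (hf : SphereSmooth f) (hg : SphereSmooth g) :
    SphereSmooth (fun x => f x + g x) := ContDiffOn.add hf hg

lemma SphereSmooth.mul (hf : SphereSmooth f) (hg : SphereSmooth g) :
    SphereSmooth (fun x => f x * g x) := ContDiffOn.mul hf hg

lemma SphereSmooth.inv (hf : SphereSmooth f) (h : ∀ x ∈ S2, f x ≠ 0) :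
    SphereSmooth (fun x => (f x)⁻¹) :=
  ContDiffOn.inv (f := radialExt f) hf fun _ hy => h _ (normalize_mem hy)

lemma SphereSmooth.sqrt (hf : SphereSmooth f) (h : ∀ x ∈ S2, f x ≠ 0) :
    SphereSmooth (fun x => √(f x)) :=
  ContDiffOn.sqrt (f := radialExt f) hf fun _ hy => h _ (normalize_mem hy)

lemma tang_apply (x : E3) (i j : Fin 3) : tang x i j = (if j = i then 1 else 0) - x i * x j := by
  simp [tang, PiLp.sub_apply]

lemma contDiff_tang (i : Fin 3) : ContDiff ℝ ∞ (fun x => tang x i) := by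
  unfold tang
  fun_prop

lemma SphereSmooth.sd (hf : SphereSmooth f) (i : Fin 3) : SphereSmooth (sd i f) := by
  refine sphereSmooth_of_contDiffOn ?_
  have h1 : ContDiffOn ℝ ∞ (fderiv ℝ (radialExt f)) {0}ᶜ :=
    ContDiffOn.fderiv_of_isOpen hf isOpen_compl_zero (by simp)
  exact h1.clm_apply (contDiff_tang i).contDiffOn

end Smooth

lemma sum_sq_of_mem {x : E3} (hx : x ∈ S2) : ∑ i, x i * x i = 1 := by
  have := norm_eq_one_of_mem hx
  rw [EuclideanSpace.norm_eq, Real.sqrt_eq_one] at this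
  simpa [sq] using this

lemma sum_smul_tang {x : E3} (hx : x ∈ S2) : ∑ i, x i • tang x i = 0 := by
  ext j
  have h := sum_sq_of_mem hx
  have e : ∀ i, (x i • tang x i) j = (if j = i then x i else 0) - (x i * x i) * x j := by
    intro i; rw [PiLp.smul_apply, tang_apply, smul_eq_mul]; split_ifs <;> ring
  rw [WithLp.ofLp_sum, Finset.sum_apply]
  simp only [e, Finset.sum_sub_distrib, ← Finset.sum_mul, h]
  simp

lemma inner_tang {x : E3} (hx : x ∈ S2) (i : Fin 3) : inner ℝ x (tang x i) = 0 := by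
  simp [tang, inner_sub_right, inner_smul_right,
    norm_eq_one_of_mem hx, EuclideanSpace.inner_single_right]

lemma sum_mul_sd {x : E3} (hx : x ∈ S2) (f : E3 → ℝ) : ∑ i, x i * sd i f x = 0 := by
  have := congrArg (fderiv ℝ (radialExt f) x) (sum_smul_tang hx)
  simpa [map_sum, sd, sphereD] using this

/-- The radial extension of a coordinate is `y k / ‖y‖`, and the norm has zero derivative in
tangential directions. -/
lemma sd_coord {x : E3} (hx : x ∈ S2) (i k : Fin 3) :
    sd i (fun y : E3 => y k) x = tang x i k := by
  have hx0 := ne_zero_of_mem hx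
  have h1 : DifferentiableAt ℝ (fun y : E3 => ‖y‖⁻¹) x :=
    ((contDiffAt_norm ℝ hx0).inv (norm_ne_zero_iff.mpr hx0)).differentiableAt one_ne_zero
  have h2 : HasFDerivAt (fun y : E3 => y k) (EuclideanSpace.proj k : E3 →L[ℝ] ℝ) x :=
    (EuclideanSpace.proj k : E3 →L[ℝ] ℝ).hasFDerivAt
  have h3 := h1.hasFDerivAt.mul h2
  have hz : fderiv ℝ (fun y : E3 => ‖y‖⁻¹) x (tang x i) = 0 := by
    have h4 : HasFDerivAt (fun y : E3 => ‖y‖ ^ 2) (2 • innerSL ℝ x) x := by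
      simpa using (HasStrictFDerivAt.hasFDerivAt (hasStrictFDerivAt_norm_sq x))
    have h5 : (fun y : E3 => ‖y‖⁻¹) = fun y => (√(‖y‖ ^ 2))⁻¹ := by
      ext y; rw [Real.sqrt_sq (norm_nonneg _)]
    have h6 := (hasDerivAt_inv (x := √(‖x‖ ^ 2)) (by simpa using hx0)).comp_hasFDerivAt x
      (h4.sqrt (by simpa using hx0))
    rw [h5]
    have h7 : fderiv ℝ (fun y : E3 => (√(‖y‖ ^ 2))⁻¹) x = _ := h6.fderiv
    rw [h7]
    simp [inner_tang hx]
  have e : radialExt (fun y : E3 => y k) = fun y => ‖y‖⁻¹ * y k := by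
    ext y; simp [radialExt]
  unfold sd sphereD
  rw [e, show fderiv ℝ (fun y : E3 => ‖y‖⁻¹ * y k) x = _ from h3.fderiv]
  simp [hz, norm_eq_one_of_mem hx]

/-! ### Families of functions on the sphere with asymptotic expansions -/

/-- `f r → c` uniformly on the sphere as `r → ∞`, where the limit is smooth. -/
def SLimZero (f : ℝ → E3 → ℝ) (c : E3 → ℝ) : Prop :=
  SphereSmooth c ∧ (∀ᶠ r in atTop, ContinuousOn (f r) S2) ∧
    ∀ x ∈ S2, Tendsto (fun p : ℝ × E3 => f p.1 p.2) (atTop ×ˢ 𝓝[S2] x) (𝓝 (c x))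

/-- `f r → c` uniformly on the sphere as `r → ∞`, together with `n` tangential derivatives, where the
limit is smooth. -/
def SLim : ℕ → (ℝ → E3 → ℝ) → (E3 → ℝ) → Prop
  | 0, f, c => SLimZero f c
  | n + 1, f, c => SLimZero f c ∧ (∀ᶠ r in atTop, ∀ x ∈ S2, SDiff (f r) x) ∧
      ∀ i, SLim n (fun r => sd i (f r)) (sd i c)

/-! ### Calculus of limits that are uniform with derivatives -/

section SLim
variable {n : ℕ} {f g : ℝ → E3 → ℝ} {c d : E3 → ℝ}

lemma SLim.zero (h : SLim n f c) : SLim 0 f c := by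
  cases n with
  | zero => exact h
  | succ n => exact h.1

lemma SLim.smooth (h : SLim n f c) : SphereSmooth c := h.zero.1

lemma SLim.continuousOn (h : SLim n f c) : ∀ᶠ r in atTop, ContinuousOn (f r) S2 := h.zero.2.1

lemma SLim.tendsto (h : SLim n f c) {x : E3} (hx : x ∈ S2) :
    Tendsto (fun r => f r x) atTop (𝓝 (c x)) :=
  (h.zero.2.2 x hx).comp (tendsto_id.prodMk
    (tendsto_nhdsWithin_iff.mpr ⟨tendsto_const_nhds, Eventually.of_forall fun _ => hx⟩))

lemma SLim.sDiff (h : SLim (n + 1) f c) : ∀ᶠ r in atTop, ∀ x ∈ S2, SDiff (f r) x := h.2.1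

lemma SLim.sd (h : SLim (n + 1) f c) (i : Fin 3) : SLim n (fun r => sd i (f r)) (sd i c) := h.2.2 i

lemma SLim.mono_succ : ∀ {n : ℕ} {f : ℝ → E3 → ℝ} {c : E3 → ℝ}, SLim (n + 1) f c → SLim n f c := by
  intro n
  induction n with
  | zero => intro f c h; exact h.1
  | succ n ih => intro f c h; exact ⟨h.1, h.2.1, fun i => ih (h.2.2 i)⟩

lemma SLim.congr : ∀ {n : ℕ} {f g : ℝ → E3 → ℝ} {c : E3 → ℝ}, SLim n f c →
    (∀ᶠ r in atTop, ∀ x ∈ S2, f r x = g r x) → SLim n g c := by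
  have base : ∀ {f g : ℝ → E3 → ℝ} {c : E3 → ℝ}, SLim 0 f c →
      (∀ᶠ r in atTop, ∀ x ∈ S2, f r x = g r x) → SLim 0 g c := by
    rintro f g c ⟨h1, h2, h3⟩ h
    refine ⟨h1, ?_, fun x hx => ?_⟩
    · filter_upwards [h, h2] with r hr hc using hc.congr fun x hx => (hr x hx).symm
    · refine (h3 x hx).congr' ?_
      filter_upwards [h.prod_mk self_mem_nhdsWithin] with p hp using hp.1 _ hp.2
  intro n
  induction n with
  | zero => exact base
  | succ n ih =>
    intro f g c hf h
    refine ⟨base hf.1 h, ?_, fun i => ih (hf.2.2 i) ?_⟩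
    · filter_upwards [h, hf.2.1] with r hr hd x hx using (hd x hx).congr hx hr
    · filter_upwards [h] with r hr x hx using sd_congr hr hx i

lemma SLim.congr_lim : ∀ {n : ℕ} {f : ℝ → E3 → ℝ} {c d : E3 → ℝ}, SLim n f c →
    (∀ x ∈ S2, c x = d x) → SLim n f d := by
  have base : ∀ {f : ℝ → E3 → ℝ} {c d : E3 → ℝ}, SLim 0 f c →
      (∀ x ∈ S2, c x = d x) → SLim 0 f d := by
    rintro f c d ⟨h1, h2, h3⟩ h
    exact ⟨h1.congr h, h2, fun x hx => h x hx ▸ h3 x hx⟩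
  intro n
  induction n with
  | zero => exact base
  | succ n ih =>
    intro f c d hf h
    exact ⟨base hf.1 h, hf.2.1, fun i => ih (hf.2.2 i) fun x hx => sd_congr h hx i⟩

/-- Compactness of the sphere turns convergence along `atTop ×ˢ 𝓝[S2] x` at each point into a
statement uniform in `x`. This provides the eventual nonvanishing, positivity and boundedness used
below. -/
lemma SLim.eventually_mem (h : SLim n f c) {O : Set ℝ} (hO : IsOpen O) (hc : ∀ x ∈ S2, c x ∈ O) :
    ∀ᶠ r in atTop, ∀ x ∈ S2, f r x ∈ O := by
  have hcomp : IsCompact S2 := isCompact_sphere _ _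
  refine hcomp.induction_on (p := fun s => ∀ᶠ r in atTop, ∀ x ∈ s, f r x ∈ O) (by simp) ?_ ?_ ?_
  · intro s t hst ht
    filter_upwards [ht] with r hr x hx using hr x (hst hx)
  · intro s t hs ht
    filter_upwards [hs, ht] with r h1 h2 x hx using hx.elim (h1 x) (h2 x)
  · intro x hx
    have := h.zero.2.2 x hx (hO.mem_nhds (hc x hx))
    obtain ⟨u, hu, v, hv, huv⟩ := mem_prod_iff.mp this
    refine ⟨v, hv, ?_⟩
    filter_upwards [hu] with r hr y hy
    exact huv (Set.mk_mem_prod hr hy)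

lemma SLim.eventually_ne (h : SLim n f c) (hc : ∀ x ∈ S2, c x ≠ 0) :
    ∀ᶠ r in atTop, ∀ x ∈ S2, f r x ≠ 0 :=
  h.eventually_mem (O := {0}ᶜ) isOpen_compl_singleton hc

lemma SLim.eventually_pos (h : SLim n f c) (hc : ∀ x ∈ S2, 0 < c x) :
    ∀ᶠ r in atTop, ∀ x ∈ S2, 0 < f r x :=
  h.eventually_mem (O := Set.Ioi 0) isOpen_Ioi hc

lemma SLim.const : ∀ {n : ℕ} {c : E3 → ℝ}, SphereSmooth c → SLim n (fun _ => c) c := by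
  have base : ∀ {c : E3 → ℝ}, SphereSmooth c → SLim 0 (fun _ => c) c := by
    intro c hc
    exact ⟨hc, Eventually.of_forall fun _ => hc.continuousOn, fun x hx =>
      (hc.continuousOn x hx).tendsto.comp tendsto_snd⟩
  intro n
  induction n with
  | zero => exact base
  | succ n ih =>
    intro c hc
    exact ⟨base hc, Eventually.of_forall fun _ x hx => hc.sDiff hx, fun i => ih (hc.sd i)⟩

lemma SLim.scalar : ∀ {n : ℕ} {t : ℝ → ℝ} {a : ℝ}, Tendsto t atTop (𝓝 a) →
    SLim n (fun r _ => t r) (fun _ => a) := by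
  have base : ∀ {t : ℝ → ℝ} {a : ℝ}, Tendsto t atTop (𝓝 a) →
      SLim 0 (fun r _ => t r) (fun _ => a) := by
    intro t a ht
    exact ⟨sphereSmooth_const a, Eventually.of_forall fun _ => continuousOn_const, fun x hx =>
      ht.comp tendsto_fst⟩
  intro n t a ht
  cases n with
  | zero => exact base ht
  | succ n =>
    refine ⟨base ht, Eventually.of_forall fun _ x _ => sDiff_const _, fun i => ?_⟩
    have h0 : ∀ b : ℝ, CWY.sd i (fun _ : E3 => b) = fun _ => (0 : ℝ) := fun b =>
      funext fun x => sd_const b i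
    simp only [h0]
    exact SLim.const (sphereSmooth_const 0)

lemma SLim.add : ∀ {n : ℕ} {f g : ℝ → E3 → ℝ} {c d : E3 → ℝ}, SLim n f c → SLim n g d →
    SLim n (fun r x => f r x + g r x) (fun x => c x + d x) := by
  have base : ∀ {f g : ℝ → E3 → ℝ} {c d : E3 → ℝ}, SLim 0 f c → SLim 0 g d →
      SLim 0 (fun r x => f r x + g r x) (fun x => c x + d x) := by
    rintro f g c d ⟨h1, h2, h3⟩ ⟨k1, k2, k3⟩
    refine ⟨h1.add k1, ?_, fun x hx => (h3 x hx).add (k3 x hx)⟩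
    filter_upwards [h2, k2] with r hr kr using hr.add kr
  intro n
  induction n with
  | zero => exact base
  | succ n ih =>
    intro f g c d hf hg
    refine ⟨base hf.1 hg.1, ?_, fun i => ?_⟩
    · filter_upwards [hf.2.1, hg.2.1] with r h1 h2 x hx using (h1 x hx).add (h2 x hx)
    · refine ((ih (hf.2.2 i) (hg.2.2 i)).congr ?_).congr_lim ?_
      · filter_upwards [hf.2.1, hg.2.1] with r h1 h2 x hx
        exact (sd_add (h1 x hx) (h2 x hx) i).symm
      · intro x hx
        exact (sd_add (hf.smooth.sDiff hx) (hg.smooth.sDiff hx) i).symm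

lemma SLim.mul : ∀ {n : ℕ} {f g : ℝ → E3 → ℝ} {c d : E3 → ℝ}, SLim n f c → SLim n g d →
    SLim n (fun r x => f r x * g r x) (fun x => c x * d x) := by
  have base : ∀ {f g : ℝ → E3 → ℝ} {c d : E3 → ℝ}, SLim 0 f c → SLim 0 g d →
      SLim 0 (fun r x => f r x * g r x) (fun x => c x * d x) := by
    rintro f g c d ⟨h1, h2, h3⟩ ⟨k1, k2, k3⟩
    refine ⟨h1.mul k1, ?_, fun x hx => (h3 x hx).mul (k3 x hx)⟩
    filter_upwards [h2, k2] with r hr kr using hr.mul kr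
  intro n
  induction n with
  | zero => exact base
  | succ n ih =>
    intro f g c d hf hg
    refine ⟨base hf.1 hg.1, ?_, fun i => ?_⟩
    · filter_upwards [hf.2.1, hg.2.1] with r h1 h2 x hx using (h1 x hx).mul (h2 x hx)
    · refine (((ih (hf.2.2 i) hg.mono_succ).add (ih hf.mono_succ (hg.2.2 i))).congr ?_).congr_lim ?_
      · filter_upwards [hf.2.1, hg.2.1] with r h1 h2 x hx
        exact (sd_mul (h1 x hx) (h2 x hx) hx i).symm
      · intro x hx
        exact (sd_mul (hf.smooth.sDiff hx) (hg.smooth.sDiff hx) hx i).symm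

lemma SLim.const_mul (a : ℝ) (hf : SLim n f c) : SLim n (fun r x => a * f r x) (fun x => a * c x) :=
  (SLim.const (sphereSmooth_const a)).mul hf

lemma SLim.inv : ∀ {n : ℕ} {f : ℝ → E3 → ℝ} {c : E3 → ℝ}, SLim n f c → (∀ x ∈ S2, c x ≠ 0) →
    SLim n (fun r x => (f r x)⁻¹) (fun x => (c x)⁻¹) := by
  have base : ∀ {f : ℝ → E3 → ℝ} {c : E3 → ℝ}, SLim 0 f c → (∀ x ∈ S2, c x ≠ 0) →
      SLim 0 (fun r x => (f r x)⁻¹) (fun x => (c x)⁻¹) := by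
    intro f c h hc
    refine ⟨h.1.inv hc, ?_, fun x hx => (h.2.2 x hx).inv₀ (hc x hx)⟩
    filter_upwards [h.2.1, h.eventually_ne hc] with r hr kr using hr.inv₀ kr
  intro n
  induction n with
  | zero => exact base
  | succ n ih =>
    intro f c hf hc
    have hne := hf.eventually_ne hc
    refine ⟨base hf.1 hc, ?_, fun i => ?_⟩
    · filter_upwards [hf.2.1, hne] with r h1 h2 x hx using (h1 x hx).inv hx (h2 x hx)
    · have hi := ih hf.mono_succ hc
      refine ((((hf.2.2 i).mul (hi.mul hi)).const_mul (-1)).congr ?_).congr_lim ?_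
      · filter_upwards [hf.2.1, hne] with r h1 h2 x hx
        rw [sd_inv (h1 x hx) hx (h2 x hx) i]; ring
      · intro x hx
        rw [sd_inv (hf.smooth.sDiff hx) hx (hc x hx) i]; ring

lemma SLim.sqrt : ∀ {n : ℕ} {f : ℝ → E3 → ℝ} {c : E3 → ℝ}, SLim n f c → (∀ x ∈ S2, 0 < c x) →
    SLim n (fun r x => √(f r x)) (fun x => √(c x)) := by
  have base : ∀ {f : ℝ → E3 → ℝ} {c : E3 → ℝ}, SLim 0 f c → (∀ x ∈ S2, 0 < c x) →
      SLim 0 (fun r x => √(f r x)) (fun x => √(c x)) := by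
    intro f c h hc
    refine ⟨h.1.sqrt fun x hx => (hc x hx).ne', ?_, fun x hx => (h.2.2 x hx).sqrt⟩
    filter_upwards [h.2.1] with r hr using hr.sqrt
  intro n
  induction n with
  | zero => exact base
  | succ n ih =>
    intro f c hf hc
    have hc' : ∀ x ∈ S2, c x ≠ 0 := fun x hx => (hc x hx).ne'
    have hne := hf.eventually_ne hc'
    refine ⟨base hf.1 hc, ?_, fun i => ?_⟩
    · filter_upwards [hf.2.1, hne] with r h1 h2 x hx using (h1 x hx).sqrt hx (h2 x hx)
    · have hi := (ih hf.mono_succ hc).inv fun x hx => (Real.sqrt_pos.mpr (hc x hx)).ne'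
      refine ((((hf.2.2 i).mul hi).const_mul (1 / 2)).congr ?_).congr_lim ?_
      · filter_upwards [hf.2.1, hne] with r h1 h2 x hx
        rw [sd_sqrt (h1 x hx) hx (h2 x hx) i]
      · intro x hx
        rw [sd_sqrt (hf.smooth.sDiff hx) hx (hc' x hx) i]

lemma SLim.inv_mul (hf : SLim n f c) : SLim n (fun r x => r⁻¹ * f r x) (fun _ => 0) :=
  ((SLim.scalar tendsto_inv_atTop_zero).mul hf).congr_lim fun _ _ => zero_mul _

end SLim

/-- `f r = c + c₁ / r + ⋯ + c_N / r ^ N + o(r ^ (-N))` uniformly on the sphere together with `n`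
tangential derivatives, where the coefficients are smooth. -/
def Ex : ℕ → ℕ → (ℝ → E3 → ℝ) → (E3 → ℝ) → Prop
  | 0, n, f, c => SLim n f c
  | N + 1, n, f, c => SphereSmooth c ∧ ∃ d, Ex N n (fun r x => r * (f r x - c x)) d

/-! ### Algebra and differentiation of expansions in `1/r` -/

section Ex
variable {N n : ℕ} {f g : ℝ → E3 → ℝ} {c d : E3 → ℝ}

lemma Ex.smooth (h : Ex N n f c) : SphereSmooth c := by
  cases N with
  | zero => exact SLim.smooth h
  | succ N => exact h.1

lemma Ex.congr : ∀ {N : ℕ} {f g : ℝ → E3 → ℝ} {c : E3 → ℝ}, Ex N n f c →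
    (∀ᶠ r in atTop, ∀ x ∈ S2, f r x = g r x) → Ex N n g c := by
  intro N
  induction N with
  | zero => intro f g c h e; exact SLim.congr h e
  | succ N ih =>
    rintro f g c ⟨hc, d, hd⟩ e
    refine ⟨hc, d, ih hd ?_⟩
    filter_upwards [e] with r hr x hx
    rw [hr x hx]

lemma Ex.congr_lim (h : Ex N n f c) (e : ∀ x ∈ S2, c x = d x) : Ex N n f d := by
  cases N with
  | zero => exact SLim.congr_lim h e
  | succ N =>
    obtain ⟨hc, b, hb⟩ := h
    refine ⟨hc.congr e, b, hb.congr (Eventually.of_forall fun r x hx => ?_)⟩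
    rw [e x hx]

lemma Ex.const : ∀ {N : ℕ} {c : E3 → ℝ}, SphereSmooth c → Ex N n (fun _ => c) c := by
  intro N
  induction N with
  | zero => intro c hc; exact SLim.const hc
  | succ N ih =>
    intro c hc
    exact ⟨hc, fun _ => 0, (ih (sphereSmooth_const 0)).congr
      (Eventually.of_forall fun r x hx => by simp)⟩

lemma Ex.of_scaled (h : Ex N n f d) : Ex (N + 1) n (fun r x => r⁻¹ * f r x) (fun _ => 0) := by
  refine ⟨sphereSmooth_const 0, d, h.congr ?_⟩
  filter_upwards [eventually_ne_atTop 0] with r hr x hx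
  field_simp; ring

/-- A vanishing leading coefficient may be traded for a factor `r`, at the cost of one order. -/
lemma Ex.scaled (h : Ex (N + 1) n f (fun _ => 0)) : ∃ d, Ex N n (fun r x => r * f r x) d := by
  obtain ⟨_, d, hd⟩ := h
  exact ⟨d, hd.congr (Eventually.of_forall fun r x hx => by simp)⟩

lemma Ex.add : ∀ {N : ℕ} {f g : ℝ → E3 → ℝ} {c d : E3 → ℝ}, Ex N n f c → Ex N n g d →
    Ex N n (fun r x => f r x + g r x) (fun x => c x + d x) := by
  intro N
  induction N with
  | zero => intro f g c d hf hg; exact SLim.add hf hg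
  | succ N ih =>
    rintro f g c d ⟨hc, c', hc'⟩ ⟨hd, d', hd'⟩
    exact ⟨hc.add hd, _, (ih hc' hd').congr (Eventually.of_forall fun r x hx => by ring)⟩

lemma Ex.mono_succ : ∀ {N : ℕ} {f : ℝ → E3 → ℝ} {c : E3 → ℝ}, Ex (N + 1) n f c → Ex N n f c := by
  intro N
  induction N with
  | zero =>
    rintro f c ⟨hc, d, hd⟩
    refine (((SLim.inv_mul hd).add (SLim.const hc)).congr ?_).congr_lim fun x _ => zero_add _
    filter_upwards [eventually_ne_atTop 0] with r hr x hx
    field_simp; ring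
  | succ N ih =>
    rintro f c ⟨hc, d, hd⟩
    exact ⟨hc, d, ih hd⟩

lemma Ex.mono {N' : ℕ} (h : Ex N n f c) (hN : N' ≤ N) : Ex N' n f c := by
  induction N, hN using Nat.le_induction with
  | base => exact h
  | succ N _ ih => exact ih h.mono_succ

lemma Ex.sLim (h : Ex N n f c) : SLim n f c := h.mono (Nat.zero_le N)

lemma Ex.mul : ∀ {N : ℕ} {f g : ℝ → E3 → ℝ} {c d : E3 → ℝ}, Ex N n f c → Ex N n g d →
    Ex N n (fun r x => f r x * g r x) (fun x => c x * d x) := by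
  intro N
  induction N with
  | zero => intro f g c d hf hg; exact SLim.mul hf hg
  | succ N ih =>
    intro f g c d hf hg
    obtain ⟨hc, c', hc'⟩ := hf
    obtain ⟨hd, d', hd'⟩ := id hg
    -- Here `r(fg - cd) = r(f - c) g + c r(g - d)`, so `g` is needed only to order `N`.
    exact ⟨hc.mul hd, _, ((ih hc' hg.mono_succ).add (ih (Ex.const hc) hd')).congr
      (Eventually.of_forall fun r x hx => by ring)⟩

lemma Ex.const_mul (a : ℝ) (hf : Ex N n f c) : Ex N n (fun r x => a * f r x) (fun x => a * c x) :=
  (Ex.const (sphereSmooth_const a)).mul hf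

lemma Ex.neg (hf : Ex N n f c) : Ex N n (fun r x => -f r x) (fun x => -c x) :=
  ((hf.const_mul (-1)).congr (Eventually.of_forall fun r x hx => by ring)).congr_lim
    fun x _ => by ring

lemma Ex.sub (hf : Ex N n f c) (hg : Ex N n g d) :
    Ex N n (fun r x => f r x - g r x) (fun x => c x - d x) :=
  ((hf.add hg.neg).congr (Eventually.of_forall fun r x hx => by ring)).congr_lim
    fun x _ => by ring

lemma Ex.sum {ι : Type*} (s : Finset ι) {f : ι → ℝ → E3 → ℝ} {c : ι → E3 → ℝ}
    (h : ∀ i ∈ s, Ex N n (f i) (c i)) :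
    Ex N n (fun r x => ∑ i ∈ s, f i r x) (fun x => ∑ i ∈ s, c i x) := by
  classical
  induction s using Finset.induction_on with
  | empty => simpa using Ex.const (sphereSmooth_const 0)
  | insert a s ha ih =>
    simp only [Finset.sum_insert ha]
    exact (h a (by simp)).add (ih fun i hi => h i (by simp [hi]))

lemma Ex.inv : ∀ {N : ℕ}, Ex N n f c → (∀ x ∈ S2, c x ≠ 0) →
    Ex N n (fun r x => (f r x)⁻¹) (fun x => (c x)⁻¹) := by
  intro N
  induction N with
  | zero => intro hf hc; exact SLim.inv hf hc
  | succ N ih =>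
    intro hf h0
    have hne := hf.sLim.eventually_ne h0
    have hi := ih hf.mono_succ h0
    obtain ⟨hc, c', hc'⟩ := hf
    -- Here `r(1/f - 1/c) = -r(f - c) · (1/f) · (1/c)`, where `1/f` has order `N` by induction.
    refine ⟨hc.inv h0, _, ((hc'.mul (hi.mul (Ex.const (hc.inv h0)))).const_mul (-1)).congr ?_⟩
    filter_upwards [hne] with r hr x hx
    have h1 := hr x hx
    have h2 := h0 x hx
    field_simp; ring

lemma Ex.sqrt : ∀ {N : ℕ}, Ex N n f c → (∀ x ∈ S2, 0 < c x) →
    Ex N n (fun r x => √(f r x)) (fun x => √(c x)) := by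
  intro N
  induction N with
  | zero => intro hf hc; exact SLim.sqrt hf hc
  | succ N ih =>
    intro hf h0
    have hpos := hf.sLim.eventually_pos h0
    have hs := ih hf.mono_succ h0
    obtain ⟨hc, c', hc'⟩ := hf
    have hcs := hc.sqrt fun x hx => (h0 x hx).ne'
    -- Rationalization: `r(√f - √c) = r(f - c) / (√f + √c)`.
    refine ⟨hcs, _, (hc'.mul ((hs.add (Ex.const hcs)).inv fun x hx => ?_)).congr ?_⟩
    · have := Real.sqrt_pos.mpr (h0 x hx); positivity
    · filter_upwards [hpos] with r hr x hx
      have h1 := Real.sqrt_pos.mpr (hr x hx)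
      have h2 := Real.sqrt_pos.mpr (h0 x hx)
      have h3 := Real.mul_self_sqrt (hr x hx).le
      have h4 := Real.mul_self_sqrt (h0 x hx).le
      have h5 : √(f r x) + √(c x) ≠ 0 := by positivity
      field_simp
      linear_combination r * (h4 - h3)

lemma Ex.sd : ∀ {N : ℕ} {f : ℝ → E3 → ℝ} {c : E3 → ℝ}, Ex N (n + 1) f c → ∀ i,
    Ex N n (fun r => sd i (f r)) (sd i c) := by
  intro N
  induction N with
  | zero => intro f c h i; exact SLim.sd h i
  | succ N ih =>
    intro f c h i
    have hdiff := h.sLim.sDiff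
    obtain ⟨hc, d, hd⟩ := h
    refine ⟨hc.sd i, _, (ih hd i).congr ?_⟩
    filter_upwards [hdiff] with r hr x hx
    have e : (fun y => f r y - c y) = fun y => f r y + (-1) * c y := by ext y; ring
    have hm : SDiff (fun y => (-1) * c y) x := (sDiff_const _).mul (hc.sDiff hx)
    rw [sd_const_mul r, e, sd_add (hr x hx) hm, sd_const_mul]
    ring

lemma Ex.mono_right : ∀ {N : ℕ} {f : ℝ → E3 → ℝ} {c : E3 → ℝ}, Ex N (n + 1) f c → Ex N n f c := by
  intro N
  induction N with
  | zero => intro f c h; exact SLim.mono_succ h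
  | succ N ih => rintro f c ⟨hc, d, hd⟩; exact ⟨hc, d, ih hd⟩

lemma Ex.mono_right' {n' : ℕ} (h : Ex N n f c) (hn : n' ≤ n) : Ex N n' f c := by
  induction n, hn using Nat.le_induction with
  | base => exact h
  | succ N _ ih => exact ih h.mono_right

lemma Ex.tendsto (h : Ex N n f c) {x : E3} (hx : x ∈ S2) :
    Tendsto (fun r => f r x) atTop (𝓝 (c x)) := h.sLim.tendsto hx

lemma Ex.sDiff (h : Ex N (n + 1) f c) : ∀ᶠ r in atTop, ∀ x ∈ S2, SDiff (f r) x := h.sLim.sDiff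

lemma Ex.unique (h : Ex N n f c) {x : E3} (hx : x ∈ S2) {a : ℝ}
    (ha : Tendsto (fun r => f r x) atTop (𝓝 a)) : c x = a :=
  tendsto_nhds_unique (h.tendsto hx) ha

/-- This is how remainders `o(r⁻²)` enter the calculus: they are second-order expansions whose
coefficients all vanish (the case `c = 0`). -/
lemma SLim.ex_sq (h : SLim n (fun r x => r ^ 2 * f r x) c) : Ex 2 n f (fun _ => 0) := by
  have h0 : Ex 0 n (fun r x => r ^ 2 * f r x) c := h
  refine h0.of_scaled.of_scaled.congr ?_
  filter_upwards [eventually_ne_atTop 0] with r hr x hx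
  field_simp

end Ex

/-! ### Integrals over the sphere -/

lemma tendsto_sphereIntegral {f : ℝ → E3 → ℝ} {c : E3 → ℝ} (h : SLim 0 f c) :
    Tendsto (fun r => sphereIntegral (f r)) atTop (𝓝 (sphereIntegral c)) := by
  unfold sphereIntegral
  have hlim : ∀ x ∈ S2, Tendsto (fun r => f r x) atTop (𝓝 (c x)) := fun x hx => h.tendsto hx
  obtain ⟨K, hK⟩ := (isCompact_sphere (0 : E3) 1).exists_bound_of_continuousOn
    h.smooth.continuousOn
  have hb := h.eventually_mem (O := Metric.ball 0 (K + 1)) Metric.isOpen_ball fun x hx => by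
    have := hK x hx
    simp only [Metric.mem_ball, dist_zero_right]; linarith
  refine tendsto_integral_filter_of_dominated_convergence (fun _ => K + 1) ?_ ?_ ?_ ?_
  · filter_upwards [h.continuousOn] with r hr
    exact (continuousOn_iff_continuous_domRestrict.mp hr).aestronglyMeasurable
  · filter_upwards [hb] with r hr
    refine Eventually.of_forall fun x => ?_
    have := hr x x.2
    simp only [Metric.mem_ball, dist_zero_right] at this
    exact this.le
  · exact integrable_const _
  · exact Eventually.of_forall fun x => hlim x x.2

lemma sphereIntegrable {f : E3 → ℝ} (h : ContinuousOn f S2) :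
    Integrable (fun x : Metric.sphere (0 : E3) 1 => f x) (volume : Measure E3).toSphere :=
  (continuousOn_iff_continuous_domRestrict.mp h).integrable_of_hasCompactSupport
    (HasCompactSupport.of_compactSpace _)

lemma sphereIntegral_congr {f g : E3 → ℝ} (h : ∀ x ∈ S2, f x = g x) :
    sphereIntegral f = sphereIntegral g :=
  integral_congr_ae (Eventually.of_forall fun x => h x x.2)

lemma sphereIntegral_add {f g : E3 → ℝ} (hf : ContinuousOn f S2) (hg : ContinuousOn g S2) :
    sphereIntegral (fun x => f x + g x) = sphereIntegral f + sphereIntegral g :=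
  integral_add (sphereIntegrable hf) (sphereIntegrable hg)

lemma sphereIntegral_const_mul (a : ℝ) (f : E3 → ℝ) :
    sphereIntegral (fun x => a * f x) = a * sphereIntegral f := integral_const_mul _ _

lemma sphereIntegral_sum {ι : Type*} (s : Finset ι) {f : ι → E3 → ℝ}
    (hf : ∀ i ∈ s, ContinuousOn (f i) S2) :
    sphereIntegral (fun x => ∑ i ∈ s, f i x) = ∑ i ∈ s, sphereIntegral (f i) :=
  integral_finsetSum s fun i hi => sphereIntegrable (hf i hi)

/-- If the leading coefficient has vanishing integral, then `r ∫ f r` converges. -/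
lemma Ex.exists_tendsto_mul_integral {f : ℝ → E3 → ℝ} {c : E3 → ℝ} (h : Ex 1 0 f c)
    (hc : sphereIntegral c = 0) :
    ∃ L, Tendsto (fun r => r * sphereIntegral (f r)) atTop (𝓝 L) := by
  have hcont := h.sLim.continuousOn
  obtain ⟨hs, d, hd⟩ := h
  refine ⟨_, (tendsto_sphereIntegral hd).congr' ?_⟩
  filter_upwards [hcont] with r hr
  have e : (fun x => r * (f r x - c x)) = fun x => r * (f r x + (-1) * c x) := by ext; ring
  rw [e, sphereIntegral_const_mul, sphereIntegral_add (g := fun x => (-1) * c x) hr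
    (continuousOn_const.mul hs.continuousOn), sphereIntegral_const_mul, hc]
  ring

/-! ### Behaviour of surface data under rescaling -/

/-- The one-forms `diff` and `conn` only see the tangential part of a vector. -/
structure SurfaceInSpacetime.Radial (S : SurfaceInSpacetime) : Prop where
  diff : ∀ x ∈ S2, ∑ i, x i • S.diff x (tang x i) = 0
  conn : ∀ x ∈ S2, ∑ i, x i • S.conn x (tang x i) = 0

/-- The surface with tangent vectors divided by `c`. -/
noncomputable def SurfaceInSpacetime.rescale (c : ℝ) (S : SurfaceInSpacetime) :
    SurfaceInSpacetime where
  metric := S.metric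
  conn := S.conn
  diff := fun x v => c⁻¹ • S.diff x v

/-- The projection to the normal line of the sphere. -/
def radialProj (x : E3) : Matrix (Fin 3) (Fin 3) ℝ := Matrix.of fun i j => x i * x j

section Gram
variable {σ : E3 → E3 → E3 → ℝ} {x : E3}

lemma radialProj_mul_self (hx : x ∈ S2) : radialProj x * radialProj x = radialProj x := by
  ext i j
  simp only [radialProj, Matrix.mul_apply, Matrix.of_apply]
  calc ∑ k, x i * x k * (x k * x j) = x i * x j * ∑ k, x k * x k := by
        rw [Finset.mul_sum]; exact Finset.sum_congr rfl fun k _ => by ring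
    _ = x i * x j := by rw [sum_sq_of_mem hx, mul_one]

lemma gram_mul_radialProj (hx : x ∈ S2) (h : ∀ i, ∑ j, x j * σ x (tang x i) (tang x j) = 0) :
    gram σ x * radialProj x = radialProj x := by
  ext i j
  simp only [gram, radialProj, Matrix.mul_apply, Matrix.of_apply]
  calc ∑ k, (σ x (tang x i) (tang x k) + x i * x k) * (x k * x j)
      = x j * (∑ k, x k * σ x (tang x i) (tang x k)) + x i * x j * ∑ k, x k * x k := by
        rw [Finset.mul_sum, Finset.mul_sum, ← Finset.sum_add_distrib]
        exact Finset.sum_congr rfl fun k _ => by ring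
    _ = x i * x j := by rw [sum_sq_of_mem hx, h]; ring

lemma radialProj_mul_gram (hx : x ∈ S2) (h : ∀ i, ∑ j, x j * σ x (tang x j) (tang x i) = 0) :
    radialProj x * gram σ x = radialProj x := by
  ext i j
  simp only [gram, radialProj, Matrix.mul_apply, Matrix.of_apply]
  calc ∑ k, x i * x k * (σ x (tang x k) (tang x j) + x k * x j)
      = x i * (∑ k, x k * σ x (tang x k) (tang x j)) + x i * x j * ∑ k, x k * x k := by
        rw [Finset.mul_sum, Finset.mul_sum, ← Finset.sum_add_distrib]
        exact Finset.sum_congr rfl fun k _ => by ring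
    _ = x i * x j := by rw [sum_sq_of_mem hx, h]; ring

end Gram

namespace SurfaceInSpacetime

lemma ip_smul_left (S : SurfaceInSpacetime) (x : E3) (a : ℝ) (u w : Vec4) :
    S.ip x (a • u) w = a * S.ip x u w := by
  simp [ip, smul_dotProduct]

lemma ip_smul_right (S : SurfaceInSpacetime) (x : E3) (a : ℝ) (u w : Vec4) :
    S.ip x u (a • w) = a * S.ip x u w := by
  simp [ip, Matrix.mulVec_smul, dotProduct_smul]

lemma ip_sum_left (S : SurfaceInSpacetime) (x : E3) {ι : Type*} (s : Finset ι) (u : ι → Vec4)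
    (w : Vec4) : S.ip x (∑ i ∈ s, u i) w = ∑ i ∈ s, S.ip x (u i) w := by
  simp [ip, sum_dotProduct]

lemma ip_sum_right (S : SurfaceInSpacetime) (x : E3) {ι : Type*} (s : Finset ι) (u : Vec4)
    (w : ι → Vec4) : S.ip x u (∑ i ∈ s, w i) = ∑ i ∈ s, S.ip x u (w i) := by
  simp [ip, Matrix.mulVec_sum, dotProduct_sum]

lemma ip_zero_left (S : SurfaceInSpacetime) (x : E3) (w : Vec4) : S.ip x 0 w = 0 := by simp [ip]

lemma ip_zero_right (S : SurfaceInSpacetime) (x : E3) (w : Vec4) : S.ip x w 0 = 0 := by simp [ip]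

lemma ip_sub_left (S : SurfaceInSpacetime) (x : E3) (u v w : Vec4) :
    S.ip x (u - v) w = S.ip x u w - S.ip x v w := by simp [ip, sub_dotProduct]

variable {S : SurfaceInSpacetime} {c : ℝ} {x : E3}

lemma Radial.rescale (h : S.Radial) (c : ℝ) : (S.rescale c).Radial where
  diff x hx := by
    simp only [SurfaceInSpacetime.rescale, smul_comm _ c⁻¹, ← Finset.smul_sum, h.diff x hx,
      smul_zero]
  conn := h.conn

lemma Radial.ip_left (h : S.Radial) (hx : x ∈ S2) (w : Vec4) :
    ∑ i, x i * S.ip x (S.diff x (tang x i)) w = 0 := by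
  simp only [← ip_smul_left, ← ip_sum_left, h.diff x hx, ip_zero_left]

lemma Radial.ip_right (h : S.Radial) (hx : x ∈ S2) (w : Vec4) :
    ∑ i, x i * S.ip x w (S.diff x (tang x i)) = 0 := by
  simp only [← ip_smul_right, ← ip_sum_right, h.diff x hx, ip_zero_right]

lemma Radial.gram_mul (h : S.Radial) (hx : x ∈ S2) :
    gram S.induced x * radialProj x = radialProj x :=
  gram_mul_radialProj hx fun _ => h.ip_right hx _

lemma Radial.mul_gram (h : S.Radial) (hx : x ∈ S2) :
    radialProj x * gram S.induced x = radialProj x :=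
  radialProj_mul_gram hx fun _ => h.ip_left hx _

lemma Radial.inv_mul (h : S.Radial) (hx : x ∈ S2) (hdet : (gram S.induced x).det ≠ 0) :
    (gram S.induced x)⁻¹ * radialProj x = radialProj x := by
  have hu : IsUnit (gram S.induced x).det := hdet.isUnit
  conv_lhs => rw [← h.gram_mul hx]
  rw [← Matrix.mul_assoc, Matrix.nonsing_inv_mul _ hu, Matrix.one_mul]

lemma Radial.mul_inv (h : S.Radial) (hx : x ∈ S2) (hdet : (gram S.induced x).det ≠ 0) :
    radialProj x * (gram S.induced x)⁻¹ = radialProj x := by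
  have hu : IsUnit (gram S.induced x).det := hdet.isUnit
  conv_lhs => rw [← h.mul_gram hx]
  rw [Matrix.mul_assoc, Matrix.mul_nonsing_inv _ hu, Matrix.mul_one]

/-- Rescaling acts on the tangential block of `gram` only; the artificial normal direction keeps
unit length, which accounts for the correction along `radialProj`. In contractions of tangential
data this correction disappears. -/
lemma gram_eq_rescale (hc : c ≠ 0) : gram S.induced x =
    c ^ 2 • gram (S.rescale c).induced x + (1 - c ^ 2) • radialProj x := by
  ext i j
  have e : (S.rescale c).induced x (tang x i) (tang x j) =
      c⁻¹ * (c⁻¹ * S.induced x (tang x i) (tang x j)) := by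
    unfold induced
    change S.ip x (c⁻¹ • _) (c⁻¹ • _) = _
    rw [ip_smul_left, ip_smul_right]
  simp only [gram, radialProj, Matrix.of_apply, Matrix.add_apply, Matrix.smul_apply, smul_eq_mul, e]
  field_simp; ring

lemma det_gram_rescale (h : S.Radial) (hc : c ≠ 0) (hx : x ∈ S2) :
    (gram S.induced x).det = c ^ 4 * (gram (S.rescale c).induced x).det := by
  have e : gram S.induced x = gram (S.rescale c).induced x *
      (c ^ 2 • (1 : Matrix (Fin 3) (Fin 3) ℝ) + (1 - c ^ 2) • radialProj x) := by
    rw [gram_eq_rescale hc, Matrix.mul_add, Matrix.mul_smul, Matrix.mul_smul, Matrix.mul_one,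
      (h.rescale c).gram_mul hx]
  -- The matrix acts as `c²` on the tangent plane and as `1` on the normal line.
  have e2 : (c ^ 2 • (1 : Matrix (Fin 3) (Fin 3) ℝ) + (1 - c ^ 2) • radialProj x).det = c ^ 4 := by
    have h1 := sum_sq_of_mem hx
    rw [Fin.sum_univ_three] at h1
    rw [Matrix.det_fin_three]
    simp [radialProj]
    linear_combination (c ^ 4 * (1 - c ^ 2)) * h1
  rw [e, Matrix.det_mul, e2, mul_comm]

lemma inv_gram_rescale (h : S.Radial) (hc : c ≠ 0) (hx : x ∈ S2)
    (hdet : (gram (S.rescale c).induced x).det ≠ 0) : (gram S.induced x)⁻¹ =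
      (c ^ 2)⁻¹ • (gram (S.rescale c).induced x)⁻¹ + (1 - (c ^ 2)⁻¹) • radialProj x := by
  apply Matrix.inv_eq_right_inv
  rw [gram_eq_rescale hc]
  simp only [Matrix.add_mul, Matrix.mul_add, Matrix.smul_mul, Matrix.mul_smul,
    (h.rescale c).gram_mul hx, (h.rescale c).mul_inv hx hdet, radialProj_mul_self hx,
    Matrix.mul_nonsing_inv _ hdet.isUnit]
  ext i j
  simp only [Matrix.add_apply, Matrix.smul_apply, smul_eq_mul]
  field_simp; ring

/-- One tangential slot of `F` is enough to annihilate the `radialProj` term of the inverse. Values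
in a module are allowed so that the lemma covers both scalar contractions and vector traces such as
the mean curvature. -/
lemma sum_inv_gram_rescale {V : Type*} [AddCommGroup V] [Module ℝ V] (h : S.Radial) (hc : c ≠ 0)
    (hx : x ∈ S2) (hdet : (gram (S.rescale c).induced x).det ≠ 0) (F : Fin 3 → Fin 3 → V)
    (hF : ∀ j, ∑ i, x i • F i j = 0) :
    ∑ i, ∑ j, (gram S.induced x)⁻¹ i j • F i j =
      (c ^ 2)⁻¹ • ∑ i, ∑ j, (gram (S.rescale c).induced x)⁻¹ i j • F i j := by
  have h0 : ∑ i, ∑ j, radialProj x i j • F i j = 0 := by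
    rw [Finset.sum_comm]
    refine Finset.sum_eq_zero fun j _ => ?_
    have : ∀ i, radialProj x i j • F i j = x j • (x i • F i j) := fun i => by
      simp only [radialProj, Matrix.of_apply, smul_smul, mul_comm]
    simp only [this, ← Finset.smul_sum, hF, smul_zero]
  rw [inv_gram_rescale h hc hx hdet]
  simp only [Matrix.add_apply, Matrix.smul_apply, smul_eq_mul, add_smul, mul_smul,
    Finset.sum_add_distrib, ← Finset.smul_sum, h0, smul_zero, add_zero]

lemma areaDensity_rescale (h : S.Radial) (hc : c ≠ 0) (hx : x ∈ S2) :
    areaDensity S.induced x = c ^ 2 * areaDensity (S.rescale c).induced x := by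
  unfold areaDensity
  rw [det_gram_rescale h hc hx, show c ^ 4 = (c ^ 2) ^ 2 by ring, Real.sqrt_mul (by positivity),
    Real.sqrt_sq (by positivity)]

lemma contract_rescale (h : S.Radial) (hc : c ≠ 0) (hx : x ∈ S2)
    (hdet : (gram (S.rescale c).induced x).det ≠ 0) {β γ : E3 → ℝ}
    (hβ : ∑ i, x i * β (tang x i) = 0) :
    contract S.induced x β γ = (c ^ 2)⁻¹ * contract (S.rescale c).induced x β γ := by
  have := sum_inv_gram_rescale h hc hx hdet (fun i j => β (tang x i) * γ (tang x j)) fun j => by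
    simp only [smul_eq_mul, ← mul_assoc, ← Finset.sum_mul, hβ, zero_mul]
  simpa only [contract, smul_eq_mul, mul_assoc] using this

/-- In dimension two the densitized inverse metric `√det σ σ^{ab}` is invariant under scaling, so
only the outer factor `(√det σ)⁻¹` changes. -/
lemma divOneForm_rescale (h : S.Radial) (hc : c ≠ 0)
    (hdet : ∀ x ∈ S2, (gram (S.rescale c).induced x).det ≠ 0) {β : E3 → E3 → ℝ}
    (hβ : ∀ x ∈ S2, ∑ i, x i * β x (tang x i) = 0) (hx : x ∈ S2) :
    divOneForm S.induced β x = (c ^ 2)⁻¹ * divOneForm (S.rescale c).induced β x := by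
  unfold divOneForm
  have e : ∀ i, ∀ y ∈ S2, areaDensity S.induced y *
        ∑ j, (gram S.induced y)⁻¹ i j * β y (tang y j) =
      areaDensity (S.rescale c).induced y *
        ∑ j, (gram (S.rescale c).induced y)⁻¹ i j * β y (tang y j) := by
    intro i y hy
    have h0 : ∑ j, radialProj y i j * β y (tang y j) = 0 := by
      simp only [radialProj, Matrix.of_apply, mul_assoc, ← Finset.mul_sum, hβ y hy, mul_zero]
    rw [areaDensity_rescale h hc hy, inv_gram_rescale h hc hy (hdet y hy)]
    simp only [Matrix.add_apply, Matrix.smul_apply, smul_eq_mul, add_mul, mul_assoc,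
      Finset.sum_add_distrib, ← Finset.mul_sum, h0, mul_zero, add_zero]
    field_simp
  rw [areaDensity_rescale h hc hx]
  simp only [fun i => sphereD_congr (e i) hx]
  rw [mul_inv, mul_assoc]

lemma laplacian_rescale (h : S.Radial) (hc : c ≠ 0)
    (hdet : ∀ x ∈ S2, (gram (S.rescale c).induced x).det ≠ 0) (f : E3 → ℝ) (hx : x ∈ S2) :
    laplacian S.induced f x = (c ^ 2)⁻¹ * laplacian (S.rescale c).induced f x :=
  divOneForm_rescale h hc hdet (fun _ hy => sum_mul_sd hy f) hx

lemma normalPart_rescale (h : S.Radial) (hc : c ≠ 0) (hx : x ∈ S2)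
    (hdet : (gram (S.rescale c).induced x).det ≠ 0) (w : Vec4) :
    S.normalPart x w = (S.rescale c).normalPart x w := by
  unfold normalPart
  have := sum_inv_gram_rescale h hc hx hdet
    (fun i j => S.ip x w (S.diff x (tang x i)) • S.diff x (tang x j)) fun j => by
      simp only [smul_smul, ← Finset.sum_smul, h.ip_right hx, zero_smul]
  simp only [smul_smul] at this
  rw [this]
  congr 1
  simp only [Finset.smul_sum]
  refine Finset.sum_congr rfl fun i _ => Finset.sum_congr rfl fun j _ => ?_
  change _ = (_ * S.ip x w (c⁻¹ • _)) • (c⁻¹ • _)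
  rw [ip_smul_right, smul_smul, smul_smul]
  congr 1
  field_simp

lemma normalPart_smul (S : SurfaceInSpacetime) (x : E3) (a : ℝ) (w : Vec4) :
    S.normalPart x (a • w) = a • S.normalPart x w := by
  simp only [normalPart, ip_smul_left, smul_sub, Finset.smul_sum, smul_smul]
  congr 1
  refine Finset.sum_congr rfl fun i _ => Finset.sum_congr rfl fun j _ => ?_
  congr 1; ring

lemma covD_smul (S : SurfaceInSpacetime) (x : E3) (a : ℝ) (s : E3 → Vec4) (v : E3) :
    S.covD (fun y => a • s y) x v = a • S.covD s x v := by
  have : radialExt (fun y => a • s y) = a • radialExt s := rfl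
  simp only [covD, sphereD, this, fderiv_const_smul_field, Matrix.mulVec_smul, smul_add]
  rfl

lemma covD_congr {s t : E3 → Vec4} (h : ∀ y ∈ S2, s y = t y) (hx : x ∈ S2) (v : E3) :
    S.covD s x v = S.covD t x v := by
  rw [covD, covD, sphereD_congr h hx, h x hx]

lemma Radial.covD (h : S.Radial) (hx : x ∈ S2) (s : E3 → Vec4) :
    ∑ i, x i • S.covD s x (tang x i) = 0 := by
  have h1 : ∑ i, x i • sphereD s x (tang x i) = 0 := by
    simp only [sphereD, ← map_smul, ← map_sum, sum_smul_tang hx, map_zero]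
  simp only [SurfaceInSpacetime.covD, smul_add, Finset.sum_add_distrib, h1, zero_add,
    ← Matrix.smul_mulVec, ← Matrix.sum_mulVec, h.conn x hx, Matrix.zero_mulVec]

lemma meanCurv_rescale (h : S.Radial) (hc : c ≠ 0) (hx : x ∈ S2)
    (hdet : (gram (S.rescale c).induced x).det ≠ 0) :
    S.meanCurv x = c⁻¹ • (S.rescale c).meanCurv x := by
  unfold meanCurv
  rw [normalPart_rescale h hc hx hdet, ← normalPart_smul]
  congr 1
  rw [sum_inv_gram_rescale h hc hx hdet _ fun j => h.covD hx _, Finset.smul_sum, Finset.smul_sum]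
  refine Finset.sum_congr rfl fun i _ => ?_
  rw [Finset.smul_sum, Finset.smul_sum]
  refine Finset.sum_congr rfl fun j _ => ?_
  change _ = c⁻¹ • _ • S.covD (fun y => c⁻¹ • S.diff y (tang y j)) x (tang x i)
  rw [covD_smul, smul_smul, smul_smul, smul_smul]
  congr 1
  field_simp

lemma normH_rescale (h : S.Radial) (hc : 0 < c) (hx : x ∈ S2)
    (hdet : (gram (S.rescale c).induced x).det ≠ 0) :
    S.normH x = c⁻¹ * (S.rescale c).normH x := by
  unfold normH
  rw [meanCurv_rescale h hc.ne' hx hdet, ip_smul_left, ip_smul_right, ← mul_assoc, ← sq,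
    Real.sqrt_mul (by positivity), Real.sqrt_sq (by positivity)]
  rfl

lemma timeNormal_rescale (h : S.Radial) (hc : 0 < c) (hx : x ∈ S2)
    (hdet : (gram (S.rescale c).induced x).det ≠ 0) :
    S.timeNormal x = (S.rescale c).timeNormal x := by
  unfold timeNormal
  rw [meanCurv_rescale h hc.ne' hx hdet, normalPart_rescale h hc.ne' hx hdet, ip_smul_left,
    ip_smul_right, ip_smul_right, smul_smul]
  congr 2
  change _ = S.ip x _ _ / S.ip x _ _
  have := hc.ne'
  field_simp

lemma J_rescale (h : S.Radial) (hc : 0 < c) (hx : x ∈ S2)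
    (hdet : (gram (S.rescale c).induced x).det ≠ 0) :
    S.J x = c⁻¹ • (S.rescale c).J x := by
  unfold J
  rw [normH_rescale h hc hx hdet, timeNormal_rescale h hc hx hdet, smul_smul, mul_div_assoc]
  rfl

/-- The connection form depends only on the unit normals `J/|H|` and `H/|H|`, which do not scale,
and on the connection, which `rescale` leaves untouched. -/
lemma alphaH_rescale (h : S.Radial) (hc : 0 < c)
    (hdet : ∀ x ∈ S2, (gram (S.rescale c).induced x).det ≠ 0) (hx : x ∈ S2) (v : E3) :
    S.alphaH x v = (S.rescale c).alphaH x v := by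
  unfold alphaH
  have e : ∀ y ∈ S2, (S.normH y)⁻¹ • S.J y = ((S.rescale c).normH y)⁻¹ • (S.rescale c).J y := by
    intro y hy
    rw [normH_rescale h hc hy (hdet y hy), J_rescale h hc hy (hdet y hy), smul_smul]
    congr 1
    have := hc.ne'
    field_simp
  rw [covD_congr e hx, normH_rescale h hc hx (hdet x hx),
    meanCurv_rescale h hc.ne' hx (hdet x hx), smul_smul]
  have e2 : (c⁻¹ * (S.rescale c).normH x)⁻¹ * c⁻¹ = ((S.rescale c).normH x)⁻¹ := by
    have := hc.ne'
    field_simp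
  rw [e2]
  rfl

/-! ### Orthogonality of the normal frame -/

/-- The three vectors `tang x i` are linearly dependent, so the Gram matrix `G` of the tangent
vectors must be completed by the projection `P` to the normal line. Then `G⁻¹(G - P) = 1 - P`, and
the `P` term vanishes against a tangential covector. -/
lemma ip_normalPart_diff (h : S.Radial) (hx : x ∈ S2) (hdet : (gram S.induced x).det ≠ 0)
    (w : Vec4) (k : Fin 3) : S.ip x (S.normalPart x w) (S.diff x (tang x k)) = 0 := by
  have e1 : ∀ j, S.ip x (S.diff x (tang x j)) (S.diff x (tang x k)) =
      gram S.induced x j k - radialProj x j k := fun j => by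
    simp [gram, radialProj, induced]
  have e2 : ∀ i, ∑ j, (gram S.induced x)⁻¹ i j * (gram S.induced x j k - radialProj x j k) =
      (1 - radialProj x) i k := fun i => by
    have h1 := congrFun (congrFun (Matrix.nonsing_inv_mul _ hdet.isUnit) i) k
    have h2 := congrFun (congrFun (h.inv_mul hx hdet) i) k
    simp only [Matrix.mul_apply] at h1 h2
    simp only [mul_sub, Finset.sum_sub_distrib, h1, h2, Matrix.sub_apply]
  have e3 : ∑ i, S.ip x w (S.diff x (tang x i)) * radialProj x i k = 0 := by
    have := h.ip_right hx w
    calc _ = x k * ∑ i, x i * S.ip x w (S.diff x (tang x i)) := by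
          rw [Finset.mul_sum]
          exact Finset.sum_congr rfl fun i _ => by simp [radialProj]; ring
      _ = 0 := by rw [this, mul_zero]
  unfold normalPart
  rw [ip_sub_left, ip_sum_left]
  simp only [ip_sum_left, ip_smul_left, e1]
  calc _ = S.ip x w (S.diff x (tang x k)) - ∑ i, S.ip x w (S.diff x (tang x i)) *
        ∑ j, (gram S.induced x)⁻¹ i j * (gram S.induced x j k - radialProj x j k) := by
        congr 1
        refine Finset.sum_congr rfl fun i _ => ?_
        rw [Finset.mul_sum]
        exact Finset.sum_congr rfl fun j _ => by ring
    _ = 0 := by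
        simp only [e2]
        simp only [Matrix.sub_apply, mul_sub, Finset.sum_sub_distrib, e3]
        simp [Matrix.one_apply]

lemma ip_meanCurv_diff (h : S.Radial) (hx : x ∈ S2) (hdet : (gram S.induced x).det ≠ 0)
    (k : Fin 3) : S.ip x (S.meanCurv x) (S.diff x (tang x k)) = 0 :=
  ip_normalPart_diff h hx hdet _ k

lemma ip_timeNormal_diff (h : S.Radial) (hx : x ∈ S2) (hdet : (gram S.induced x).det ≠ 0)
    (k : Fin 3) : S.ip x (S.timeNormal x) (S.diff x (tang x k)) = 0 := by
  rw [timeNormal, ip_sub_left, ip_smul_left, ip_normalPart_diff h hx hdet,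
    ip_meanCurv_diff h hx hdet]
  ring

lemma ip_J_diff (h : S.Radial) (hx : x ∈ S2) (hdet : (gram S.induced x).det ≠ 0) (k : Fin 3) :
    S.ip x (S.J x) (S.diff x (tang x k)) = 0 := by
  rw [J, ip_smul_left, ip_timeNormal_diff h hx hdet, mul_zero]

end SurfaceInSpacetime

/-! ### Expansions of vectors and matrices -/

/-- Expansions of the components of a vector. -/
def VEx (N n : ℕ) (u : ℝ → E3 → Vec4) (c : E3 → Vec4) : Prop :=
  ∀ μ, Ex N n (fun r x => u r x μ) (fun x => c x μ)

/-- Expansions of the entries of a matrix. -/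
def MEx (N n : ℕ) (A : ℝ → E3 → Matrix (Fin 3) (Fin 3) ℝ) (C : E3 → Matrix (Fin 3) (Fin 3) ℝ) :
    Prop :=
  ∀ i j, Ex N n (fun r x => A r x i j) (fun x => C x i j)

section
variable {N n : ℕ}

lemma MEx.det {A : ℝ → E3 → Matrix (Fin 3) (Fin 3) ℝ} {C : E3 → Matrix (Fin 3) (Fin 3) ℝ}
    (h : MEx N n A C) : Ex N n (fun r x => (A r x).det) (fun x => (C x).det) := by
  simp only [Matrix.det_fin_three]
  have m := fun i j k l p q => ((h i j).mul (h k l)).mul (h p q)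
  exact (((((m _ _ _ _ _ _).sub (m _ _ _ _ _ _)).sub (m _ _ _ _ _ _)).add (m _ _ _ _ _ _)).add
    (m _ _ _ _ _ _)).sub (m _ _ _ _ _ _)

/-- Cramer's rule writes each entry as a quotient of determinants, to which `MEx.det` and `Ex.inv`
apply. -/
lemma MEx.inv {A : ℝ → E3 → Matrix (Fin 3) (Fin 3) ℝ} {C : E3 → Matrix (Fin 3) (Fin 3) ℝ}
    (h : MEx N n A C) (hC : ∀ x ∈ S2, (C x).det ≠ 0) :
    MEx N n (fun r x => (A r x)⁻¹) (fun x => (C x)⁻¹) := by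
  intro i j
  have e : ∀ B : Matrix (Fin 3) (Fin 3) ℝ,
      B⁻¹ i j = (B.det)⁻¹ * (B.updateRow j (Pi.single i 1)).det := by
    intro B
    rw [Matrix.inv_def, Matrix.smul_apply, Ring.inverse_eq_inv', Matrix.adjugate_apply, smul_eq_mul]
  simp only [e]
  refine (h.det.inv hC).mul (MEx.det fun k l => ?_)
  simp only [Matrix.updateRow_apply]
  split_ifs
  · exact Ex.const (sphereSmooth_const _)
  · exact h k l

lemma VEx.add {u v : ℝ → E3 → Vec4} {c d : E3 → Vec4} (hu : VEx N n u c) (hv : VEx N n v d) :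
    VEx N n (fun r x => u r x + v r x) (fun x => c x + d x) := fun μ => (hu μ).add (hv μ)

lemma VEx.sub {u v : ℝ → E3 → Vec4} {c d : E3 → Vec4} (hu : VEx N n u c) (hv : VEx N n v d) :
    VEx N n (fun r x => u r x - v r x) (fun x => c x - d x) := fun μ => (hu μ).sub (hv μ)

lemma VEx.smul {f : ℝ → E3 → ℝ} {v : ℝ → E3 → Vec4} {c : E3 → ℝ} {d : E3 → Vec4}
    (hf : Ex N n f c) (hv : VEx N n v d) :
    VEx N n (fun r x => f r x • v r x) (fun x => c x • d x) := fun μ => hf.mul (hv μ)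

lemma VEx.sum {ι : Type*} (s : Finset ι) {v : ι → ℝ → E3 → Vec4} {d : ι → E3 → Vec4}
    (h : ∀ i ∈ s, VEx N n (v i) (d i)) :
    VEx N n (fun r x => ∑ i ∈ s, v i r x) (fun x => ∑ i ∈ s, d i x) := by
  intro μ
  simp only [Finset.sum_apply]
  exact Ex.sum s fun i hi => h i hi μ

lemma VEx.congr {u v : ℝ → E3 → Vec4} {c : E3 → Vec4} (hu : VEx N n u c)
    (h : ∀ᶠ r in atTop, ∀ x ∈ S2, u r x = v r x) : VEx N n v c := by
  intro μ
  refine (hu μ).congr ?_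
  filter_upwards [h] with r hr x hx
  rw [hr x hx]

lemma VEx.congr_lim {u : ℝ → E3 → Vec4} {c d : E3 → Vec4} (hu : VEx N n u c)
    (h : ∀ x ∈ S2, c x = d x) : VEx N n u d := fun μ =>
  (hu μ).congr_lim fun x hx => by rw [h x hx]

lemma VEx.mono {N' n' : ℕ} {u : ℝ → E3 → Vec4} {c : E3 → Vec4} (hu : VEx N n u c) (hN : N' ≤ N)
    (hn : n' ≤ n) : VEx N' n' u c := fun μ => ((hu μ).mono hN).mono_right' hn

lemma sphereD_apply {u : E3 → Vec4} {x : E3} (h : ∀ μ, SDiff (fun y => u y μ) x) (i : Fin 3)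
    (μ : Fin 4) : sphereD u x (tang x i) μ = sd i (fun y => u y μ) x := by
  have := fderiv_pi (φ := fun μ y => radialExt (fun z => u z μ) y) h
  change fderiv ℝ (fun y μ => radialExt (fun z => u z μ) y) x _ _ = _
  rw [this]
  rfl

lemma VEx.sphereD {u : ℝ → E3 → Vec4} {c : E3 → Vec4} (hu : VEx N (n + 1) u c) (i : Fin 3) :
    VEx N n (fun r x => sphereD (u r) x (tang x i)) (fun x μ => sd i (fun y => c y μ) x) := by
  intro μ
  refine ((hu μ).sd i).congr ?_
  filter_upwards [eventually_all.mpr fun μ => (hu μ).sDiff] with r hr x hx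
  exact (sphereD_apply (fun μ => hr μ x hx) i μ).symm

lemma vEx_const {w : E3 → Vec4} (h : ∀ μ, SphereSmooth fun x => w x μ) :
    VEx N n (fun _ => w) w := fun μ => Ex.const (h μ)

lemma mink_eq (u w : Vec4) : mink u w = -(u 0 * w 0) + ∑ k : Fin 3, u k.succ * w k.succ := by
  simp [mink, minkowski, dotProduct, Matrix.mulVec_diagonal, Fin.sum_univ_succ]

end

/-- A unit vector as a spatial vector of Minkowski space. -/
def spatial (x : E3) : Vec4 := Fin.cons 0 fun k => x k

lemma mink_smul_left (a : ℝ) (u w : Vec4) : mink (a • u) w = a * mink u w := by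
  simp [mink, smul_dotProduct]

lemma mink_smul_right (a : ℝ) (u w : Vec4) : mink u (a • w) = a * mink u w := by
  simp [mink, Matrix.mulVec_smul, dotProduct_smul]

lemma mink_spatial (x y : E3) : mink (spatial x) (spatial y) = ∑ k, x k * y k := by
  simp [mink_eq, spatial]

lemma sum_tang_mul_tang {x : E3} (hx : x ∈ S2) (i j : Fin 3) :
    ∑ k, tang x i k * tang x j k = (if i = j then 1 else 0) - x i * x j := by
  have h := sum_sq_of_mem hx
  have e : ∀ k, tang x i k * tang x j k = (if k = i then (if k = j then (1 : ℝ) else 0) else 0) -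
      (if k = i then x j * x k else 0) - (if k = j then x i * x k else 0) +
        x i * x j * (x k * x k) := fun k => by
    simp only [tang_apply]; split_ifs <;> ring
  simp only [e, Finset.sum_add_distrib, Finset.sum_sub_distrib, ← Finset.mul_sum, h,
    Finset.sum_ite_eq', Finset.mem_univ, if_true]
  ring

lemma smooth_spatial_tang (i : Fin 3) (μ : Fin 4) : SphereSmooth fun x => spatial (tang x i) μ := by
  refine Fin.cases ?_ (fun k => ?_) μ
  · exact sphereSmooth_const 0
  · simp only [spatial, Fin.cons_succ]
    exact sphereSmooth_of_contDiffOn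
      (((EuclideanSpace.proj k : E3 →L[ℝ] ℝ).contDiff.comp (contDiff_tang i)).contDiffOn)

lemma smooth_spatial (μ : Fin 4) : SphereSmooth fun x => spatial x μ := by
  refine Fin.cases ?_ (fun k => ?_) μ
  · exact sphereSmooth_const 0
  · exact sphereSmooth_coord k

/-! ### Families of surfaces close to the round sphere -/

/-- A family of surfaces which converges to the round unit sphere in Minkowski space, with
expansions of second order. -/
structure NormalizedFamily (S : ℝ → SurfaceInSpacetime) : Prop where
  radial : ∀ᶠ r in atTop, (S r).Radial
  metric : ∀ μ ν, Ex 2 2 (fun r x => (S r).metric x μ ν) (fun _ => minkowski μ ν)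
  conn : ∀ i μ ν, Ex 2 1 (fun r x => (S r).conn x (tang x i) μ ν) (fun _ => 0)
  diff : ∀ i, VEx 2 2 (fun r x => (S r).diff x (tang x i)) (fun x => spatial (tang x i))

namespace NormalizedFamily
open SurfaceInSpacetime

variable {S : ℝ → SurfaceInSpacetime} (h : NormalizedFamily S)
include h

lemma ip {n : ℕ} (hn : n ≤ 2) {u v : ℝ → E3 → Vec4} {c d : E3 → Vec4} (hu : VEx 2 n u c)
    (hv : VEx 2 n v d) :
    Ex 2 n (fun r x => (S r).ip x (u r x) (v r x)) (fun x => mink (c x) (d x)) := by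
  unfold SurfaceInSpacetime.ip mink
  simp only [dotProduct, Matrix.mulVec]
  exact Ex.sum _ fun μ _ => (hu μ).mul (Ex.sum _ fun ν _ =>
    ((h.metric μ ν).mono_right' hn).mul (hv ν))

lemma gram : MEx 2 2 (fun r x => CWY.gram (S r).induced x) (fun _ => 1) := by
  intro i j
  have h1 := (h.ip le_rfl (h.diff i) (h.diff j)).add
    (Ex.const ((sphereSmooth_coord i).mul (sphereSmooth_coord j)))
  refine h1.congr_lim fun x hx => ?_
  change _ = (1 : Matrix (Fin 3) (Fin 3) ℝ) i j
  rw [mink_spatial, sum_tang_mul_tang hx, Matrix.one_apply]; ring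

lemma det_ne_zero : ∀ᶠ r in atTop, ∀ x ∈ S2, (CWY.gram (S r).induced x).det ≠ 0 :=
  h.gram.det.sLim.eventually_ne fun x hx => by simp

lemma inv_gram (i j : Fin 3) : Ex 2 2 (fun r x => (CWY.gram (S r).induced x)⁻¹ i j)
    (fun _ => (1 : Matrix (Fin 3) (Fin 3) ℝ) i j) := by
  simpa using h.gram.inv (fun x hx => by simp) i j

lemma areaDensity : Ex 2 2 (fun r x => CWY.areaDensity (S r).induced x) (fun _ => 1) := by
  unfold CWY.areaDensity
  simpa using h.gram.det.sqrt fun x hx => by simp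

/-- In the limit the inverse Gram matrix is the identity, so the double sum reduces to its diagonal.
-/
lemma normalPart {n : ℕ} (hn : n ≤ 2) {w : ℝ → E3 → Vec4} {c : E3 → Vec4} (hw : VEx 2 n w c) :
    VEx 2 n (fun r x => (S r).normalPart x (w r x))
      (fun x => c x - ∑ i, mink (c x) (spatial (tang x i)) • spatial (tang x i)) := by
  unfold SurfaceInSpacetime.normalPart
  have hd := fun i => (h.diff i).mono le_rfl hn
  have h1 := hw.sub (VEx.sum Finset.univ fun i _ => VEx.sum Finset.univ fun j _ =>
    VEx.smul (((h.inv_gram i j).mono_right' hn).mul (h.ip hn hw (hd i))) (hd j))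
  refine h1.congr_lim fun x hx => ?_
  simp [Matrix.one_apply]

lemma covD {s : ℝ → E3 → Vec4} {c : E3 → Vec4} {n : ℕ} (hn : n ≤ 1) (hs : VEx 2 (n + 1) s c)
    (i : Fin 3) : VEx 2 n (fun r x => (S r).covD (s r) x (tang x i))
      (fun x μ => sd i (fun y => c y μ) x) := by
  unfold SurfaceInSpacetime.covD
  have h2 : VEx 2 n (fun r x => (S r).conn x (tang x i) *ᵥ s r x) (fun _ => 0) := by
    intro μ
    simp only [Matrix.mulVec, dotProduct]
    refine (Ex.sum Finset.univ fun ν _ =>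
      ((h.conn i μ ν).mono_right' hn).mul (hs ν).mono_right).congr_lim fun x hx => ?_
    simp
  exact ((hs.sphereD i).add h2).congr_lim fun x hx => by simp

/-- The limit is the mean curvature vector of the unit sphere. Since `tang x i` is the `i`-th basis
vector minus `x i • x`, summing its derivatives along `tang x i` gives `-2x`, which is already
normal. -/
lemma meanCurv : VEx 2 1 (fun r x => (S r).meanCurv x) (fun x => (-2 : ℝ) • spatial x) := by
  unfold SurfaceInSpacetime.meanCurv
  have h1 := h.normalPart (n := 1) (by norm_num) (VEx.sum Finset.univ fun i _ =>
    VEx.sum Finset.univ fun j _ => VEx.smul ((h.inv_gram i j).mono_right)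
      (h.covD le_rfl (h.diff j) i))
  refine h1.congr_lim fun x hx => ?_
  have e : (∑ i, ∑ j, (1 : Matrix (Fin 3) (Fin 3) ℝ) i j •
      (fun μ => sd i (fun y => spatial (tang y j) μ) x : Vec4)) = (-2 : ℝ) • spatial x := by
    have e1 : ∀ i, (∑ j, (1 : Matrix (Fin 3) (Fin 3) ℝ) i j •
        (fun μ => sd i (fun y => spatial (tang y j) μ) x : Vec4)) =
        (fun μ => sd i (fun y => spatial (tang y i) μ) x : Vec4) := fun i => by
      simp [Matrix.one_apply]
    simp only [e1]
    ext μ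
    rw [Finset.sum_apply]
    refine Fin.cases ?_ (fun k => ?_) μ
    · simp [spatial, sd_const]
    · have e2 : ∀ i, sd i (fun y => spatial (tang y i) k.succ) x =
          -(tang x i i * x k + x i * tang x i k) := fun i => by
        have e3 : (fun y : E3 => spatial (tang y i) k.succ) =
            fun y => (if k = i then (1 : ℝ) else 0) + (-1) * (y i * y k) := by
          ext y; simp only [spatial, Fin.cons_succ, tang_apply]; ring
        have s1 := (sphereSmooth_coord i).sDiff hx
        have s2 := (sphereSmooth_coord k).sDiff hx
        rw [e3, sd_add (sDiff_const _) ((sDiff_const _).mul (s1.mul s2)), sd_const_mul, sd_const,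
          sd_mul s1 s2 hx, sd_coord hx, sd_coord hx]
        ring
      simp only [e2]
      have hs := sum_sq_of_mem hx
      have ht : ∑ i, x i * tang x i k = 0 := by
        have := congrArg (fun v : E3 => v k) (sum_smul_tang hx)
        simpa using this
      rw [Finset.sum_neg_distrib, Finset.sum_add_distrib, ht, ← Finset.sum_mul]
      simp only [tang_apply, if_true, Finset.sum_sub_distrib, hs]
      simp only [spatial, Finset.sum_const, Finset.card_univ, Fintype.card_fin, nsmul_eq_mul,
        Pi.smul_apply, Fin.cons_succ, smul_eq_mul]
      ring
  rw [e]
  have e2 : ∀ i, mink ((-2 : ℝ) • spatial x) (spatial (tang x i)) = 0 := fun i => by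
    have h3 := inner_tang hx i
    rw [PiLp.inner_apply] at h3
    rw [mink_smul_left, mink_spatial]
    simp only [RCLike.inner_apply, conj_trivial] at h3
    simp only [mul_comm (x _), h3, mul_zero]
  simp only [e2, zero_smul, Finset.sum_const_zero, sub_zero]

lemma sq_meanCurv : Ex 2 1 (fun r x => (S r).ip x ((S r).meanCurv x) ((S r).meanCurv x))
    (fun _ => 4) := by
  refine (h.ip (by norm_num) h.meanCurv h.meanCurv).congr_lim fun x hx => ?_
  have := sum_sq_of_mem hx
  rw [mink_smul_left, mink_smul_right, mink_spatial, this]; norm_num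

lemma normH : Ex 2 1 (fun r x => (S r).normH x) (fun _ => 2) :=
  (h.sq_meanCurv.sqrt fun x hx => by norm_num).congr_lim fun x hx => by
    rw [show (4 : ℝ) = 2 ^ 2 by norm_num, Real.sqrt_sq (by norm_num)]

lemma normH_pos : ∀ᶠ r in atTop, ∀ x ∈ S2, 0 < (S r).normH x :=
  h.normH.sLim.eventually_pos fun x hx => by norm_num

lemma timeNormal : VEx 2 1 (fun r x => (S r).timeNormal x) (fun _ => Pi.single 0 1) := by
  unfold SurfaceInSpacetime.timeNormal
  have he : VEx 2 1 (fun (_ : ℝ) (_ : E3) => (Pi.single 0 1 : Vec4)) (fun _ => Pi.single 0 1) :=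
    vEx_const fun μ => sphereSmooth_const _
  have h1 := (h.normalPart (by norm_num) he).sub
    (VEx.smul ((h.ip (by norm_num) he h.meanCurv).mul (h.sq_meanCurv.inv fun x hx => by norm_num))
      h.meanCurv)
  have h2 := h1.congr_lim (d := fun _ => Pi.single 0 1) fun x hx => by
    simp [mink_eq, spatial]
  simpa only [div_eq_mul_inv] using h2

/-- The unit timelike normal `J / |H|`. -/
lemma timeDir : VEx 2 1 (fun r x => ((S r).normH x)⁻¹ • (S r).J x) (fun _ => Pi.single 0 1) := by
  unfold SurfaceInSpacetime.J
  have h1 : Ex 2 1 (fun r x => -(S r).ip x ((S r).timeNormal x) ((S r).timeNormal x))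
      (fun _ => 1) :=
    (h.ip (by norm_num) h.timeNormal h.timeNormal).neg.congr_lim fun x hx => by simp [mink_eq]
  have hs := h1.sqrt fun x hx => by norm_num
  have h2 := VEx.smul (h.normH.inv fun x hx => by norm_num) (VEx.smul
    (h.normH.mul (hs.inv fun x hx => by norm_num)) h.timeNormal)
  have h3 := h2.congr_lim (d := fun _ => Pi.single 0 1) fun x hx => by simp
  simpa only [div_eq_mul_inv] using h3

/-- The unit spacelike normal `H / |H|`. -/
lemma spaceDir : VEx 2 1 (fun r x => ((S r).normH x)⁻¹ • (S r).meanCurv x)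
    (fun x => -spatial x) :=
  (VEx.smul (h.normH.inv fun x hx => by norm_num) h.meanCurv).congr_lim fun x hx => by
    rw [smul_smul]; norm_num

/-- The leading term is zero because the limiting timelike normal is the constant vector `∂_0` and
the connection tends to zero. The next coefficient is the `α^{(-1)}` of the theorem. -/
lemma alphaH (i : Fin 3) : Ex 2 0 (fun r x => (S r).alphaH x (tang x i)) (fun _ => 0) := by
  unfold SurfaceInSpacetime.alphaH
  refine (h.ip (by norm_num) (h.covD (n := 0) (by norm_num) h.timeDir i)
    (h.spaceDir.mono le_rfl (Nat.zero_le _))).congr_lim fun x hx => ?_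
  simp [mink_eq, sd_const]

end NormalizedFamily

/-! ### Restriction to large spheres of functions near infinity -/

lemma fderiv_normalize_tang {x : E3} (hx : x ∈ S2) (i : Fin 3) :
    fderiv ℝ (fun y : E3 => ‖y‖⁻¹ • y) x (tang x i) = tang x i := by
  have hd : DifferentiableAt ℝ (fun y : E3 => ‖y‖⁻¹ • y) x :=
    (contDiffOn_normalize.contDiffAt (isOpen_compl_zero.mem_nhds (ne_zero_of_mem hx))).differentiableAt
      (by simp)
  ext k
  have h1 := ((EuclideanSpace.proj k : E3 →L[ℝ] ℝ).hasFDerivAt.comp x hd.hasFDerivAt).fderiv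
  have h2 := sd_coord hx i k
  rw [← h2]
  change _ = fderiv ℝ ((EuclideanSpace.proj k : E3 →L[ℝ] ℝ) ∘ fun y : E3 => ‖y‖⁻¹ • y) x _
  rw [h1]
  rfl

lemma DifferentiableAt.sDiff {g : E3 → ℝ} {x : E3} (hx : x ∈ S2) (hg : DifferentiableAt ℝ g x) :
    SDiff g x := by
  have hd : DifferentiableAt ℝ (fun y : E3 => ‖y‖⁻¹ • y) x :=
    (contDiffOn_normalize.contDiffAt (isOpen_compl_zero.mem_nhds (ne_zero_of_mem hx))).differentiableAt
      (by simp)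
  have e : ‖x‖⁻¹ • x = x := by simp [norm_eq_one_of_mem hx]
  exact DifferentiableAt.comp x (by simpa only [e] using hg) hd

lemma sd_eq_fderiv {g : E3 → ℝ} {x : E3} (hx : x ∈ S2) (hg : DifferentiableAt ℝ g x) (i : Fin 3) :
    sd i g x = fderiv ℝ g x (tang x i) := by
  have hd : DifferentiableAt ℝ (fun y : E3 => ‖y‖⁻¹ • y) x :=
    (contDiffOn_normalize.contDiffAt (isOpen_compl_zero.mem_nhds (ne_zero_of_mem hx))).differentiableAt
      (by simp)
  have e : ‖x‖⁻¹ • x = x := by simp [norm_eq_one_of_mem hx]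
  have h1 := fderiv_comp x (g := g) (f := fun y : E3 => ‖y‖⁻¹ • y) (by simpa only [e] using hg) hd
  change fderiv ℝ (g ∘ fun y : E3 => ‖y‖⁻¹ • y) x _ = _
  rw [h1, ContinuousLinearMap.comp_apply, fderiv_normalize_tang hx, e]

lemma apply_eq_sum_single (L : E3 →L[ℝ] ℝ) (v : E3) :
    L v = ∑ l, v l * L (EuclideanSpace.single l (1 : ℝ)) := by
  have : v = ∑ l, v l • EuclideanSpace.single l (1 : ℝ) := by
    ext k
    simp [Finset.sum_apply, Pi.single_apply]
  conv_lhs => rw [this]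
  simp

/-- The partial derivative of a function on Euclidean space. -/
noncomputable def partialD (l : Fin 3) (q : E3 → ℝ) (y : E3) : ℝ :=
  fderiv ℝ q y (EuclideanSpace.single l (1 : ℝ))

lemma tendsto_smul_cobounded {x : E3} :
    Tendsto (fun p : ℝ × E3 => p.1 • p.2) (atTop ×ˢ 𝓝[S2] x) (Bornology.cobounded E3) := by
  rw [← tendsto_norm_atTop_iff_cobounded]
  refine Tendsto.congr' ?_ (tendsto_fst (f := (atTop : Filter ℝ)) (g := 𝓝[S2] x))
  filter_upwards [(eventually_gt_atTop (0 : ℝ)).prod_mk self_mem_nhdsWithin] with p hp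
  rw [norm_smul, norm_eq_one_of_mem hp.2, mul_one, Real.norm_of_nonneg hp.1.le]

lemma smul_mem_exterior {R r : ℝ} (hr : R < r) (h0 : 0 < r) {x : E3} (hx : x ∈ S2) :
    r • x ∈ (Metric.closedBall (0 : E3) R)ᶜ := by
  simp [norm_smul, norm_eq_one_of_mem hx, abs_of_pos h0, hr]

lemma isOpen_exterior (R : ℝ) : IsOpen (Metric.closedBall (0 : E3) R)ᶜ :=
  Metric.isClosed_closedBall.isOpen_compl

lemma eventually_mem_exterior (R : ℝ) :
    ∀ᶠ y in Bornology.cobounded E3, y ∈ (Metric.closedBall (0 : E3) R)ᶜ :=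
  Bornology.isBounded_def.mp Metric.isBounded_closedBall

lemma contDiffOn_partialD {q : E3 → ℝ} {U : Set E3} (hU : IsOpen U) (hq : ContDiffOn ℝ ∞ q U)
    (l : Fin 3) : ContDiffOn ℝ ∞ (partialD l q) U :=
  (ContDiffOn.fderiv_of_isOpen (m := ∞) hq hU (by simp)).clm_apply contDiffOn_const

lemma isLittleO_partialD {q : E3 → ℝ} {R : ℝ}
    (hq : ContDiffOn ℝ ∞ q (Metric.closedBall (0 : E3) R)ᶜ) {m b : ℕ}
    (h : iteratedFDeriv ℝ (m + 1) q =o[Bornology.cobounded E3] fun y => (‖y‖ ^ b)⁻¹) (l : Fin 3) :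
    iteratedFDeriv ℝ m (partialD l q) =o[Bornology.cobounded E3] fun y => (‖y‖ ^ b)⁻¹ := by
  refine IsBigO.trans_isLittleO ?_ h
  let L : (E3 →L[ℝ] ℝ) →L[ℝ] ℝ := ContinuousLinearMap.apply ℝ ℝ (EuclideanSpace.single l (1 : ℝ))
  refine IsBigO.of_bound ‖L‖ ?_
  filter_upwards [eventually_mem_exterior R] with y hy
  have h1 : ContDiffAt ℝ ∞ (fderiv ℝ q) y :=
    (ContDiffOn.fderiv_of_isOpen (m := ∞) hq (isOpen_exterior R) (by simp)).contDiffAt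
      ((isOpen_exterior R).mem_nhds hy)
  have h2 := L.norm_iteratedFDeriv_comp_left h1 (n := m) (by exact_mod_cast le_top)
  rw [norm_iteratedFDeriv_fderiv] at h2
  exact h2

lemma fderiv_comp_smul_apply {q : E3 → ℝ} {r : ℝ} {x : E3} (hq : DifferentiableAt ℝ q (r • x))
    (v : E3) : fderiv ℝ (fun y => q (r • y)) x v = r * fderiv ℝ q (r • x) v := by
  have h1 : HasFDerivAt (fun y : E3 => r • y) (r • ContinuousLinearMap.id ℝ E3) x :=
    (hasFDerivAt_id x).const_smul r
  have h2 := (hq.hasFDerivAt.comp x h1).fderiv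
  change fderiv ℝ (q ∘ fun y => r • y) x v = _
  rw [h2]
  simp

/-- A tangential derivative of `q(r ·)` equals `r` times a combination of the partial derivatives of
`q` at `r x`. The factor `r` is absorbed by the improved decay of those derivatives, so the
induction applies to `partialD l q` with `a + 1` in place of `a`. -/
lemma sLim_exterior : ∀ (n : ℕ) (q : E3 → ℝ) (a : ℕ) {R : ℝ},
    ContDiffOn ℝ ∞ q (Metric.closedBall (0 : E3) R)ᶜ →
    (∀ m ≤ n, iteratedFDeriv ℝ m q =o[Bornology.cobounded E3] fun y => (‖y‖ ^ (a + m))⁻¹) →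
    SLim n (fun r x => r ^ a * q (r • x)) (fun _ => 0) := by
  have base : ∀ (q : E3 → ℝ) (a : ℕ) {R : ℝ},
      ContDiffOn ℝ ∞ q (Metric.closedBall (0 : E3) R)ᶜ →
      (iteratedFDeriv ℝ 0 q =o[Bornology.cobounded E3] fun y => (‖y‖ ^ a)⁻¹) →
      SLimZero (fun r x => r ^ a * q (r • x)) (fun _ => 0) := by
    intro q a R hq ho
    refine ⟨sphereSmooth_const 0, ?_, fun x hx => ?_⟩
    · filter_upwards [eventually_gt_atTop R, eventually_gt_atTop 0] with r hr h0
      exact continuousOn_const.mul (hq.continuousOn.comp (by fun_prop)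
        fun x hx => smul_mem_exterior hr h0 hx)
    · have h1 : q =o[Bornology.cobounded E3] fun y => (‖y‖ ^ a)⁻¹ := by
        rw [← isLittleO_norm_left] at ho ⊢
        simpa only [norm_iteratedFDeriv_zero] using ho
      have h2 := (h1.comp_tendsto (tendsto_smul_cobounded (x := x))).tendsto_div_nhds_zero
      refine h2.congr' ?_
      filter_upwards [(eventually_gt_atTop (0 : ℝ)).prod_mk self_mem_nhdsWithin] with p hp
      simp only [Function.comp, norm_smul, norm_eq_one_of_mem hp.2, mul_one,
        Real.norm_of_nonneg hp.1.le, div_inv_eq_mul]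
      ring
  intro n
  induction n with
  | zero => intro q a R hq h; exact base q a hq (by simpa using h 0 le_rfl)
  | succ n ih =>
    intro q a R hq h
    have hd : ∀ r > max R 0, ∀ x ∈ S2, DifferentiableAt ℝ q (r • x) := fun r hr x hx =>
      (hq.contDiffAt ((isOpen_exterior R).mem_nhds
        (smul_mem_exterior (lt_of_le_of_lt (le_max_left _ _) hr)
          (lt_of_le_of_lt (le_max_right _ _) hr) hx))).differentiableAt (by simp)
    have hd' : ∀ r > max R 0, ∀ x ∈ S2, DifferentiableAt ℝ (fun y => q (r • y)) x :=
      fun r hr x hx => DifferentiableAt.comp (g := q) (f := fun y => r • y) x (hd r hr x hx)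
        (by fun_prop)
    refine ⟨base q a hq (by simpa using h 0 (Nat.zero_le _)), ?_, fun i => ?_⟩
    · filter_upwards [eventually_gt_atTop (max R 0)] with r hr x hx
      exact (sDiff_const _).mul (DifferentiableAt.sDiff hx (hd' r hr x hx))
    · have h1 : ∀ l, SLim n (fun r x => r ^ (a + 1) * partialD l q (r • x)) (fun _ => 0) := by
        intro l
        refine ih (partialD l q) (a + 1) (contDiffOn_partialD (isOpen_exterior R) hq l) ?_
        intro m hm
        have := isLittleO_partialD hq (h (m + 1) (by omega)) l
        rwa [show a + (m + 1) = a + 1 + m by ring] at this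
      have h2 : ∀ l, SphereSmooth fun x => tang x i l := fun l => by
        simpa [spatial] using smooth_spatial_tang i l.succ
      have h3 : Ex 0 n _ _ := Ex.sum Finset.univ fun l _ => (Ex.const (N := 0) (h2 l)).mul (h1 l)
      refine SLim.congr_lim (SLim.congr h3 ?_) ?_
      · filter_upwards [eventually_gt_atTop (max R 0)] with r hr x hx
        rw [sd_const_mul, sd_eq_fderiv hx (hd' r hr x hx), fderiv_comp_smul_apply (hd r hr x hx),
          apply_eq_sum_single, Finset.mul_sum, Finset.mul_sum]
        exact Finset.sum_congr rfl fun l _ => by rw [partialD]; ring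
      · intro x hx
        simp [sd_const]

/-! ### Restriction of expansions to large spheres -/

/-- The homogeneous function of degree `-a` with given values on the sphere. -/
noncomputable def homog (a : ℕ) (c : E3 → ℝ) (z : E3) : ℝ := radialExt c z / ‖z‖ ^ a

lemma contDiffOn_homog (a : ℕ) {c : E3 → ℝ} (hc : SphereSmooth c) :
    ContDiffOn ℝ ∞ (homog a c) {0}ᶜ := by
  refine ContDiffOn.div hc ?_ fun y hy => pow_ne_zero _ (norm_ne_zero_iff.mpr hy)
  intro y hy
  exact ((contDiffAt_norm ℝ hy).pow a).contDiffWithinAt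

lemma homog_smul (a : ℕ) (c : E3 → ℝ) {r : ℝ} (hr : 0 < r) (z : E3) :
    homog a c (r • z) = (r ^ a)⁻¹ * homog a c z := by
  have : ‖r • z‖⁻¹ • r • z = ‖z‖⁻¹ • z := by
    rw [norm_smul, Real.norm_of_nonneg hr.le, smul_smul]
    congr 1
    field_simp
  simp only [homog, radialExt, this]
  rw [norm_smul, Real.norm_of_nonneg hr.le, mul_pow, mul_comm (r ^ a), ← div_div,
    div_eq_inv_mul _ (r ^ a)]

lemma homog_of_mem (a : ℕ) (c : E3 → ℝ) {x : E3} (hx : x ∈ S2) : homog a c x = c x := by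
  simp [homog, radialExt_of_mem c hx, norm_eq_one_of_mem hx]

lemma differentiableAt_homog (a : ℕ) {c : E3 → ℝ} (hc : SphereSmooth c) {z : E3} (hz : z ≠ 0) :
    DifferentiableAt ℝ (homog a c) z :=
  ((contDiffOn_homog a hc).contDiffAt (isOpen_compl_zero.mem_nhds hz)).differentiableAt (by simp)

lemma partialD_homog_smul (a : ℕ) {c : E3 → ℝ} (hc : SphereSmooth c) {r : ℝ} (hr : 0 < r) {x : E3}
    (hx : x ∈ S2) (l : Fin 3) :
    partialD l (homog a c) (r • x) = (r ^ (a + 1))⁻¹ * partialD l (homog a c) x := by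
  have h1 := fderiv_comp_smul_apply (q := homog a c) (r := r) (x := x)
    (differentiableAt_homog a hc (smul_ne_zero hr.ne' (ne_zero_of_mem hx)))
    (EuclideanSpace.single l (1 : ℝ))
  have h2 : (fun y => homog a c (r • y)) = (r ^ a)⁻¹ • homog a c :=
    funext fun y => homog_smul a c hr y
  rw [h2, fderiv_const_smul_field] at h1
  simp only [partialD]
  simp only [smul_apply, smul_eq_mul, Pi.smul_apply] at h1
  field_simp at h1 ⊢
  linear_combination -h1

lemma sphereSmooth_partialD_homog (a : ℕ) {c : E3 → ℝ} (hc : SphereSmooth c) (l : Fin 3) :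
    SphereSmooth (partialD l (homog a c)) :=
  sphereSmooth_of_contDiffOn (contDiffOn_partialD isOpen_compl_zero (contDiffOn_homog a hc) l)

section Expansion
variable {q : E3 → ℝ} {c₀ : ℝ} {a n : ℕ} {R : ℝ}

lemma HasExpansionAtInfinity.exists_remainder (h : HasExpansionAtInfinity q c₀ a n) (hR : 0 < R)
    (hq : ContDiffOn ℝ ∞ q (Metric.closedBall (0 : E3) R)ᶜ) :
    ∃ c₁ c₂ p : E3 → ℝ, SphereSmooth c₁ ∧ SphereSmooth c₂ ∧
      ContDiffOn ℝ ∞ p (Metric.closedBall (0 : E3) R)ᶜ ∧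
      (∀ m ≤ n, iteratedFDeriv ℝ m p =o[Bornology.cobounded E3]
        fun y => (‖y‖ ^ (a + 1 + m))⁻¹) ∧
      ∀ z, q z = c₀ + homog a c₁ z + homog (a + 1) c₂ z + p z := by
  obtain ⟨c₁, c₂, h1, h2, ho⟩ := h
  have hsub : (Metric.closedBall (0 : E3) R)ᶜ ⊆ {0}ᶜ := by
    intro y hy h0
    simp only [Set.mem_singleton_iff] at h0
    subst h0
    simp [hR.le] at hy
  refine ⟨c₁, c₂, fun z => q z - c₀ - homog a c₁ z - homog (a + 1) c₂ z, h1, h2, ?_, ho,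
    fun z => by ring⟩
  exact ((hq.sub contDiffOn_const).sub ((contDiffOn_homog a h1).mono hsub)).sub
    ((contDiffOn_homog (a + 1) h2).mono hsub)

lemma HasExpansionAtInfinity.ex_one (h : HasExpansionAtInfinity q c₀ 1 n) (hR : 0 < R)
    (hq : ContDiffOn ℝ ∞ q (Metric.closedBall (0 : E3) R)ᶜ) :
    Ex 2 n (fun r x => q (r • x)) (fun _ => c₀) := by
  obtain ⟨c₁, c₂, p, h1, h2, hp, ho, e⟩ := h.exists_remainder hR hq
  have hp2 := (sLim_exterior n p 2 hp fun m hm => ho m hm).ex_sq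
  have hc := Ex.const (N := 2) (n := n) (sphereSmooth_const c₀)
  refine ((((hc.add (Ex.const (N := 1) h1).of_scaled).add
    (Ex.const (N := 0) h2).of_scaled.of_scaled).add hp2).congr ?_).congr_lim fun x _ => by simp
  filter_upwards [eventually_gt_atTop 0] with r hr x hx
  rw [e, homog_smul _ _ hr, homog_smul _ _ hr, homog_of_mem _ _ hx, homog_of_mem _ _ hx]
  field_simp; ring

/-- Partial derivatives lower the degree of homogeneity by one, and the factor `r` restores it. This
form is used for the Christoffel symbols, which occur multiplied by `r` because the tangent vectors
of `Σ_r` have length of order `r`. -/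
lemma HasExpansionAtInfinity.ex_partialD (h : HasExpansionAtInfinity q c₀ 1 (n + 1)) (hR : 0 < R)
    (hq : ContDiffOn ℝ ∞ q (Metric.closedBall (0 : E3) R)ᶜ) (l : Fin 3) :
    Ex 2 n (fun r x => r * partialD l q (r • x)) (fun _ => 0) := by
  obtain ⟨c₁, c₂, p, h1, h2, hp, ho, e⟩ := h.exists_remainder hR hq
  have hp3 := sLim_exterior n (partialD l p) 3 (contDiffOn_partialD (isOpen_exterior R) hp l)
    fun m hm => by
      have := isLittleO_partialD hp (ho (m + 1) (by omega)) l
      rwa [show 1 + 1 + (m + 1) = 3 + m by ring] at this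
  have hp2 : Ex 2 n (fun r x => r * partialD l p (r • x)) (fun _ => 0) :=
    (hp3.congr (Eventually.of_forall fun r x _ => by ring)).ex_sq
  refine ((((Ex.const (N := 1) (sphereSmooth_partialD_homog 1 h1 l)).of_scaled.add
    (Ex.const (N := 0) (sphereSmooth_partialD_homog 2 h2 l)).of_scaled.of_scaled).add hp2).congr
      ?_).congr_lim fun x _ => by simp
  filter_upwards [eventually_gt_atTop 0, eventually_gt_atTop R] with r hr hrR x hx
  have hne : r • x ≠ 0 := smul_ne_zero hr.ne' (ne_zero_of_mem hx)
  have d1 := differentiableAt_homog 1 h1 hne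
  have d2 := differentiableAt_homog 2 h2 hne
  have d3 : DifferentiableAt ℝ p (r • x) := (hp.contDiffAt ((isOpen_exterior R).mem_nhds
    (smul_mem_exterior hrR hr hx))).differentiableAt (by simp)
  have e1 : partialD l q (r • x) = partialD l (homog 1 c₁) (r • x) +
      partialD l (homog 2 c₂) (r • x) + partialD l p (r • x) := by
    have : q = fun z => c₀ + homog 1 c₁ z + homog 2 c₂ z + p z := funext e
    have h4 := (((hasFDerivAt_const c₀ (r • x)).add d1.hasFDerivAt).add d2.hasFDerivAt).add
      d3.hasFDerivAt
    simp only [partialD]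
    conv_lhs => rw [this]
    rw [show fderiv ℝ (fun z => c₀ + homog 1 c₁ z + homog 2 c₂ z + p z) (r • x) = _ from h4.fderiv]
    simp
  rw [e1, partialD_homog_smul 1 h1 hr hx, partialD_homog_smul 2 h2 hr hx]
  field_simp; ring

lemma HasExpansionAtInfinity.ex_two (h : HasExpansionAtInfinity q 0 2 n) (hR : 0 < R)
    (hq : ContDiffOn ℝ ∞ q (Metric.closedBall (0 : E3) R)ᶜ) :
    Ex 2 n (fun r x => r * q (r • x)) (fun _ => 0) := by
  obtain ⟨c₁, c₂, p, h1, h2, hp, ho, e⟩ := h.exists_remainder hR hq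
  have hp2 : Ex 2 n (fun r x => r * p (r • x)) (fun _ => 0) :=
    ((sLim_exterior n p 3 hp fun m hm => ho m hm).congr
      (Eventually.of_forall fun r x _ => by ring)).ex_sq
  refine ((((Ex.const (N := 1) h1).of_scaled.add
    (Ex.const (N := 0) h2).of_scaled.of_scaled).add hp2).congr ?_).congr_lim fun x _ => by simp
  filter_upwards [eventually_gt_atTop 0] with r hr x hx
  rw [e, homog_smul _ _ hr, homog_smul _ _ hr, homog_of_mem _ _ hx, homog_of_mem _ _ hx]
  field_simp; ring

end Expansion

/-! ### Coordinate spheres -/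

namespace InitialDataSet
open SurfaceInSpacetime

variable {M : Type*} [TopologicalSpace M] [ChartedSpace E3 M] [IsManifold 𝓘(ℝ, E3) ∞ M]
  {D : InitialDataSet M} {Φ : OpenPartialHomeomorph M E3}

lemma spacetimeConn_smul (y : E3) (t : ℝ) (v : E3) :
    D.spacetimeConn Φ y (t • v) = t • D.spacetimeConn Φ y v := by
  ext μ ν
  refine Fin.cases (Fin.cases ?_ (fun j => ?_) ν) (fun i => Fin.cases ?_ (fun j => ?_) ν) μ <;>
  simp only [spacetimeConn, Matrix.smul_apply, Matrix.of_apply, Fin.cons_zero, Fin.cons_succ,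
    smul_eq_mul, PiLp.smul_apply, Finset.mul_sum, mul_zero] <;>
  simp only [mul_assoc, mul_left_comm _ t]

lemma spacetimeConn_add (y : E3) (v w : E3) :
    D.spacetimeConn Φ y (v + w) = D.spacetimeConn Φ y v + D.spacetimeConn Φ y w := by
  ext μ ν
  refine Fin.cases (Fin.cases ?_ (fun j => ?_) ν) (fun i => Fin.cases ?_ (fun j => ?_) ν) μ <;>
  simp only [spacetimeConn, Matrix.add_apply, Matrix.of_apply, Fin.cons_zero, Fin.cons_succ,
    PiLp.add_apply, mul_add, add_mul, Finset.sum_add_distrib, add_zero]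

lemma coordSphere_radial (r : ℝ) : (D.coordSphere Φ r).Radial where
  diff x hx := by
    have h := sum_smul_tang hx
    change ∑ i, x i • (Fin.cons 0 fun k => r * tang x i k : Vec4) = 0
    ext μ
    rw [Finset.sum_apply]
    refine Fin.cases ?_ (fun k => ?_) μ
    · simp
    · have := congrArg (fun v : E3 => r * v k) h
      simpa [Finset.mul_sum, mul_left_comm] using this
  conn x hx := by
    let L : E3 →+ Matrix (Fin 4) (Fin 4) ℝ :=
      AddMonoidHom.mk' (fun v => D.spacetimeConn Φ (r • x) (r • v)) fun v w => by
        rw [smul_add, spacetimeConn_add]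
    have h1 : ∀ i, x i • D.spacetimeConn Φ (r • x) (r • tang x i) = L (x i • tang x i) := fun i => by
      change _ = D.spacetimeConn Φ (r • x) (r • x i • tang x i)
      rw [smul_comm r (x i), spacetimeConn_smul (D := D) (Φ := Φ) (r • x) (x i)]
    change ∑ i, x i • D.spacetimeConn Φ (r • x) (r • tang x i) = 0
    simp only [h1, ← map_sum, sum_smul_tang hx, map_zero]

/-- The connection form is evaluated on `r • v`, so its entries are contractions of `r Γ` and `r k`.
Both are `O(1/r)`: `Γ` contains one derivative of `g - δ`, and `k` is `O(r⁻²)`. One tangential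
derivative remains, since `g` may be differentiated twice and `k` once. -/
lemma IsAsymptoticallyFlat.normalizedFamily (hD : D.IsAsymptoticallyFlat Φ) :
    NormalizedFamily fun r => (D.coordSphere Φ r).rescale r := by
  obtain ⟨R, hR, hT⟩ := hD.target
  have hg := fun i j => (hD.g_expansion i j).ex_one hR (hT ▸ hD.g_smooth i j)
  have hdg := fun i j l => (hD.g_expansion i j).ex_partialD hR (hT ▸ hD.g_smooth i j) l
  have hk := fun i j => (hD.k_expansion i j).ex_two hR (hT ▸ hD.k_smooth i j)
  have hginv : MEx 2 2 (fun r x => (D.gComp Φ (r • x))⁻¹)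
      (fun _ => (1 : Matrix (Fin 3) (Fin 3) ℝ)) := by
    have h1 : MEx 2 2 (fun r x => D.gComp Φ (r • x)) (fun _ => (1 : Matrix (Fin 3) (Fin 3) ℝ)) := by
      intro i j
      simpa only [Matrix.one_apply] using hg i j
    simpa using h1.inv fun x _ => by simp
  have htang : ∀ i l, Ex 2 1 (fun _ x => tang x i l) (fun x => tang x i l) := fun i l => by
    simpa [spatial] using Ex.const (N := 2) (n := 1) (smooth_spatial_tang i l.succ)
  have hΓ : ∀ i j l, Ex 2 1 (fun r x => r * D.christoffel Φ (r • x) i j l) (fun _ => 0) := by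
    intro i j l
    have h1 := (Ex.sum Finset.univ fun s _ => (hginv i s).mono_right.mul
      (((hdg l s j).add (hdg j s l)).sub (hdg j l s))).const_mul (1 / 2)
    refine (h1.congr (Eventually.of_forall fun r x _ => ?_)).congr_lim fun x _ => by simp
    simp only [christoffel, Finset.mul_sum]
    refine Finset.sum_congr rfl fun s _ => ?_
    simp only [partialD]
    ring
  refine ⟨Eventually.of_forall fun r => (coordSphere_radial r).rescale r, ?_, ?_, ?_⟩
  · intro μ ν
    refine Fin.cases (Fin.cases ?_ (fun j => ?_) ν) (fun i => Fin.cases ?_ (fun j => ?_) ν) μ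
    · simpa [rescale, coordSphere, spacetimeMetric, minkowski] using
        Ex.const (sphereSmooth_const (-1))
    · simpa [rescale, coordSphere, spacetimeMetric, minkowski, Matrix.diagonal_apply,
        (Fin.succ_ne_zero j).symm] using Ex.const (sphereSmooth_const 0)
    · simpa [rescale, coordSphere, spacetimeMetric, minkowski] using
        Ex.const (sphereSmooth_const 0)
    · simpa [rescale, coordSphere, spacetimeMetric, minkowski, Matrix.diagonal_apply] using hg i j
  · intro i μ ν
    change Ex 2 1 (fun r x => D.spacetimeConn Φ (r • x) (r • tang x i) μ ν) _
    simp only [spacetimeConn_smul, Matrix.smul_apply, smul_eq_mul]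
    refine Fin.cases (Fin.cases ?_ (fun j => ?_) ν) (fun s => Fin.cases ?_ (fun j => ?_) ν) μ
    · simpa [spacetimeConn] using Ex.const (sphereSmooth_const 0)
    · refine ((Ex.sum Finset.univ fun l _ => (htang i l).mul (hk l j)).congr
        (Eventually.of_forall fun r x _ => ?_)).congr_lim fun x _ => by simp
      simp only [spacetimeConn, Matrix.of_apply, Fin.cons_zero, Fin.cons_succ, Finset.mul_sum]
      exact Finset.sum_congr rfl fun l _ => by ring
    · refine ((Ex.sum Finset.univ fun t _ => Ex.sum Finset.univ fun l _ =>
        ((hginv s t).mono_right.mul (htang i l)).mul (hk l t)).congr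
        (Eventually.of_forall fun r x _ => ?_)).congr_lim fun x _ => by simp
      simp only [spacetimeConn, Matrix.of_apply, Fin.cons_zero, Fin.cons_succ, Finset.mul_sum]
      exact Finset.sum_congr rfl fun t _ => Finset.sum_congr rfl fun l _ => by ring
    · refine ((Ex.sum Finset.univ fun l _ => (htang i l).mul (hΓ s l j)).congr
        (Eventually.of_forall fun r x _ => ?_)).congr_lim fun x _ => by simp
      simp only [spacetimeConn, Matrix.of_apply, Fin.cons_succ, Finset.mul_sum]
      exact Finset.sum_congr rfl fun l _ => by ring
  · intro i
    refine (vEx_const (smooth_spatial_tang i)).congr ?_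
    filter_upwards [eventually_ne_atTop 0] with r hr x hx
    change spatial (tang x i) = r⁻¹ • (Fin.cons 0 fun k => r * tang x i k : Vec4)
    ext μ
    refine Fin.cases ?_ (fun k => ?_) μ
    · simp [spatial]
    · simp [spatial, hr]

end InitialDataSet

/-! ### Smallness of tangential derivatives from smallness of derivatives -/

lemma radialExt_smul (f : E3 → ℝ) {t : ℝ} (ht : 0 < t) (y : E3) :
    radialExt f (t • y) = radialExt f y := by
  unfold radialExt
  congr 1
  rw [norm_smul, Real.norm_of_nonneg ht.le, smul_smul]
  congr 1
  field_simp

/-- The radial extension is homogeneous of degree zero. Hence its derivative along `y` vanishes,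
which allows `tang` to be replaced by a fixed basis vector, and its partial derivatives have degree
`-1`, which the factor `‖y‖` compensates. Iterated tangential derivatives thereby become expressible
through derivatives in the ambient space. -/
lemma radialExt_sd {f : E3 → ℝ} (hf : SphereSmooth f) (i : Fin 3) {y : E3} (hy : y ≠ 0) :
    radialExt (sd i f) y = ‖y‖ * partialD i (radialExt f) y := by
  have hd : ∀ z : E3, z ≠ 0 → DifferentiableAt ℝ (radialExt f) z := fun z hz =>
    (ContDiffOn.contDiffAt hf (isOpen_compl_zero.mem_nhds hz)).differentiableAt (by simp)
  have hn : 0 < ‖y‖ := norm_pos_iff.mpr hy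
  have hx := normalize_mem hy
  set x := ‖y‖⁻¹ • y with hxdef
  have hyx : y = ‖y‖ • x := by rw [hxdef, smul_smul, mul_inv_cancel₀ hn.ne', one_smul]
  have hx0 := ne_zero_of_mem hx
  -- Euler's relation: the extension is constant along the ray through `x`.
  have h1 : fderiv ℝ (radialExt f) x x = 0 := by
    have hc : HasDerivAt (fun t : ℝ => t • x) x 1 := by
      simpa using (hasDerivAt_id (1 : ℝ)).smul_const x
    have h2 : HasDerivAt (fun t : ℝ => radialExt f (t • x)) (fderiv ℝ (radialExt f) x x) 1 :=
      HasFDerivAt.comp_hasDerivAt (l := radialExt f) (f := fun t : ℝ => t • x) (1 : ℝ)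
        (by simpa only [one_smul] using (hd x hx0).hasFDerivAt) hc
    have h3 : HasDerivAt (fun t : ℝ => radialExt f (t • x)) 0 1 := by
      refine (hasDerivAt_const (1 : ℝ) (radialExt f x)).congr_of_eventuallyEq ?_
      filter_upwards [lt_mem_nhds one_pos] with t ht using radialExt_smul f ht x
    exact h2.unique h3
  have h4 : fderiv ℝ (radialExt f) x (EuclideanSpace.single i 1) =
      ‖y‖ * fderiv ℝ (radialExt f) y (EuclideanSpace.single i 1) := by
    have h5 := fderiv_comp_smul_apply (q := radialExt f) (r := ‖y‖) (x := x)
      (hyx ▸ hd y hy) (EuclideanSpace.single i 1)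
    rw [← hyx, show (fun z => radialExt f (‖y‖ • z)) = radialExt f from
      funext fun z => radialExt_smul f hn z] at h5
    exact h5
  change fderiv ℝ (radialExt f) x (tang x i) = _
  rw [tang, map_sub, map_smul, h1, h4, partialD]
  simp

/-- The first `n` derivatives of the radial extensions of a family tend to zero on the sphere. -/
def SmallJet (n : ℕ) (g : ℝ → E3 → ℝ) : Prop :=
  (∀ᶠ r in atTop, SphereSmooth (g r)) ∧ ∀ m ≤ n, ∀ ε > (0 : ℝ), ∀ᶠ r : ℝ in atTop, ∀ x ∈ S2,
    ‖iteratedFDeriv ℝ m (radialExt (g r)) x‖ ≤ ε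

lemma norm_iteratedFDeriv_partialD_le {f : E3 → ℝ} {U : Set E3} (hU : IsOpen U)
    (hf : ContDiffOn ℝ ∞ f U) (i : Fin 3) (m : ℕ) {x : E3} (hx : x ∈ U) :
    ‖iteratedFDeriv ℝ m (partialD i f) x‖ ≤
      ‖(ContinuousLinearMap.apply ℝ ℝ (EuclideanSpace.single i (1 : ℝ) : E3) :
        (E3 →L[ℝ] ℝ) →L[ℝ] ℝ)‖ * ‖iteratedFDeriv ℝ (m + 1) f x‖ := by
  have h1 : ContDiffAt ℝ ∞ (fderiv ℝ f) x :=
    (ContDiffOn.fderiv_of_isOpen (m := ∞) hf hU (by simp)).contDiffAt (hU.mem_nhds hx)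
  have h2 := (ContinuousLinearMap.apply ℝ ℝ (EuclideanSpace.single i (1 : ℝ) : E3) :
    (E3 →L[ℝ] ℝ) →L[ℝ] ℝ).norm_iteratedFDeriv_comp_left h1 (n := m) (by exact_mod_cast le_top)
  rw [norm_iteratedFDeriv_fderiv] at h2
  exact h2

lemma contDiffOn_norm_compl_zero : ContDiffOn ℝ ∞ (fun y : E3 => ‖y‖) {0}ᶜ := fun _ hy =>
  (contDiffAt_norm ℝ hy).contDiffWithinAt

lemma exists_bound_iteratedFDeriv_norm (m : ℕ) :
    ∃ K : ℝ, 0 ≤ K ∧ ∀ x ∈ S2, ‖iteratedFDeriv ℝ m (fun y : E3 => ‖y‖) x‖ ≤ K := by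
  have h1 : ContinuousOn (iteratedFDerivWithin ℝ m (fun y : E3 => ‖y‖) {0}ᶜ) {0}ᶜ :=
    contDiffOn_norm_compl_zero.continuousOn_iteratedFDerivWithin (by exact_mod_cast le_top)
      isOpen_compl_zero.uniqueDiffOn
  obtain ⟨K, hK⟩ := (isCompact_sphere (0 : E3) 1).exists_bound_of_continuousOn
    (h1.mono fun x hx => ne_zero_of_mem hx)
  refine ⟨max K 0, le_max_right _ _, fun x hx => ?_⟩
  rw [← iteratedFDerivWithin_of_isOpen m isOpen_compl_zero (ne_zero_of_mem hx)]
  exact (hK x hx).trans (le_max_left _ _)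

/-- By `radialExt_sd` the extension of a tangential derivative is `‖y‖` times a partial derivative,
and the derivatives of `‖y‖` are bounded on the sphere, so the Leibniz rule applies. -/
lemma SmallJet.sd {n : ℕ} {g : ℝ → E3 → ℝ} (h : SmallJet (n + 1) g) (i : Fin 3) :
    SmallJet n (fun r => sd i (g r)) := by
  refine ⟨h.1.mono fun r hr => hr.sd i, fun m hm ε hε => ?_⟩
  choose K hK0 hK using exists_bound_iteratedFDeriv_norm
  set A := ‖(ContinuousLinearMap.apply ℝ ℝ (EuclideanSpace.single i (1 : ℝ) : E3) :
    (E3 →L[ℝ] ℝ) →L[ℝ] ℝ)‖ with hA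
  have hA0 : 0 ≤ A := by rw [hA]; positivity
  set C := ∑ j ∈ Finset.range (m + 1), (m.choose j : ℝ) * K j * A with hC
  have hC0 : 0 ≤ C := Finset.sum_nonneg fun j _ =>
    mul_nonneg (mul_nonneg (Nat.cast_nonneg _) (hK0 j)) hA0
  -- The Leibniz sum is at most `C` times the bound on the jets; `C + 1` avoids division by zero.
  have hδ : 0 < ε / (C + 1) := by positivity
  have hall : ∀ᶠ r in atTop, ∀ j ∈ Finset.range (n + 2), ∀ x ∈ S2,
      ‖iteratedFDeriv ℝ j (radialExt (g r)) x‖ ≤ ε / (C + 1) := by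
    rw [Finset.eventually_all]
    intro j hj
    exact h.2 j (by simpa [Nat.lt_succ_iff] using hj) _ hδ
  filter_upwards [h.1, hall] with r hs hb x hx
  have hx0 : x ∈ ({0}ᶜ : Set E3) := ne_zero_of_mem hx
  have e : radialExt (CWY.sd i (g r)) =ᶠ[𝓝 x] fun y => ‖y‖ * partialD i (radialExt (g r)) y := by
    filter_upwards [isOpen_compl_zero.mem_nhds hx0] with y hy using radialExt_sd hs i hy
  rw [(e.iteratedFDeriv ℝ m).eq_of_nhds, ← iteratedFDerivWithin_of_isOpen m isOpen_compl_zero hx0]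
  refine (norm_iteratedFDerivWithin_mul_le contDiffOn_norm_compl_zero
    (contDiffOn_partialD isOpen_compl_zero hs i) isOpen_compl_zero.uniqueDiffOn hx0
    (n := m) (by exact_mod_cast le_top)).trans ?_
  calc _ ≤ ∑ j ∈ Finset.range (m + 1), (m.choose j : ℝ) * K j * A * (ε / (C + 1)) := by
        refine Finset.sum_le_sum fun j hj => ?_
        rw [iteratedFDerivWithin_of_isOpen j isOpen_compl_zero hx0,
          iteratedFDerivWithin_of_isOpen (m - j) isOpen_compl_zero hx0]
        have h1 := norm_iteratedFDeriv_partialD_le isOpen_compl_zero hs i (m - j) hx0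
        have h2 := hb (m - j + 1) (by simp; omega) x hx
        have h3 : ‖iteratedFDeriv ℝ (m - j) (partialD i (radialExt (g r))) x‖ ≤
            A * (ε / (C + 1)) := h1.trans (mul_le_mul_of_nonneg_left h2 hA0)
        rw [mul_assoc _ A]
        exact mul_le_mul (mul_le_mul_of_nonneg_left (hK j x hx) (Nat.cast_nonneg _)) h3
          (norm_nonneg _) (mul_nonneg (Nat.cast_nonneg _) (hK0 j))
    _ = C * (ε / (C + 1)) := by rw [← Finset.sum_mul]
    _ ≤ ε := by
        rw [mul_div_assoc', div_le_iff₀ (by positivity)]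
        nlinarith

lemma SmallJet.sLim : ∀ {n : ℕ} {g : ℝ → E3 → ℝ}, SmallJet n g → SLim n g (fun _ => 0) := by
  have base : ∀ {g : ℝ → E3 → ℝ} {n : ℕ}, SmallJet n g → SLimZero g (fun _ => 0) := by
    intro g n h
    refine ⟨sphereSmooth_const 0, h.1.mono fun r hr => hr.continuousOn, fun x hx => ?_⟩
    rw [Metric.tendsto_nhds]
    intro ε hε
    filter_upwards [(h.2 0 (Nat.zero_le _) (ε / 2) (half_pos hε)).prod_mk self_mem_nhdsWithin]
      with p hp
    have := hp.1 p.2 hp.2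
    rw [norm_iteratedFDeriv_zero, radialExt_of_mem _ hp.2] at this
    rw [dist_zero_right]
    linarith
  intro n
  induction n with
  | zero => intro g h; exact base h
  | succ n ih =>
    intro g h
    refine ⟨base h, h.1.mono fun r hr x hx => hr.sDiff hx, fun i => ?_⟩
    refine (ih (h.sd i)).congr_lim fun x _ => ?_
    rw [sd_const]

/-! ### Surfaces in Minkowski space -/

lemma SphereSmooth.apply {u : E3 → Vec4} (h : SphereSmooth u) (μ : Fin 4) :
    SphereSmooth fun x => u x μ :=
  (ContinuousLinearMap.proj μ : Vec4 →L[ℝ] ℝ).contDiff.comp_contDiffOn h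

/-- The remainder of the embedding is `o(1/r)`, so after division by `r` it is `o(r⁻²)`, as needed
for second order. `SmallJet` translates the iterated ambient derivatives of the hypothesis into
tangential ones. -/
lemma HasEmbeddingExpansion.vEx {X : ℝ → E3 → Vec4} (h : HasEmbeddingExpansion X)
    (hs : ∀ᶠ r in atTop, SphereSmooth (X r)) :
    VEx 2 3 (fun r x => r⁻¹ • X r x) spatial := by
  obtain ⟨Y₀, Y₁, h0, h1, hY⟩ := h
  intro μ
  set P : ℝ → E3 → Vec4 := fun r y =>
    X r y - r • (Fin.cons 0 fun i => y i : Vec4) - Y₀ y - r⁻¹ • Y₁ y with hP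
  have hspat : SphereSmooth (fun y : E3 => (Fin.cons 0 fun i => y i : Vec4)) :=
    contDiffOn_pi.mpr fun ν => smooth_spatial ν
  have hPs : ∀ᶠ r in atTop, SphereSmooth (P r) := by
    filter_upwards [hs] with r hr
    exact ((ContDiffOn.sub hr (ContDiffOn.const_smul r hspat)).sub h0).sub
      (ContDiffOn.const_smul r⁻¹ h1)
  have hjet : SmallJet 3 (fun r x => r * P r x μ) := by
    refine ⟨hPs.mono fun r hr => (sphereSmooth_const r).mul (hr.apply μ), fun m hm ε hε => ?_⟩
    let L : Vec4 →L[ℝ] ℝ := ContinuousLinearMap.proj μ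
    have hδ : 0 < ε / (‖L‖ + 1) := by positivity
    filter_upwards [hY m hm _ hδ, hPs, eventually_gt_atTop 0] with r hr hs hr0 x hx
    have hc : ContDiffAt ℝ ∞ (radialExt (P r)) x :=
      ContDiffOn.contDiffAt hs (isOpen_compl_zero.mem_nhds (ne_zero_of_mem hx))
    have e : radialExt (fun y => r * P r y μ) = (r • L) ∘ radialExt (P r) := rfl
    rw [e]
    refine ((r • L).norm_iteratedFDeriv_comp_left hc (n := m) (by exact_mod_cast le_top)).trans ?_
    calc ‖r • L‖ * ‖iteratedFDeriv ℝ m (radialExt (P r)) x‖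
        ≤ (r * ‖L‖) * (ε / (‖L‖ + 1) * r⁻¹) := by
          rw [norm_smul, Real.norm_of_nonneg hr0.le]
          exact mul_le_mul_of_nonneg_left (hr x hx) (by positivity)
      _ = ‖L‖ * (ε / (‖L‖ + 1)) := by field_simp
      _ ≤ ε := by
          rw [mul_div_assoc', div_le_iff₀ (by positivity)]
          nlinarith
  have hP2 : Ex 2 3 (fun r x => r⁻¹ * P r x μ) (fun _ => 0) := by
    refine SLim.ex_sq (hjet.sLim.congr ?_)
    filter_upwards [eventually_ne_atTop 0] with r hr x _
    field_simp
  refine ((((Ex.const (smooth_spatial μ)).add (Ex.const (N := 1) (h0.apply μ)).of_scaled).add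
    (Ex.const (N := 0) (h1.apply μ)).of_scaled.of_scaled).add hP2).congr ?_ |>.congr_lim
      fun x _ => by simp
  filter_upwards [eventually_ne_atTop 0] with r hr x _
  simp only [hP, Pi.sub_apply, Pi.smul_apply, smul_eq_mul, spatial]
  field_simp; ring

lemma minkowskiSurface_radial (X : E3 → Vec4) : (minkowskiSurface X).Radial where
  diff x hx := by
    change ∑ i, x i • fderiv ℝ (radialExt X) x (tang x i) = 0
    simp only [← map_smul, ← map_sum, sum_smul_tang hx, map_zero]
  conn x hx := by simp [minkowskiSurface]

lemma rescale_minkowskiSurface_diff (X : E3 → Vec4) (r : ℝ) (x v : E3) :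
    ((minkowskiSurface X).rescale r).diff x v = sphereD (fun y => r⁻¹ • X y) x v := by
  have : radialExt (fun y => r⁻¹ • X y) = r⁻¹ • radialExt X := rfl
  simp only [SurfaceInSpacetime.rescale, minkowskiSurface, sphereD, this, fderiv_const_smul_field]
  rfl

section Embedding
variable {X : ℝ → E3 → Vec4}

/-- The differential consumes one of the three derivatives of the embedding, which leaves the two
required by `NormalizedFamily`. -/
lemma normalizedFamily_minkowskiSurface (h : VEx 2 3 (fun r x => r⁻¹ • X r x) spatial) :
    NormalizedFamily fun r => (minkowskiSurface (X r)).rescale r where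
  radial := Eventually.of_forall fun r => (minkowskiSurface_radial (X r)).rescale r
  metric μ ν := Ex.const (sphereSmooth_const _)
  conn i μ ν := Ex.const (sphereSmooth_const 0)
  diff i := by
    simp only [rescale_minkowskiSurface_diff]
    refine (h.sphereD i).congr_lim fun x hx => ?_
    ext μ
    refine Fin.cases ?_ (fun k => ?_) μ
    · simp [spatial, sd_const]
    · simp [spatial, sd_coord hx]

/-- The connection one-form of a nearly round sphere in Minkowski space is exact to leading order. -/
lemma exists_potential_alphaH (h : VEx 2 3 (fun r x => r⁻¹ • X r x) spatial) :
    ∃ φ, SphereSmooth φ ∧ ∀ i, Ex 1 0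
      (fun r x => r * ((minkowskiSurface (X r)).rescale r).alphaH x (tang x i)) (sd i φ) := by
  have hS := normalizedFamily_minkowskiSurface h
  set S : ℝ → SurfaceInSpacetime := fun r => (minkowskiSurface (X r)).rescale r with hSdef
  set T : ℝ → E3 → Vec4 := fun r x => ((S r).normH x)⁻¹ • (S r).J x with hT
  set V : ℝ → E3 → Vec4 := fun r x => ((S r).normH x)⁻¹ • (S r).meanCurv x with hV
  set U : ℝ → E3 → Vec4 := fun r x => r⁻¹ • X r x with hU
  have hTex : VEx 2 1 T (fun _ => Pi.single 0 1) := hS.timeDir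
  have hVex : VEx 2 1 V (fun x => -spatial x) := hS.spaceDir
  have hT1 : ∀ k : Fin 3, ∃ d, Ex 1 1 (fun r x => r * T r x k.succ) d := fun k =>
    Ex.scaled ((hTex k.succ).congr_lim fun x _ => by simp)
  choose n hn using hT1
  obtain ⟨v₀, hv₀⟩ := Ex.scaled ((hVex 0).congr_lim (d := fun _ => 0) fun x _ => by simp [spatial])
  obtain ⟨y₀, hy₀⟩ := Ex.scaled ((h 0).congr_lim (d := fun _ => 0) fun x _ => by simp [spatial])
  have hTd : ∀ i (k : Fin 3), Ex 1 0 (fun r x => r * sd i (fun y => T r y k.succ) x)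
      (sd i (n k)) := fun i k => ((hn k).sd i).congr (Eventually.of_forall fun r x _ => by
    rw [sd_const_mul])
  have hyd : ∀ i, Ex 1 2 (fun r x => r * sd i (fun y => U r y 0) x) (sd i y₀) := fun i =>
    (hy₀.sd i).congr (Eventually.of_forall fun r x _ => by rw [sd_const_mul])
  -- With `T = ∂_0 + n/r + …` and `X^0 = y₀ + …`, the limit of `r α_{H₀}` is `-x·dn` (`hdx`). As
  -- `dy₀ = n·dx` (`horth`), this equals `d(y₀ - x·n)` by the Leibniz rule.
  set φ : E3 → ℝ := fun x => y₀ x + (-1) * ∑ k, x k * n k x with hφ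
  have hsum : SphereSmooth fun x : E3 => ∑ k, x k * n k x :=
    (Ex.sum (N := 0) (n := 0) Finset.univ fun k _ =>
      Ex.const ((sphereSmooth_coord k).mul (hn k).smooth)).smooth
  refine ⟨φ, hy₀.smooth.add ((sphereSmooth_const _).mul hsum), fun i => ?_⟩
  obtain ⟨d, hd⟩ := (hS.alphaH i).scaled
  refine hd.congr_lim fun x hx => ?_
  have hTs : ∀ᶠ r in atTop, ∀ μ, SDiff (fun y => T r y μ) x :=
    eventually_all.mpr fun μ => (hTex μ).sDiff.mono fun r hr => hr x hx
  have hUs : ∀ᶠ r in atTop, ∀ μ, SDiff (fun y => U r y μ) x :=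
    eventually_all.mpr fun μ => (h μ).sDiff.mono fun r hr => hr x hx
  -- In `r ⟨∂_i T, V⟩` the time component disappears, because `∂_i T^0` tends to zero and `r V^0`
  -- converges. The spatial components converge with `r ∂_i T^k → ∂_i n_k` and `V^k → -x_k`.
  have hdx : d x = -∑ k, x k * sd i (n k) x := by
    refine hd.unique hx ?_
    have l1 : Tendsto (fun r => -(sd i (fun y => T r y 0) x * (r * V r x 0)) +
        ∑ k : Fin 3, (r * sd i (fun y => T r y k.succ) x) * V r x k.succ) atTop
        (𝓝 (-(0 * v₀ x) + ∑ k : Fin 3, sd i (n k) x * -(x k))) := by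
      refine Tendsto.add (Tendsto.neg (Tendsto.mul ?_ (hv₀.tendsto hx))) (tendsto_finsetSum _
        fun k _ => Tendsto.mul ((hTd i k).tendsto hx) ?_)
      · have := ((hTex 0).sd i).tendsto hx
        simpa [sd_const] using this
      · have := (hVex k.succ).tendsto hx
        simpa [spatial] using this
    have e : -(0 * v₀ x) + ∑ k : Fin 3, sd i (n k) x * -(x k) = -∑ k, x k * sd i (n k) x := by
      simp [mul_comm]
    rw [e] at l1
    refine l1.congr' ?_
    filter_upwards [hTs] with r hr
    have e1 : (S r).alphaH x (tang x i) = mink (sphereD (T r) x (tang x i)) (V r x) := by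
      have e2 : (S r).covD (T r) x (tang x i) = sphereD (T r) x (tang x i) := by
        simp [SurfaceInSpacetime.covD, hSdef, SurfaceInSpacetime.rescale, minkowskiSurface]
      change (S r).ip x ((S r).covD (T r) x (tang x i)) (V r x) = _
      rw [e2]
      rfl
    rw [e1, mink_eq]
    simp only [sphereD_apply hr]
    rw [mul_add, Finset.mul_sum]
    congr 1
    · ring
    · exact Finset.sum_congr rfl fun k _ => by ring
  -- This is the limit of `r ⟨T, ∂_i (X/r)⟩ = 0`.
  have horth : sd i y₀ x = ∑ k, n k x * tang x i k := by
    have l1 : Tendsto (fun r => -(T r x 0 * (r * sd i (fun y => U r y 0) x)) +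
        ∑ k : Fin 3, (r * T r x k.succ) * sd i (fun y => U r y k.succ) x) atTop
        (𝓝 (-(1 * sd i y₀ x) + ∑ k : Fin 3, n k x * tang x i k)) := by
      refine Tendsto.add (Tendsto.neg (Tendsto.mul ?_ ((hyd i).tendsto hx))) (tendsto_finsetSum _
        fun k _ => Tendsto.mul ((hn k).tendsto hx) ?_)
      · simpa using (hTex 0).tendsto hx
      · have := ((h k.succ).sd i).tendsto hx
        simpa [spatial, sd_coord hx] using this
    have l2 : Tendsto (fun r => -(T r x 0 * (r * sd i (fun y => U r y 0) x)) +
        ∑ k : Fin 3, (r * T r x k.succ) * sd i (fun y => U r y k.succ) x) atTop (𝓝 0) := by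
      refine tendsto_const_nhds.congr' ?_
      filter_upwards [hUs, hS.radial, hS.det_ne_zero] with r hr hrad hdet
      have h1 := SurfaceInSpacetime.ip_J_diff hrad hx (hdet x hx) i
      have h2 : mink (T r x) (sphereD (U r) x (tang x i)) = 0 := by
        rw [hT, mink_smul_left, ← rescale_minkowskiSurface_diff]
        exact mul_eq_zero_of_right _ h1
      rw [mink_eq] at h2
      simp only [sphereD_apply hr] at h2
      have h3 := congrArg (fun t => r * t) h2
      simp only [mul_zero, mul_add, Finset.mul_sum] at h3
      rw [← h3]
      congr 1
      · ring
      · exact Finset.sum_congr rfl fun k _ => by ring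
    have := tendsto_nhds_unique l1 l2
    linarith
  have hsd : ∀ k, SDiff (fun y : E3 => y k * n k y) x := fun k =>
    ((sphereSmooth_coord k).sDiff hx).mul ((hn k).smooth.sDiff hx)
  have hse : sd i (fun y : E3 => ∑ k, y k * n k y) x =
      ∑ k, (tang x i k * n k x + x k * sd i (n k) x) := by
    simp only [Fin.sum_univ_three]
    rw [sd_add ((hsd 0).add (hsd 1)) (hsd 2), sd_add (hsd 0) (hsd 1)]
    simp only [fun k => sd_mul ((sphereSmooth_coord k).sDiff hx) ((hn k).smooth.sDiff hx) hx i,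
      sd_coord hx]
  rw [hφ, sd_add (hy₀.smooth.sDiff hx) ((sDiff_const _).mul (hsum.sDiff hx)), sd_const_mul, hse,
    hdx, horth, Finset.sum_add_distrib]
  simp only [mul_comm (n _ x)]
  ring

end Embedding

/-! ### Rotations and integration by parts on the sphere -/

/-- A linear isometry acts on the unit sphere. -/
noncomputable def sphereMap (e : E3 ≃ₗᵢ[ℝ] E3) (x : Metric.sphere (0 : E3) 1) : Metric.sphere (0 : E3) 1 :=
  ⟨e x, by simp⟩

lemma continuous_sphereMap (e : E3 ≃ₗᵢ[ℝ] E3) : Continuous (sphereMap e) :=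
  Continuous.subtype_mk (e.continuous.comp continuous_subtype_val) _

-- The measure `toSphere` of a set is defined through the volume of the cone over it, and a linear
-- isometry maps cones to cones of the same volume.
open scoped Pointwise in
lemma measurePreserving_sphereMap (e : E3 ≃ₗᵢ[ℝ] E3) :
    MeasurePreserving (sphereMap e) (volume : Measure E3).toSphere
      (volume : Measure E3).toSphere := by
  refine ⟨(continuous_sphereMap e).measurable, ?_⟩
  ext s hs
  have hs' := (continuous_sphereMap e).measurable hs
  rw [Measure.map_apply (continuous_sphereMap e).measurable hs,
    Measure.toSphere_apply' _ hs', Measure.toSphere_apply' _ hs]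
  congr 1
  have hset : (Set.Ioo (0 : ℝ) 1 • ((↑) '' (sphereMap e ⁻¹' s) : Set E3)) =
      e ⁻¹' (Set.Ioo (0 : ℝ) 1 • ((↑) '' s : Set E3)) := by
    ext y
    simp only [Set.mem_smul, Set.mem_image, Set.mem_preimage]
    constructor
    · rintro ⟨t, ht, _, ⟨x, hx, rfl⟩, rfl⟩
      exact ⟨t, ht, _, ⟨_, hx, rfl⟩, by simp [sphereMap]⟩
    · rintro ⟨t, ht, _, ⟨x, hx, rfl⟩, h⟩
      refine ⟨t, ht, e.symm x, ⟨sphereMap e.symm x, ?_, rfl⟩, ?_⟩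
      · have : sphereMap e (sphereMap e.symm x) = x := Subtype.ext (by simp [sphereMap])
        simpa [this] using hx
      · rw [← map_smul, h, e.symm_apply_apply]
  rw [hset]
  exact e.measurePreserving.measure_preimage_equiv (f := e.toMeasurableEquiv) _

lemma sphereIntegral_comp_isometry (e : E3 ≃ₗᵢ[ℝ] E3) (f : E3 → ℝ) (hf : ContinuousOn f S2) :
    sphereIntegral (fun x => f (e x)) = sphereIntegral f := by
  unfold sphereIntegral
  have h := measurePreserving_sphereMap e
  have h2 := (integral_map (μ := (volume : Measure E3).toSphere) h.measurable.aemeasurable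
    (f := fun x : Metric.sphere (0 : E3) 1 => f x)
    (continuousOn_iff_continuous_domRestrict.mp hf).aestronglyMeasurable)
  rw [h.map_eq] at h2
  exact h2.symm

/-- The rotation by the angle `t` in the plane of the axes `l` and `k`. -/
noncomputable def rot (l k : Fin 3) (t : ℝ) (x : E3) : E3 :=
  x + (Real.cos t - 1) • (x l • EuclideanSpace.single l 1 + x k • EuclideanSpace.single k 1) +
    Real.sin t • (x l • EuclideanSpace.single k 1 - x k • EuclideanSpace.single l 1)

lemma exists_rot_isometry {l k : Fin 3} (hlk : l ≠ k) (t : ℝ) :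
    ∃ e : E3 ≃ₗᵢ[ℝ] E3, ∀ x, e x = rot l k t x := by
  let L : E3 →ₗ[ℝ] E3 :=
    { toFun := rot l k t
      map_add' := fun x y => by
        simp only [rot, PiLp.add_apply, add_smul, smul_add, smul_sub]; abel
      map_smul' := fun c x => by
        ext j
        simp only [rot, PiLp.add_apply, PiLp.sub_apply, PiLp.smul_apply, smul_eq_mul,
          RingHom.id_apply]
        ring }
  have hn : ∀ x, ‖L x‖ = ‖x‖ := by
    intro x
    have key : ∑ j, (rot l k t x) j * (rot l k t x) j = ∑ j, x j * x j := by
      have hc := Real.sin_sq_add_cos_sq t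
      simp only [rot, Fin.sum_univ_three, PiLp.add_apply, PiLp.sub_apply, PiLp.smul_apply,
        smul_eq_mul, PiLp.single_apply]
      fin_cases l <;> fin_cases k <;> first | exact absurd rfl hlk | skip
      · simp; linear_combination (x 0 ^ 2 + x 1 ^ 2) * hc
      · simp; linear_combination (x 0 ^ 2 + x 2 ^ 2) * hc
      · simp; linear_combination (x 1 ^ 2 + x 0 ^ 2) * hc
      · simp; linear_combination (x 1 ^ 2 + x 2 ^ 2) * hc
      · simp; linear_combination (x 2 ^ 2 + x 0 ^ 2) * hc
      · simp; linear_combination (x 2 ^ 2 + x 1 ^ 2) * hc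
    change ‖rot l k t x‖ = ‖x‖
    rw [EuclideanSpace.norm_eq, EuclideanSpace.norm_eq]
    congr 1
    simpa [sq] using key
  exact ⟨(⟨L, hn⟩ : E3 →ₗᵢ[ℝ] E3).toLinearIsometryEquiv rfl, fun x => rfl⟩

/-- The derivative of a function on the sphere along an infinitesimal rotation. -/
noncomputable def rotD (l k : Fin 3) (φ : E3 → ℝ) (x : E3) : ℝ := x l * sd k φ x - x k * sd l φ x

lemma SphereSmooth.rotD {φ : E3 → ℝ} (h : SphereSmooth φ) (l k : Fin 3) :
    SphereSmooth (rotD l k φ) :=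
  (((sphereSmooth_coord l).mul (h.sd k)).add
    ((sphereSmooth_const (-1)).mul ((sphereSmooth_coord k).mul (h.sd l)))).congr
    fun x _ => by unfold CWY.rotD; ring

lemma hasDerivAt_rot {l k : Fin 3} (hlk : l ≠ k) (x : E3) (t : ℝ) :
    HasDerivAt (fun s => rot l k s x) (rot l k t x l • EuclideanSpace.single k (1 : ℝ) -
      rot l k t x k • EuclideanSpace.single l (1 : ℝ)) t := by
  have h1 := (((Real.hasDerivAt_cos t).sub_const 1).smul_const
    (x l • EuclideanSpace.single l (1 : ℝ) + x k • EuclideanSpace.single k (1 : ℝ) : E3)).const_add x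
  have h2 := h1.add ((Real.hasDerivAt_sin t).smul_const
    (x l • EuclideanSpace.single k (1 : ℝ) - x k • EuclideanSpace.single l (1 : ℝ) : E3))
  refine h2.congr_deriv ?_
  have el : rot l k t x l = Real.cos t * x l - Real.sin t * x k := by
    simp [rot, hlk]; ring
  have ek : rot l k t x k = Real.cos t * x k + Real.sin t * x l := by
    simp [rot, hlk.symm]; ring
  rw [el, ek]
  module

/-- The rotation field is tangent to the sphere: the radial parts of `y l • tang y k` and `y k •
tang y l` are equal and cancel. -/
lemma rotD_eq_fderiv (l k : Fin 3) (φ : E3 → ℝ) (y : E3) :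
    rotD l k φ y = fderiv ℝ (radialExt φ) y
      (y l • EuclideanSpace.single k (1 : ℝ) - y k • EuclideanSpace.single l (1 : ℝ)) := by
  have : y l • EuclideanSpace.single k (1 : ℝ) - y k • EuclideanSpace.single l (1 : ℝ) =
      y l • tang y k - y k • tang y l := by
    unfold tang; module
  rw [this, map_sub, map_smul, map_smul]
  rfl

/-- Infinitesimal rotations integrate to zero over the sphere. -/
lemma sphereIntegral_rotD {φ : E3 → ℝ} (h : SphereSmooth φ) (l k : Fin 3) :
    sphereIntegral (rotD l k φ) = 0 := by
  by_cases hlk : l = k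
  · subst hlk
    simp [rotD, sphereIntegral]
  have hmem : ∀ t, ∀ x ∈ S2, rot l k t x ∈ S2 := fun t x hx => by
    obtain ⟨e, he⟩ := exists_rot_isometry hlk t
    rw [← he]
    simpa using hx
  have hcomp : ∀ ψ : E3 → ℝ, ContinuousOn ψ S2 → ∀ t,
      ContinuousOn (fun x => ψ (rot l k t x)) S2 := fun ψ hψ t => by
    obtain ⟨e, he⟩ := exists_rot_isometry hlk t
    refine hψ.comp ?_ (hmem t)
    exact (e.continuous.congr he).continuousOn
  -- By invariance of the measure, the integral of `φ` composed with the rotation by `t` does not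
  -- depend on `t`. Its derivative at `0`, taken under the integral sign with the supremum of `|rotD
  -- l k φ|` as dominating constant, is the integral in question.
  have hconst : ∀ t, ∫ x : Metric.sphere (0 : E3) 1, φ (rot l k t x)
      ∂(volume : Measure E3).toSphere = sphereIntegral φ := fun t => by
    obtain ⟨e, he⟩ := exists_rot_isometry hlk t
    rw [← sphereIntegral_comp_isometry e φ h.continuousOn]
    simp only [sphereIntegral, he]
  obtain ⟨K, hK⟩ := (isCompact_sphere (0 : E3) 1).exists_bound_of_continuousOn
    (h.rotD l k).continuousOn
  have hderiv : ∀ t, ∀ x ∈ S2, HasDerivAt (fun s => φ (rot l k s x))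
      (rotD l k φ (rot l k t x)) t := by
    intro t x hx
    have h1 : HasFDerivAt (radialExt φ) (fderiv ℝ (radialExt φ) (rot l k t x)) (rot l k t x) :=
      (h.sDiff (hmem t x hx)).hasFDerivAt
    have h2 := HasFDerivAt.comp_hasDerivAt (l := radialExt φ) (f := fun s => rot l k s x) t h1
      (hasDerivAt_rot hlk x t)
    rw [← rotD_eq_fderiv] at h2
    exact h2.congr_of_eventuallyEq (Eventually.of_forall fun s =>
      (radialExt_of_mem φ (hmem s x hx)).symm)
  have hD := (hasDerivAt_integral_of_dominated_loc_of_deriv_le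
    (μ := (volume : Measure E3).toSphere) (𝕜 := ℝ) (bound := fun _ => K) (x₀ := 0)
    (s := Set.univ)
    (F := fun t (x : Metric.sphere (0 : E3) 1) => φ (rot l k t x))
    (F' := fun t (x : Metric.sphere (0 : E3) 1) => rotD l k φ (rot l k t x)) univ_mem
    (Eventually.of_forall fun t => (sphereIntegrable (hcomp φ h.continuousOn t)).1)
    (sphereIntegrable (hcomp φ h.continuousOn 0))
    (sphereIntegrable (hcomp _ (h.rotD l k).continuousOn 0)).1
    (Eventually.of_forall fun x t _ => hK _ (hmem t x x.2))
    (integrable_const _)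
    (Eventually.of_forall fun x t _ => hderiv t x x.2)).2
  simp only [hconst] at hD
  have h0 := hD.unique (hasDerivAt_const (0 : ℝ) (sphereIntegral φ))
  have hr0 : ∀ x, rot l k 0 x = x := fun x => by simp [rot]
  simp only [hr0] at h0
  exact h0

lemma rotD_mul {f g : E3 → ℝ} (hf : SphereSmooth f) (hg : SphereSmooth g) (l k : Fin 3) {x : E3}
    (hx : x ∈ S2) :
    rotD l k (fun y => f y * g y) x = rotD l k f x * g x + f x * rotD l k g x := by
  unfold rotD
  rw [sd_mul (hf.sDiff hx) (hg.sDiff hx) hx, sd_mul (hf.sDiff hx) (hg.sDiff hx) hx]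
  ring

lemma rotD_coord (l k m : Fin 3) {x : E3} (hx : x ∈ S2) :
    rotD l k (fun y => y m) x = (if m = k then x l else 0) - (if m = l then x k else 0) := by
  unfold rotD
  rw [sd_coord hx, sd_coord hx, tang_apply, tang_apply]
  split_ifs <;> ring

/-- Integration by parts: the product rule combined with `sphereIntegral_rotD` moves the rotation
onto the coordinate, and rotations permute coordinates up to sign. -/
lemma sphereIntegral_mul_rotD {a : E3 → ℝ} (ha : SphereSmooth a) (l j m : Fin 3) :
    sphereIntegral (fun x => x m * rotD l j a x) =
      (if m = l then 1 else 0) * sphereIntegral (fun x => x j * a x) -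
        (if m = j then 1 else 0) * sphereIntegral (fun x => x l * a x) := by
  have h0 := sphereIntegral_rotD ((sphereSmooth_coord m).mul ha) l j
  have hc : ∀ i : Fin 3, ContinuousOn (fun x : E3 => x i * a x) S2 := fun i =>
    ((sphereSmooth_coord i).mul ha).continuousOn
  have h1 : sphereIntegral (rotD l j fun y => y m * a y) =
      sphereIntegral (fun x => x m * rotD l j a x + ((if m = j then 1 else 0) * (x l * a x) +
        (-(if m = l then 1 else 0)) * (x j * a x))) := by
    refine sphereIntegral_congr fun x hx => ?_
    rw [rotD_mul (sphereSmooth_coord m) ha l j hx, rotD_coord l j m hx]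
    split_ifs <;> ring
  rw [h1, sphereIntegral_add, sphereIntegral_add, sphereIntegral_const_mul,
    sphereIntegral_const_mul] at h0
  · linarith
  · exact continuousOn_const.mul (hc l)
  · exact continuousOn_const.mul (hc j)
  · exact ((sphereSmooth_coord m).mul (ha.rotD l j)).continuousOn
  · exact (continuousOn_const.mul (hc l)).add (continuousOn_const.mul (hc j))

/-- The first moments of the curl of a one-form on the round sphere determine its pairing with
rotation fields. -/
lemma sphereIntegral_rotation_of_curl {α : E3 → E3 → ℝ} {a : Fin 3 → E3 → ℝ}
    (ha : ∀ i, SphereSmooth (a i)) (hα : ∀ i, ∀ x ∈ S2, α x (tang x i) = a i x)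
    (h : ∀ i : Fin 3, sphereIntegral (fun x => x i * roundCurl α x) = 0) (l k : Fin 3) :
    sphereIntegral (fun x => x l * a k x) = sphereIntegral (fun x => x k * a l x) := by
  -- For each component of `α`, the antisymmetric symbol groups the derivatives into one
  -- infinitesimal rotation. After integration by parts the moment with `x m` involves exactly the
  -- two indices different from `m`, so the three moments yield the three required symmetries.
  have hcurl : ∀ x ∈ S2, roundCurl α x = rotD 1 2 (a 0) x * (-1) + rotD 2 0 (a 1) x * (-1) +
      rotD 0 1 (a 2) x * (-1) := by
    intro x hx
    have e : ∀ i j, sphereD (fun y => α y (tang y i)) x (tang x j) = sd j (a i) x := fun i j =>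
      sphereD_congr (hα i) hx _
    simp only [roundCurl, e, Fin.sum_univ_three, levi, rotD]
    simp
    ring
  have hI : ∀ m : Fin 3, sphereIntegral (fun x => x m * roundCurl α x) =
      -sphereIntegral (fun x => x m * rotD 1 2 (a 0) x) -
      sphereIntegral (fun x => x m * rotD 2 0 (a 1) x) -
      sphereIntegral (fun x => x m * rotD 0 1 (a 2) x) := by
    intro m
    have hc : ∀ i l j, ContinuousOn (fun x : E3 => x m * rotD l j (a i) x) S2 := fun i l j =>
      ((sphereSmooth_coord m).mul ((ha i).rotD l j)).continuousOn
    have : sphereIntegral (fun x => x m * roundCurl α x) = sphereIntegral (fun x =>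
        (-1) * (x m * rotD 1 2 (a 0) x) + ((-1) * (x m * rotD 2 0 (a 1) x) +
          (-1) * (x m * rotD 0 1 (a 2) x))) :=
      sphereIntegral_congr fun x hx => by rw [hcurl x hx]; ring
    rw [this, sphereIntegral_add, sphereIntegral_add, sphereIntegral_const_mul,
      sphereIntegral_const_mul, sphereIntegral_const_mul]
    · ring
    · exact continuousOn_const.mul (hc _ _ _)
    · exact continuousOn_const.mul (hc _ _ _)
    · exact continuousOn_const.mul (hc _ _ _)
    · exact (continuousOn_const.mul (hc _ _ _)).add (continuousOn_const.mul (hc _ _ _))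
  have h0 := h 0
  have h1 := h 1
  have h2 := h 2
  rw [hI] at h0 h1 h2
  simp only [sphereIntegral_mul_rotD (ha _)] at h0 h1 h2
  simp at h0 h1 h2
  fin_cases l <;> fin_cases k <;> first | rfl | (simp; linarith)

/-! ### Scaling of first-order operators -/

lemma sphereD_const_mul (a : ℝ) (f : E3 → ℝ) (x v : E3) :
    sphereD (fun y => a * f y) x v = a * sphereD f x v := by
  have : radialExt (fun y => a * f y) = a • radialExt f := rfl
  simp only [sphereD, this]
  rw [fderiv_const_smul_field]; rfl

lemma laplacian_const_mul (σ : E3 → E3 → E3 → ℝ) (a : ℝ) (f : E3 → ℝ) (x : E3) :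
    laplacian σ (fun y => a * f y) x = a * laplacian σ f x := by
  unfold laplacian divOneForm
  have e : ∀ i, (fun y => areaDensity σ y *
      ∑ j, (gram σ y)⁻¹ i j * sphereD (fun z => a * f z) y (tang y j)) =
      fun y => a * (areaDensity σ y * ∑ j, (gram σ y)⁻¹ i j * sphereD f y (tang y j)) := by
    intro i
    ext y
    simp only [sphereD_const_mul, Finset.mul_sum]
    exact Finset.sum_congr rfl fun j _ => by ring
  simp only [e]
  simp only [sphereD_const_mul, ← Finset.mul_sum]
  ring

lemma contract_mul_mul (σ : E3 → E3 → E3 → ℝ) (x : E3) (a b : ℝ) (β γ : E3 → ℝ) :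
    contract σ x (fun v => a * β v) (fun v => b * γ v) = a * b * contract σ x β γ := by
  simp only [contract, Finset.mul_sum]
  exact Finset.sum_congr rfl fun i _ => Finset.sum_congr rfl fun j _ => by ring

/-- Rationalizing the difference of roots exposes the factor `p² - q²`. For `p = |H₀|` and `q = |H|`
in rescaled variables it vanishes to leading order, so that `r(p² - q²)` has an expansion while the
other factor is regular. -/
lemma sqrt_sub_sqrt_div {r p q l w : ℝ} (hr : 0 < r) (hl : 0 ≤ l) (hq : 0 < q) (hw : 0 < w) :
    (r⁻¹ * √(p * p + l) - r⁻¹ * √(q * q + l)) / √w =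
      (r ^ 2)⁻¹ * (r * (p * p - q * q) * ((√(p * p + l) + √(q * q + l)) * √w)⁻¹) := by
  have hA : 0 ≤ p * p + l := add_nonneg (mul_self_nonneg _) hl
  have hB : 0 < q * q + l := by positivity
  have sA := Real.mul_self_sqrt hA
  have sB := Real.mul_self_sqrt hB.le
  have hBp := Real.sqrt_pos.mpr hB
  have hwp := Real.sqrt_pos.mpr hw
  have hAn := Real.sqrt_nonneg (p * p + l)
  have key : p * p - q * q =
      (√(p * p + l) - √(q * q + l)) * (√(p * p + l) + √(q * q + l)) := by
    linear_combination sB - sA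
  rw [key]
  generalize √(p * p + l) = A at *
  generalize √(q * q + l) = B at *
  generalize √w = C at *
  have hAB : A + B ≠ 0 := by positivity
  field_simp

namespace NormalizedFamily

variable {S : ℝ → SurfaceInSpacetime} (h : NormalizedFamily S)
include h

lemma contract {N n : ℕ} (hN : N ≤ 2) (hn : n ≤ 2) {β γ : ℝ → E3 → E3 → ℝ} {b c : Fin 3 → E3 → ℝ}
    (hβ : ∀ i, Ex N n (fun r x => β r x (tang x i)) (b i))
    (hγ : ∀ i, Ex N n (fun r x => γ r x (tang x i)) (c i)) :
    Ex N n (fun r x => CWY.contract (S r).induced x (β r x) (γ r x))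
      (fun x => ∑ i, b i x * c i x) := by
  unfold CWY.contract
  refine (Ex.sum Finset.univ fun i _ => Ex.sum Finset.univ fun j _ =>
    ((((h.inv_gram i j).mono hN).mono_right' hn).mul (hβ i)).mul (hγ j)).congr_lim fun x _ => ?_
  simp [Matrix.one_apply]

/-- Two derivatives of `f` and one of the metric are used. One derivative remains, which is later
needed for the gradient of the `sinh⁻¹` term. -/
lemma laplacian {f : ℝ → E3 → ℝ} {c : E3 → ℝ} (hf : Ex 1 3 f c) :
    ∃ d, Ex 1 1 (fun r x => CWY.laplacian (S r).induced (f r) x) d := by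
  have ha := h.areaDensity.mono (N' := 1) (by norm_num)
  have h1 := fun i => (ha.mul (Ex.sum Finset.univ fun j _ =>
    ((h.inv_gram i j).mono (N' := 1) (by norm_num)).mul (hf.sd j))).sd i
  exact ⟨_, ((ha.inv fun x _ => by norm_num).mono_right).mul (Ex.sum Finset.univ fun i _ => h1 i)⟩

end NormalizedFamily

lemma HasObserverExpansion.ex {T₀ : ℝ → Vec4} (h : HasObserverExpansion T₀) :
    ∃ a : Vec4, ∀ n μ, Ex 1 n (fun r _ => T₀ r μ) (fun _ => a μ) := by
  obtain ⟨a, b, ho⟩ := h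
  refine ⟨a, fun n μ => ⟨sphereSmooth_const _, fun _ => b μ, SLim.scalar ?_⟩⟩
  have h1 : (fun r => (T₀ r - a - r⁻¹ • b) μ) =o[atTop] fun r : ℝ => r⁻¹ :=
    (IsBigO.of_bound 1 (Eventually.of_forall fun r => by
      simpa using norm_le_pi_norm (T₀ r - a - r⁻¹ • b) μ)).trans_isLittleO ho
  have h2 := (h1.tendsto_div_nhds_zero).add_const (b μ)
  rw [zero_add] at h2
  refine h2.congr' ?_
  filter_upwards [eventually_ne_atTop 0] with r hr
  simp only [Pi.sub_apply, Pi.smul_apply, smul_eq_mul]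
  field_simp; ring

/-! ### The quasi-local quantities in rescaled variables -/

section Scaled

/-- The time function divided by `r`. -/
noncomputable def scaledTime (X : ℝ → E3 → Vec4) (T₀ : ℝ → Vec4) (r : ℝ) (x : E3) : ℝ :=
  -mink (r⁻¹ • X r x) (T₀ r)

/-- The Laplacian of the rescaled time function for the rescaled metric. -/
noncomputable def scaledLap (S : ℝ → SurfaceInSpacetime) (X : ℝ → E3 → Vec4) (T₀ : ℝ → Vec4)
    (r : ℝ) (x : E3) : ℝ :=
  laplacian ((S r).rescale r).induced (scaledTime X T₀ r) x

/-- The function `1 + |∇τ|²`. -/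
noncomputable def timeSlope (S : ℝ → SurfaceInSpacetime) (X : ℝ → E3 → Vec4) (T₀ : ℝ → Vec4)
    (r : ℝ) (x : E3) : ℝ :=
  1 + contract ((S r).rescale r).induced x (sphereD (scaledTime X T₀ r) x)
    (sphereD (scaledTime X T₀ r) x)

/-- The norm of the mean curvature vector of the rescaled image in Minkowski space. -/
noncomputable def scaledH₀ (X : ℝ → E3 → Vec4) (r : ℝ) (x : E3) : ℝ :=
  ((minkowskiSurface (X r)).rescale r).normH x

/-- The norm of the mean curvature vector of the rescaled surface. -/
noncomputable def scaledH (S : ℝ → SurfaceInSpacetime) (r : ℝ) (x : E3) : ℝ :=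
  ((S r).rescale r).normH x

/-- The mass density multiplied by `r ^ 2`. -/
noncomputable def scaledDensity (S : ℝ → SurfaceInSpacetime) (X : ℝ → E3 → Vec4) (T₀ : ℝ → Vec4)
    (r : ℝ) (x : E3) : ℝ :=
  r * (scaledH₀ X r x * scaledH₀ X r x - scaledH S r x * scaledH S r x) *
    ((√(scaledH₀ X r x * scaledH₀ X r x +
          scaledLap S X T₀ r x * scaledLap S X T₀ r x * (timeSlope S X T₀ r x)⁻¹) +
        √(scaledH S r x * scaledH S r x +
          scaledLap S X T₀ r x * scaledLap S X T₀ r x * (timeSlope S X T₀ r x)⁻¹)) *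
      √(timeSlope S X T₀ r x))⁻¹

/-- The argument of `sinh⁻¹` in the current form, multiplied by `r`. -/
noncomputable def scaledAngle (S : ℝ → SurfaceInSpacetime) (X : ℝ → E3 → Vec4) (T₀ : ℝ → Vec4)
    (r : ℝ) (x : E3) : ℝ :=
  scaledDensity S X T₀ r x * scaledLap S X T₀ r x * (scaledH₀ X r x * scaledH S r x)⁻¹

variable {S : ℝ → SurfaceInSpacetime} {X : ℝ → E3 → Vec4} {T₀ : ℝ → Vec4} {a : Vec4}

lemma timeFun_eq {r : ℝ} (hr : r ≠ 0) :
    timeFun (X r) (T₀ r) = fun x => r * scaledTime X T₀ r x := by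
  ext x
  rw [timeFun, scaledTime, mink_smul_left]
  field_simp

lemma ex_scaledTime (hU : VEx 2 3 (fun r x => r⁻¹ • X r x) spatial)
    (hT : ∀ n μ, Ex 1 n (fun r _ => T₀ r μ) (fun _ => a μ)) :
    Ex 1 3 (scaledTime X T₀) (fun x => -mink (spatial x) a) := by
  have e : ∀ u w : Vec4, -mink u w = u 0 * w 0 - ∑ k : Fin 3, u k.succ * w k.succ := fun u w => by
    rw [mink_eq]; ring
  unfold scaledTime
  simp only [e]
  have hU' := hU.mono (N' := 1) (by norm_num) le_rfl
  exact ((hU' 0).mul (hT 3 0)).sub (Ex.sum Finset.univ fun k _ => (hU' k.succ).mul (hT 3 k.succ))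

lemma ex_timeSlope (hP : NormalizedFamily fun r => (S r).rescale r)
    {c : E3 → ℝ} (hτ : Ex 1 3 (scaledTime X T₀) c) :
    Ex 1 2 (timeSlope S X T₀) (fun x => 1 + ∑ i, sd i c x * sd i c x) :=
  (Ex.const (sphereSmooth_const 1)).add
    (hP.contract (by norm_num) le_rfl (fun i => hτ.sd i) (fun i => hτ.sd i))

lemma timeSlope_limit_pos (c : E3 → ℝ) (x : E3) : 0 < 1 + ∑ i, sd i c x * sd i c x :=
  add_pos_of_pos_of_nonneg one_pos (Finset.sum_nonneg fun _ _ => mul_self_nonneg _)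

variable (hP : NormalizedFamily fun r => (S r).rescale r)
  (hU : VEx 2 3 (fun r x => r⁻¹ • X r x) spatial)
  (hT : ∀ n μ, Ex 1 n (fun r _ => T₀ r μ) (fun _ => a μ))
include hP hU

/-- Both rescaled norms tend to `2`, the mean curvature of the unit sphere, so the squares agree to
leading order. This is where the second order of the expansions is used up. -/
lemma exists_ex_sub_sq : ∃ d, Ex 1 1 (fun r x =>
    r * (scaledH₀ X r x * scaledH₀ X r x - scaledH S r x * scaledH S r x)) d := by
  have h0 : Ex 2 1 (scaledH₀ X) _ := (normalizedFamily_minkowskiSurface hU).normH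
  have h1 : Ex 2 1 (scaledH S) _ := hP.normH
  exact (((h0.mul h0).sub (h1.mul h1)).congr_lim fun x _ => by norm_num).scaled

include hT

lemma exists_ex_scaledLap : ∃ d, Ex 1 1 (scaledLap S X T₀) d :=
  hP.laplacian (ex_scaledTime hU hT)

lemma exists_ex_scaledDensity : ∃ d, Ex 1 1 (scaledDensity S X T₀) d := by
  obtain ⟨δ, hδ⟩ := exists_ex_sub_sq hP hU
  obtain ⟨l, hl⟩ := exists_ex_scaledLap hP hU hT
  have hW := (ex_timeSlope hP (ex_scaledTime hU hT)).mono_right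
  have hWpos := timeSlope_limit_pos fun x => -mink (spatial x) a
  have h0 : Ex 1 1 (scaledH₀ X) (fun _ => 2) :=
    (normalizedFamily_minkowskiSurface hU).normH.mono_succ
  have h1 : Ex 1 1 (scaledH S) (fun _ => 2) := hP.normH.mono_succ
  have hq := (hl.mul hl).mul (hW.inv fun x _ => (hWpos x).ne')
  have hnn : ∀ x : E3, 0 ≤ l x * l x *
      (1 + ∑ i, sd i (fun y => -mink (spatial y) a) x * sd i (fun y => -mink (spatial y) a) x)⁻¹ :=
    fun x => mul_nonneg (mul_self_nonneg _) (inv_nonneg.mpr (hWpos x).le)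
  have s0 := ((h0.mul h0).add hq).sqrt fun x _ => by have := hnn x; linarith
  have s1 := ((h1.mul h1).add hq).sqrt fun x _ => by have := hnn x; linarith
  have sW := hW.sqrt fun x _ => hWpos x
  refine ⟨_, hδ.mul (((s0.add s1).mul sW).inv fun x _ => ?_)⟩
  have p0 : 0 < √(2 * 2 + l x * l x * (1 + ∑ i, sd i (fun y => -mink (spatial y) a) x *
      sd i (fun y => -mink (spatial y) a) x)⁻¹) :=
    Real.sqrt_pos.mpr (by have := hnn x; linarith)
  have pW := Real.sqrt_pos.mpr (hWpos x)
  positivity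

lemma exists_ex_scaledAngle : ∃ d, Ex 1 1 (scaledAngle S X T₀) d := by
  obtain ⟨d, hd⟩ := exists_ex_scaledDensity hP hU hT
  obtain ⟨l, hl⟩ := exists_ex_scaledLap hP hU hT
  have h0 : Ex 1 1 (scaledH₀ X) (fun _ => 2) :=
    (normalizedFamily_minkowskiSurface hU).normH.mono_succ
  have h1 : Ex 1 1 (scaledH S) (fun _ => 2) := hP.normH.mono_succ
  exact ⟨_, (hd.mul hl).mul ((h0.mul h1).inv fun x _ => by norm_num)⟩

omit hT hU in
lemma laplacian_timeFun (hrad : ∀ r, (S r).Radial) : ∀ᶠ r in atTop, ∀ x ∈ S2,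
    laplacian (S r).induced (timeFun (X r) (T₀ r)) x = r⁻¹ * scaledLap S X T₀ r x := by
  filter_upwards [hP.det_ne_zero, eventually_ne_atTop 0] with r hdet hr x hx
  rw [SurfaceInSpacetime.laplacian_rescale (hrad r) hr hdet _ hx, timeFun_eq hr,
    laplacian_const_mul, scaledLap]
  field_simp

omit hT in
lemma normH_eq (hrad : ∀ r, (S r).Radial) : ∀ᶠ r in atTop, ∀ x ∈ S2,
    (S r).normH x = r⁻¹ * scaledH S r x ∧
    (minkowskiSurface (X r)).normH x = r⁻¹ * scaledH₀ X r x := by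
  filter_upwards [hP.det_ne_zero, (normalizedFamily_minkowskiSurface hU).det_ne_zero,
    eventually_gt_atTop 0] with r hdet hdet' hr x hx
  exact ⟨SurfaceInSpacetime.normH_rescale (hrad r) hr hx (hdet x hx),
    SurfaceInSpacetime.normH_rescale (minkowskiSurface_radial _) hr hx (hdet' x hx)⟩

lemma massDensity_eq (hrad : ∀ r, (S r).Radial) : ∀ᶠ r in atTop, ∀ x ∈ S2,
    massDensity (S r) (X r) (T₀ r) x = (r ^ 2)⁻¹ * scaledDensity S X T₀ r x := by
  have hW := (ex_timeSlope hP (ex_scaledTime hU hT)).sLim.eventually_pos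
    fun x _ => timeSlope_limit_pos _ x
  filter_upwards [hP.det_ne_zero, eventually_gt_atTop 0, laplacian_timeFun hP hrad,
    normH_eq hP hU hrad, hW, hP.normH_pos] with r hdet hr hl hH hW hpos x hx
  have hWx := hW x hx
  have e1 : 1 + contract (S r).induced x (sphereD (timeFun (X r) (T₀ r)) x)
      (sphereD (timeFun (X r) (T₀ r)) x) = timeSlope S X T₀ r x := by
    rw [SurfaceInSpacetime.contract_rescale (hrad r) hr.ne' hx (hdet x hx) (sum_mul_sd hx _),
      timeFun_eq hr.ne',
      show sphereD (fun y => r * scaledTime X T₀ r y) x =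
        fun v => r * sphereD (scaledTime X T₀ r) x v from
        funext fun v => sphereD_const_mul r _ x v, contract_mul_mul, timeSlope]
    field_simp
  have e2 : ∀ h l : ℝ, √((r⁻¹ * h) ^ 2 + (r⁻¹ * l) ^ 2 / timeSlope S X T₀ r x) =
      r⁻¹ * √(h * h + l * l * (timeSlope S X T₀ r x)⁻¹) := by
    intro h l
    have : (r⁻¹ * h) ^ 2 + (r⁻¹ * l) ^ 2 / timeSlope S X T₀ r x =
        (r⁻¹) ^ 2 * (h * h + l * l * (timeSlope S X T₀ r x)⁻¹) := by
      field_simp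
    rw [this, Real.sqrt_mul (by positivity), Real.sqrt_sq (by positivity)]
  have e3 : massDensity (S r) (X r) (T₀ r) x = (√((minkowskiSurface (X r)).normH x ^ 2 +
        laplacian (S r).induced (timeFun (X r) (T₀ r)) x ^ 2 / timeSlope S X T₀ r x) -
      √((S r).normH x ^ 2 +
        laplacian (S r).induced (timeFun (X r) (T₀ r)) x ^ 2 / timeSlope S X T₀ r x)) /
      √(timeSlope S X T₀ r x) := by
    rw [← e1]; rfl
  rw [e3, hl x hx, (hH x hx).1, (hH x hx).2, e2, e2]
  exact sqrt_sub_sqrt_div hr (mul_nonneg (mul_self_nonneg _) (inv_nonneg.mpr hWx.le))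
    (hpos x hx) hWx

/-- The current form multiplied by `r`, to leading order. -/
lemma ex_currentForm (hrad : ∀ r, (S r).Radial) {ρ u φ : E3 → ℝ} {α : Fin 3 → E3 → ℝ}
    (hρ : Ex 1 1 (scaledDensity S X T₀) ρ) (hu : Ex 1 1 (scaledAngle S X T₀) u)
    (hφ : ∀ i, Ex 1 0
      (fun r x => r * ((minkowskiSurface (X r)).rescale r).alphaH x (tang x i)) (sd i φ))
    (hα : ∀ i, Ex 1 0 (fun r x => r * ((S r).rescale r).alphaH x (tang x i)) (α i)) (i : Fin 3) :
    Ex 1 0 (fun r x => r * currentForm (S r) (X r) (T₀ r) x (tang x i))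
      (fun x => ρ x * sd i (fun y => -mink (spatial y) a) x - sd i u x - sd i φ x + α i x) := by
  have hτ := ex_scaledTime hU hT
  -- The argument of `sinh⁻¹` is `O(1/r)`, so the factor `(1 + z²)^{-1/2}` from its derivative tends
  -- to `1`, and the leading term is the exact form `du`.
  have hq : Ex 1 0 (fun r x => (√(1 + r⁻¹ * scaledAngle S X T₀ r x * (r⁻¹ * scaledAngle S X T₀ r x)))⁻¹ *
      sd i (scaledAngle S X T₀ r) x) (sd i u) := by
    have h1 : Ex 1 0 (fun r x => r⁻¹ * scaledAngle S X T₀ r x) (fun _ => 0) :=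
      (hu.mono_right.mono (N' := 0) (by norm_num)).of_scaled
    have h2 : Ex 1 0 (fun r x =>
        1 + r⁻¹ * scaledAngle S X T₀ r x * (r⁻¹ * scaledAngle S X T₀ r x)) (fun _ => 1) :=
      ((Ex.const (sphereSmooth_const 1)).add (h1.mul h1)).congr_lim fun x _ => by simp
    exact (((h2.sqrt fun x _ => by norm_num).inv fun x _ => by norm_num).mul (hu.sd i)).congr_lim
      fun x _ => by simp
  have hmain := (((hρ.mono_right.mul ((hτ.sd i).mono_right' (n' := 0) (by norm_num))).sub hq).sub
    (hφ i)).add (hα i)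
  refine hmain.congr ?_
  filter_upwards [massDensity_eq hP hU hT hrad, laplacian_timeFun hP hrad (X := X) (T₀ := T₀),
    normH_eq hP hU hrad, hP.det_ne_zero, (normalizedFamily_minkowskiSurface hU).det_ne_zero,
    hu.sDiff, hP.normH_pos, (normalizedFamily_minkowskiSurface hU).normH_pos,
    eventually_gt_atTop 0] with r hm hl hH hd hd' hus hp hp0 hr x hx
  have e1 : ∀ y ∈ S2, Real.arsinh (massDensity (S r) (X r) (T₀ r) y *
      laplacian (S r).induced (timeFun (X r) (T₀ r)) y /
        ((minkowskiSurface (X r)).normH y * (S r).normH y)) =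
      Real.arsinh (r⁻¹ * scaledAngle S X T₀ r y) := by
    intro y hy
    have q1 : scaledH S r y ≠ 0 := (hp y hy).ne'
    have q2 : scaledH₀ X r y ≠ 0 := (hp0 y hy).ne'
    rw [hm y hy, hl y hy, (hH y hy).1, (hH y hy).2, scaledAngle]
    congr 1
    field_simp
  have e2 : sphereD (timeFun (X r) (T₀ r)) x (tang x i) = r * sd i (scaledTime X T₀ r) x := by
    rw [timeFun_eq hr.ne', sphereD_const_mul]
    rfl
  unfold currentForm
  rw [sphereD_congr e1 hx, hm x hx, e2, SurfaceInSpacetime.alphaH_rescale (hrad r) hr hd hx,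
    SurfaceInSpacetime.alphaH_rescale (minkowskiSurface_radial (X r)) hr hd' hx]
  have e3 : sphereD (fun y => Real.arsinh (r⁻¹ * scaledAngle S X T₀ r y)) x (tang x i) =
      (√(1 + (r⁻¹ * scaledAngle S X T₀ r x) ^ 2))⁻¹ * (r⁻¹ * sd i (scaledAngle S X T₀ r) x) := by
    change sd i _ x = _
    rw [sd_arsinh ((sDiff_const _).mul (hus x hx)) hx, sd_const_mul]
  rw [e3, sq (r⁻¹ * scaledAngle S X T₀ r x)]
  field_simp

end Scaled

/-! ### Linear Killing fields -/

/-- `K` is the linear vector field of an element `M` of the Lorentz Lie algebra. -/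
def IsLinearKilling (K : Vec4 → Vec4) (M : Matrix (Fin 4) (Fin 4) ℝ) : Prop :=
  (∀ X, K X = M *ᵥ X) ∧ (minkowski * M)ᵀ = -(minkowski * M)

lemma minkowski_transpose : minkowskiᵀ = minkowski := Matrix.diagonal_transpose _

lemma minkowski_mul_self : minkowski * minkowski = 1 := by
  unfold minkowski
  rw [Matrix.diagonal_mul_diagonal, ← Matrix.diagonal_one]
  congr 1
  ext μ
  refine Fin.cases ?_ (fun k => ?_) μ <;> simp

lemma exists_boostField (i : Fin 3) : ∃ M, IsLinearKilling (boostField i) M := by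
  refine ⟨Matrix.single 0 i.succ 1 + Matrix.single i.succ 0 1, fun X => ?_, ?_⟩
  · ext μ
    simp only [boostField, Matrix.add_mulVec, Pi.add_apply, Matrix.single_mulVec]
    simp
    simp [Pi.single_apply, Function.update_apply]
  · ext μ ν
    simp only [minkowski, Matrix.transpose_apply, Matrix.diagonal_mul, Matrix.neg_apply,
      Matrix.add_apply, Matrix.single_apply]
    refine Fin.cases (Fin.cases ?_ (fun k => ?_) ν) (fun j => Fin.cases ?_ (fun k => ?_) ν) μ <;>
    simp [(Fin.succ_ne_zero _).symm] <;> split_ifs <;> simp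

lemma exists_rotationField (i j : Fin 3) : ∃ M, IsLinearKilling (rotationField i j) M := by
  refine ⟨Matrix.single j.succ i.succ 1 - Matrix.single i.succ j.succ 1, fun X => ?_, ?_⟩
  · ext μ
    simp only [rotationField, Matrix.sub_mulVec, Pi.sub_apply, Matrix.single_mulVec]
    simp [Pi.single_apply, Function.update_apply]
  · ext μ ν
    simp only [minkowski, Matrix.transpose_apply, Matrix.diagonal_mul, Matrix.neg_apply,
      Matrix.sub_apply, Matrix.single_apply]
    refine Fin.cases (Fin.cases ?_ (fun k => ?_) ν) (fun l => Fin.cases ?_ (fun k => ?_) ν) μ <;>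
    simp [and_comm]

lemma IsLorentz.inv_eq {A : Matrix (Fin 4) (Fin 4) ℝ} (h : IsLorentz A) :
    A⁻¹ = minkowski * Aᵀ * minkowski := by
  apply Matrix.inv_eq_left_inv
  have h' : Aᵀ * minkowski * A = minkowski := h
  rw [Matrix.mul_assoc, Matrix.mul_assoc, ← Matrix.mul_assoc Aᵀ, h', minkowski_mul_self]

/-- The covariant matrix of the push-forward of a linear Killing field. -/
def pushMatrix (A M : Matrix (Fin 4) (Fin 4) ℝ) : Matrix (Fin 4) (Fin 4) ℝ :=
  minkowski * (A * (M * minkowski) * Aᵀ) * minkowski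

lemma pushMatrix_antisymm {A M : Matrix (Fin 4) (Fin 4) ℝ}
    (hM : (minkowski * M)ᵀ = -(minkowski * M)) (μ ν : Fin 4) :
    pushMatrix A M μ ν = -pushMatrix A M ν μ := by
  have h1 : (M * minkowski)ᵀ = -(M * minkowski) := by
    have e : M * minkowski = minkowski * (minkowski * M) * minkowski := by
      rw [← Matrix.mul_assoc, minkowski_mul_self, Matrix.one_mul]
    rw [e, Matrix.transpose_mul, Matrix.transpose_mul, hM, minkowski_transpose]
    simp [Matrix.mul_assoc]
  have h2 : (pushMatrix A M)ᵀ = -pushMatrix A M := by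
    unfold pushMatrix
    rw [Matrix.transpose_mul, Matrix.transpose_mul, Matrix.transpose_mul, Matrix.transpose_mul,
      Matrix.transpose_transpose, h1, minkowski_transpose]
    simp only [Matrix.neg_mul, Matrix.mul_neg, Matrix.mul_assoc]
  have := congrFun (congrFun h2 ν) μ
  simpa using this

/-- For Lorentz `A` the inverse is `η Aᵀ η`. The push-forward is thereby polynomial in `A`, which
makes its convergence as `r → ∞` immediate, and its covariant matrix is antisymmetric. -/
lemma mink_pushField {K : Vec4 → Vec4} {A M : Matrix (Fin 4) (Fin 4) ℝ} (hK : IsLinearKilling K M)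
    (hA : IsLorentz A) (X w : Vec4) :
    mink (pushField A K X) w = ∑ μ, ∑ ν, pushMatrix A M μ ν * (X ν * w μ) := by
  have e1 : pushField A K X = (A * M * A⁻¹) *ᵥ X := by
    simp [pushField, hK.1, Matrix.mulVec_mulVec, Matrix.mul_assoc]
  have e2 : A * M * A⁻¹ = minkowski * pushMatrix A M := by
    rw [hA.inv_eq, pushMatrix]
    simp only [← Matrix.mul_assoc, minkowski_mul_self, Matrix.one_mul]
  have e3 : ∀ u v : Vec4, mink (minkowski *ᵥ u) v = u ⬝ᵥ v := by
    intro u v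
    unfold mink
    rw [Matrix.dotProduct_mulVec, ← Matrix.mulVec_transpose, minkowski_transpose,
      Matrix.mulVec_mulVec, minkowski_mul_self, Matrix.one_mulVec]
  rw [e1, e2, ← Matrix.mulVec_mulVec, e3]
  simp only [dotProduct, Matrix.mulVec, Finset.sum_mul]
  exact Finset.sum_congr rfl fun μ _ => Finset.sum_congr rfl fun ν _ => by ring

/-! ### Convergence of the conserved quantities -/

section Conserved

variable {S : ℝ → SurfaceInSpacetime} {X : ℝ → E3 → Vec4} {T₀ : ℝ → Vec4}

/-- The rescaled density of the translational part of a conserved quantity. -/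
noncomputable def energyDensity (S : ℝ → SurfaceInSpacetime) (X : ℝ → E3 → Vec4) (T₀ : ℝ → Vec4)
    (ν : Fin 4) (r : ℝ) (x : E3) : ℝ :=
  (r⁻¹ * X r x ν) * scaledDensity S X T₀ r x * areaDensity ((S r).rescale r).induced x

/-- The rescaled density of the pairing of a rotation field with the current. -/
noncomputable def rotationDensity (S : ℝ → SurfaceInSpacetime) (X : ℝ → E3 → Vec4) (T₀ : ℝ → Vec4)
    (μ ν : Fin 4) (r : ℝ) (x : E3) : ℝ :=
  contract ((S r).rescale r).induced x
    (fun v => (r⁻¹ * X r x ν) * sphereD (fun y => r⁻¹ * X r y μ) x v -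
      (r⁻¹ * X r x μ) * sphereD (fun y => r⁻¹ * X r y ν) x v)
    (fun v => r * currentForm (S r) (X r) (T₀ r) x v) *
      areaDensity ((S r).rescale r).induced x

lemma contract_sum_left (σ : E3 → E3 → E3 → ℝ) (x : E3) {ι : Type*} (s : Finset ι)
    (c : ι → ℝ) (β : ι → E3 → ℝ) (γ : E3 → ℝ) :
    contract σ x (fun v => ∑ i ∈ s, c i * β i v) γ = ∑ i ∈ s, c i * contract σ x (β i) γ := by
  simp only [contract, Finset.mul_sum, Finset.sum_mul]
  rw [Finset.sum_comm]
  conv_rhs => rw [Finset.sum_comm]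
  rw [Finset.sum_comm]
  refine Finset.sum_congr rfl fun i _ => ?_
  rw [Finset.sum_comm]
  exact Finset.sum_congr rfl fun p _ => Finset.sum_congr rfl fun j _ => by ring

lemma contract_congr_left (σ : E3 → E3 → E3 → ℝ) (x : E3) {β β' : E3 → ℝ} (γ : E3 → ℝ)
    (h : ∀ i, β (tang x i) = β' (tang x i)) : contract σ x β γ = contract σ x β' γ := by
  simp only [contract, h]

/-- Counting powers of `r`: in the energy term `X ~ r`, `ρ ~ r⁻²` and the area `~ r²`; in the
current term `X dX ~ r²`, `β ~ r⁻¹`, and the inverse metric cancels the area. One factor `r` is left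
in both cases. -/
lemma integrand_eq {r : ℝ} (hr : 0 < r) {A M : Matrix (Fin 4) (Fin 4) ℝ} {K : Vec4 → Vec4}
    (hK : IsLinearKilling K M) (hA : IsLorentz A) (hrad : (S r).Radial) {x : E3} (hx : x ∈ S2)
    (hdet : (gram ((S r).rescale r).induced x).det ≠ 0)
    (hρ : massDensity (S r) (X r) (T₀ r) x = (r ^ 2)⁻¹ * scaledDensity S X T₀ r x)
    (hX : ∀ μ, SDiff (fun y => X r y μ) x) :
    (mink (pushField A K (X r x)) (T₀ r) * massDensity (S r) (X r) (T₀ r) x +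
      contract (S r).induced x (fun v => mink (pushField A K (X r x)) (sphereD (X r) x v))
        (currentForm (S r) (X r) (T₀ r) x)) * areaDensity (S r).induced x =
    r * (∑ μ, ∑ ν, pushMatrix A M μ ν * T₀ r μ * energyDensity S X T₀ ν r x +
      ∑ μ, ∑ ν, pushMatrix A M μ ν / 2 * rotationDensity S X T₀ μ ν r x) := by
  have hk : ∀ i, mink (pushField A K (X r x)) (sphereD (X r) x (tang x i)) =
      ∑ μ, ∑ ν, pushMatrix A M μ ν * (X r x ν * sd i (fun y => X r y μ) x) := fun i => by
    rw [mink_pushField hK hA]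
    simp only [sphereD_apply hX]
  have hβ : ∑ i, x i * mink (pushField A K (X r x)) (sphereD (X r) x (tang x i)) = 0 := by
    have h1 : ∑ i, x i • sphereD (X r) x (tang x i) = 0 := by
      simp only [sphereD, ← map_smul, ← map_sum, sum_smul_tang hx, map_zero]
    have h2 := congrArg (fun w => mink (pushField A K (X r x)) w) h1
    simp only [mink, Matrix.mulVec_sum, dotProduct_sum, Matrix.mulVec_smul, dotProduct_smul,
      smul_eq_mul, Matrix.mulVec_zero, dotProduct_zero] at h2
    exact h2
  rw [SurfaceInSpacetime.contract_rescale hrad hr.ne' hx hdet hβ,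
    SurfaceInSpacetime.areaDensity_rescale hrad hr.ne' hx, hρ, mink_pushField hK hA]
  set a := areaDensity ((S r).rescale r).induced x with ha
  set σ := ((S r).rescale r).induced with hσ
  set J := currentForm (S r) (X r) (T₀ r) x with hJ
  have hanti := pushMatrix_antisymm (A := A) hK.2
  set C := pushMatrix A M with hC
  have hc : contract σ x (fun v => mink (pushField A K (X r x)) (sphereD (X r) x v)) J * a =
      r * ∑ μ, ∑ ν, C μ ν / 2 * rotationDensity S X T₀ μ ν r x := by
    have e1 : contract σ x (fun v => mink (pushField A K (X r x)) (sphereD (X r) x v)) J =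
        contract σ x (fun v => ∑ p : Fin 4 × Fin 4, C p.1 p.2 / 2 *
          (X r x p.2 * sphereD (fun y => X r y p.1) x v -
            X r x p.1 * sphereD (fun y => X r y p.2) x v)) J := by
      refine contract_congr_left σ x J fun i => ?_
      rw [hk, Fintype.sum_prod_type]
      -- Antisymmetry of the coefficients allows `X^ν dX^μ` to be replaced by half of `X^ν dX^μ -
      -- X^μ dX^ν`. This exhibits the tangential part of the field as a combination of rotation
      -- fields, to which the integral identities apply.
      have e2 : ∑ μ, ∑ ν, C μ ν * (X r x ν * sd i (fun y => X r y μ) x) =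
          -∑ μ, ∑ ν, C μ ν * (X r x μ * sd i (fun y => X r y ν) x) := by
        rw [Finset.sum_comm, ← Finset.sum_neg_distrib]
        refine Finset.sum_congr rfl fun μ _ => ?_
        rw [← Finset.sum_neg_distrib]
        refine Finset.sum_congr rfl fun ν _ => ?_
        rw [hanti ν μ]; ring
      have e3 : ∑ μ, ∑ ν, C μ ν / 2 * (X r x ν * sphereD (fun y => X r y μ) x (tang x i) -
            X r x μ * sphereD (fun y => X r y ν) x (tang x i)) =
          1 / 2 * ∑ μ, ∑ ν, C μ ν * (X r x ν * sd i (fun y => X r y μ) x) -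
          1 / 2 * ∑ μ, ∑ ν, C μ ν * (X r x μ * sd i (fun y => X r y ν) x) := by
        simp only [Finset.mul_sum, ← Finset.sum_sub_distrib]
        exact Finset.sum_congr rfl fun μ _ => Finset.sum_congr rfl fun ν _ => by
          unfold sd; ring
      rw [e3]
      linarith
    rw [e1, contract_sum_left, Fintype.sum_prod_type, Finset.sum_mul, Finset.mul_sum]
    refine Finset.sum_congr rfl fun μ _ => ?_
    rw [Finset.sum_mul, Finset.mul_sum]
    refine Finset.sum_congr rfl fun ν _ => ?_
    have e4 : rotationDensity S X T₀ μ ν r x =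
        (r⁻¹ * r⁻¹) * r * contract σ x (fun v => X r x ν * sphereD (fun y => X r y μ) x v -
            X r x μ * sphereD (fun y => X r y ν) x v) J * a := by
      rw [rotationDensity, ← contract_mul_mul]
      congr 2
      ext v
      rw [sphereD_const_mul, sphereD_const_mul]
      ring
    rw [e4]
    field_simp
  have he : ∑ μ, ∑ ν, C μ ν * T₀ r μ * energyDensity S X T₀ ν r x =
      r⁻¹ * (∑ μ, ∑ ν, C μ ν * (X r x ν * T₀ r μ)) * scaledDensity S X T₀ r x * a := by
    simp only [Finset.mul_sum, Finset.sum_mul]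
    refine Finset.sum_congr rfl fun μ _ => Finset.sum_congr rfl fun ν _ => ?_
    rw [energyDensity]; ring
  rw [he, mul_add r, ← hc]
  field_simp

lemma conservedQuantity_eq {r : ℝ} (hr : 0 < r) {A M : Matrix (Fin 4) (Fin 4) ℝ}
    {K : Vec4 → Vec4} (hK : IsLinearKilling K M) (hA : IsLorentz A) (hrad : (S r).Radial)
    (hdet : ∀ x ∈ S2, (gram ((S r).rescale r).induced x).det ≠ 0)
    (hρ : ∀ x ∈ S2, massDensity (S r) (X r) (T₀ r) x = (r ^ 2)⁻¹ * scaledDensity S X T₀ r x)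
    (hX : ∀ μ, ∀ x ∈ S2, SDiff (fun y => X r y μ) x)
    (hE : ∀ ν, ContinuousOn (energyDensity S X T₀ ν r) S2)
    (hR : ∀ μ ν, ContinuousOn (rotationDensity S X T₀ μ ν r) S2) :
    conservedQuantity (S r) (X r) (T₀ r) (pushField A K) = -1 / (8 * Real.pi) *
      (∑ μ, ∑ ν, pushMatrix A M μ ν * T₀ r μ * (r * sphereIntegral (energyDensity S X T₀ ν r)) +
        ∑ μ, ∑ ν, pushMatrix A M μ ν / 2 *
          (r * sphereIntegral (rotationDensity S X T₀ μ ν r))) := by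
  unfold conservedQuantity
  congr 1
  rw [sphereIntegral_congr fun x hx => integrand_eq hr hK hA hrad hx (hdet x hx) (hρ x hx)
    fun μ => hX μ x hx]
  have c1 : ∀ μ ν, ContinuousOn
      (fun x => pushMatrix A M μ ν * T₀ r μ * energyDensity S X T₀ ν r x) S2 := fun μ ν =>
    continuousOn_const.mul (hE ν)
  have c2 : ∀ μ ν, ContinuousOn
      (fun x => pushMatrix A M μ ν / 2 * rotationDensity S X T₀ μ ν r x) S2 := fun μ ν =>
    continuousOn_const.mul (hR μ ν)
  have d1 : ∀ μ, ContinuousOn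
      (fun x => ∑ ν, pushMatrix A M μ ν * T₀ r μ * energyDensity S X T₀ ν r x) S2 := fun μ =>
    continuousOn_finsetSum _ fun ν _ => c1 μ ν
  have d2 : ∀ μ, ContinuousOn
      (fun x => ∑ ν, pushMatrix A M μ ν / 2 * rotationDensity S X T₀ μ ν r x) S2 := fun μ =>
    continuousOn_finsetSum _ fun ν _ => c2 μ ν
  rw [sphereIntegral_const_mul, sphereIntegral_add (continuousOn_finsetSum _ fun μ _ => d1 μ)
    (continuousOn_finsetSum _ fun μ _ => d2 μ), sphereIntegral_sum _ fun μ _ => d1 μ,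
    sphereIntegral_sum _ fun μ _ => d2 μ, mul_add, Finset.mul_sum, Finset.mul_sum]
  congr 1
  · refine Finset.sum_congr rfl fun μ _ => ?_
    rw [sphereIntegral_sum _ fun ν _ => c1 μ ν, Finset.mul_sum]
    refine Finset.sum_congr rfl fun ν _ => ?_
    rw [sphereIntegral_const_mul]; ring
  · refine Finset.sum_congr rfl fun μ _ => ?_
    rw [sphereIntegral_sum _ fun ν _ => c2 μ ν, Finset.mul_sum]
    refine Finset.sum_congr rfl fun ν _ => ?_
    rw [sphereIntegral_const_mul]; ring

lemma sphereIntegral_zero : sphereIntegral (fun _ => 0) = 0 := by simp [sphereIntegral]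

lemma sum_rotation_tang {x : E3} (b : Fin 3 → ℝ) (l k : Fin 3) :
    ∑ i, (x l * tang x i k - x k * tang x i l) * b i = x l * b k - x k * b l := by
  simp only [tang_apply, Fin.sum_univ_three]
  fin_cases l <;> fin_cases k <;> simp <;> ring

lemma sd_mink_spatial (a : Vec4) {x : E3} (hx : x ∈ S2) (i : Fin 3) :
    sd i (fun y => -mink (spatial y) a) x = -∑ m, tang x i m * a m.succ := by
  have e : (fun y => -mink (spatial y) a) =
      fun y : E3 => y 0 * -a 1 + y 1 * -a 2 + y 2 * -a 3 := by
    ext y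
    rw [mink_eq]
    simp [spatial, Fin.sum_univ_three]
    ring
  have hd : ∀ (m : Fin 3) (t : ℝ), SDiff (fun y : E3 => y m * t) x := fun m t =>
    ((sphereSmooth_coord m).sDiff hx).mul (sDiff_const t)
  have hs : ∀ (m : Fin 3) (t : ℝ), sd i (fun y : E3 => y m * t) x = tang x i m * t := fun m t => by
    rw [sd_mul ((sphereSmooth_coord m).sDiff hx) (sDiff_const t) hx, sd_coord hx, sd_const]; ring
  rw [e, sd_add ((hd 0 _).add (hd 1 _)) (hd 2 _), sd_add (hd 0 _) (hd 1 _), hs, hs, hs,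
    Fin.sum_univ_three]
  simp
  ring

/-- The leading coefficient of the pairing of a rotation with the current integrates to zero. -/
lemma sphereIntegral_leading_rotation {ρ u φ : E3 → ℝ} {α : Fin 3 → E3 → ℝ} (a : Vec4)
    (hρ : SphereSmooth ρ) (hu : SphereSmooth u) (hφ : SphereSmooth φ)
    (hα : ∀ i, SphereSmooth (α i))
    (hρ0 : ∀ i : Fin 3, sphereIntegral (fun x => x i * ρ x) = 0)
    (hα0 : ∀ l k : Fin 3, sphereIntegral (fun x => x l * α k x) =
      sphereIntegral (fun x => x k * α l x)) (l k : Fin 3) :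
    sphereIntegral (fun x => x l * (ρ x * sd k (fun y => -mink (spatial y) a) x - sd k u x -
        sd k φ x + α k x) - x k * (ρ x * sd l (fun y => -mink (spatial y) a) x - sd l u x -
        sd l φ x + α l x)) = 0 := by
  have hxρ : ∀ i, ContinuousOn (fun x : E3 => x i * ρ x) S2 := fun i =>
    ((sphereSmooth_coord i).mul hρ).continuousOn
  have hxα : ∀ i j, ContinuousOn (fun x : E3 => x i * α j x) S2 := fun i j =>
    ((sphereSmooth_coord i).mul (hα j)).continuousOn
  -- The gradient of the linear function `-⟨x, a⟩` has `i`-th component `-a_i + x_i (x·a)`, whose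
  -- radial part cancels under antisymmetrization. There remain first moments of `ρ`, rotations of
  -- `u` and `φ`, and the antisymmetric pairing of `α`.
  have e : ∀ x ∈ S2, x l * (ρ x * sd k (fun y => -mink (spatial y) a) x - sd k u x -
        sd k φ x + α k x) - x k * (ρ x * sd l (fun y => -mink (spatial y) a) x - sd l u x -
        sd l φ x + α l x) = ((-a k.succ) * (x l * ρ x) + a l.succ * (x k * ρ x)) +
      (((-1) * rotD l k u x + (-1) * rotD l k φ x) +
        (x l * α k x + (-1) * (x k * α l x))) := by
    intro x hx
    rw [sd_mink_spatial a hx, sd_mink_spatial a hx]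
    have h1 : ∀ i, ∑ m, tang x i m * a m.succ = a i.succ - x i * ∑ m, x m * a m.succ := fun i => by
      simp only [tang_apply, sub_mul, Finset.sum_sub_distrib, Finset.mul_sum, ite_mul, one_mul,
        zero_mul, Finset.sum_ite_eq', Finset.mem_univ, if_true, mul_assoc]
    rw [h1, h1, rotD, rotD]
    ring
  have c1 : ContinuousOn (fun x : E3 => (-a k.succ) * (x l * ρ x)) S2 :=
    continuousOn_const.mul (hxρ l)
  have c2 : ContinuousOn (fun x : E3 => a l.succ * (x k * ρ x)) S2 :=
    continuousOn_const.mul (hxρ k)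
  have c3 : ContinuousOn (fun x : E3 => (-1) * rotD l k u x) S2 :=
    continuousOn_const.mul (hu.rotD l k).continuousOn
  have c4 : ContinuousOn (fun x : E3 => (-1) * rotD l k φ x) S2 :=
    continuousOn_const.mul (hφ.rotD l k).continuousOn
  have c5 : ContinuousOn (fun x : E3 => (-1) * (x k * α l x)) S2 :=
    continuousOn_const.mul (hxα k l)
  rw [sphereIntegral_congr e, sphereIntegral_add, sphereIntegral_add, sphereIntegral_add,
    sphereIntegral_add, sphereIntegral_add]
  · simp only [sphereIntegral_const_mul]
    rw [hρ0, hρ0, sphereIntegral_rotD hu, sphereIntegral_rotD hφ, hα0 l k]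
    ring
  all_goals first
    | exact c1 | exact c2 | exact c3 | exact c4 | exact c5 | exact hxα l k | exact c1.add c2
    | exact c3.add c4 | exact (hxα l k).add c5 | exact (c3.add c4).add ((hxα l k).add c5)

/-- The rescaled densities have expansions of first order, and convergent integrals after
multiplication by `r`. -/
lemma exists_tendsto_densities (hP : NormalizedFamily fun r => (S r).rescale r)
    (hU : VEx 2 3 (fun r x => r⁻¹ • X r x) spatial) {a : Vec4} {ρ : E3 → ℝ}
    (hρ : Ex 1 1 (scaledDensity S X T₀) ρ) {u φ : E3 → ℝ} {α : Fin 3 → E3 → ℝ}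
    (hu : SphereSmooth u) (hφ : SphereSmooth φ) (hα : ∀ i, SphereSmooth (α i))
    (hβ : ∀ i, Ex 1 0 (fun r x => r * currentForm (S r) (X r) (T₀ r) x (tang x i))
      (fun x => ρ x * sd i (fun y => -mink (spatial y) a) x - sd i u x - sd i φ x + α i x))
    (hρ0 : ∀ i : Fin 3, sphereIntegral (fun x => x i * ρ x) = 0)
    (hα0 : ∀ l k : Fin 3, sphereIntegral (fun x => x l * α k x) =
      sphereIntegral (fun x => x k * α l x)) :
    (∀ ν, (∀ᶠ r in atTop, ContinuousOn (energyDensity S X T₀ ν r) S2) ∧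
      ∃ L, Tendsto (fun r => r * sphereIntegral (energyDensity S X T₀ ν r)) atTop (𝓝 L)) ∧
    ∀ μ ν, (∀ᶠ r in atTop, ContinuousOn (rotationDensity S X T₀ μ ν r) S2) ∧
      ∃ L, Tendsto (fun r => r * sphereIntegral (rotationDensity S X T₀ μ ν r)) atTop (𝓝 L) := by
  have hU0 : ∀ μ, Ex 1 0 (fun r x => r⁻¹ * X r x μ) (fun x => spatial x μ) := fun μ =>
    ((hU μ).mono (N' := 1) (by norm_num)).mono_right' (Nat.zero_le _)
  have hUd : ∀ i μ, Ex 1 0 (fun r x => sphereD (fun y => r⁻¹ * X r y μ) x (tang x i))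
      (sd i fun x => spatial x μ) := fun i μ =>
    (((hU μ).mono (N' := 1) (by norm_num)).sd i).mono_right' (Nat.zero_le _)
  have ha0 : Ex 1 0 (fun r x => areaDensity ((S r).rescale r).induced x) (fun _ => 1) :=
    (hP.areaDensity.mono (by norm_num)).mono_right' (Nat.zero_le _)
  constructor
  · intro ν
    have h1 : Ex 1 0 (energyDensity S X T₀ ν) (fun x => spatial x ν * ρ x * 1) :=
      ((hU0 ν).mul hρ.mono_right).mul ha0
    refine ⟨h1.sLim.continuousOn, h1.exists_tendsto_mul_integral ?_⟩
    -- The time component of `X/r` tends to zero; the spatial ones give the first moments of `ρ`.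
    refine Fin.cases ?_ (fun k => ?_) ν
    · simpa [spatial] using sphereIntegral_zero
    · simpa [spatial] using hρ0 k
  · intro μ ν
    have h1 := (hP.contract (N := 1) (n := 0)
      (β := fun r x v => (r⁻¹ * X r x ν) * sphereD (fun y => r⁻¹ * X r y μ) x v -
        (r⁻¹ * X r x μ) * sphereD (fun y => r⁻¹ * X r y ν) x v)
      (γ := fun r x v => r * currentForm (S r) (X r) (T₀ r) x v)
      (by norm_num) (by norm_num) (fun i =>
      ((hU0 ν).mul (hUd i μ)).sub ((hU0 μ).mul (hUd i ν))) hβ).mul ha0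
    have h2 : Ex 1 0 (rotationDensity S X T₀ μ ν) _ := h1
    refine ⟨h2.sLim.continuousOn, h2.exists_tendsto_mul_integral ?_⟩
    have hz : ∀ (i : Fin 3) (x : E3), sd i (fun _ => (0 : ℝ)) x = 0 := fun i x => sd_const 0 i
    have hs : ∀ i k : Fin 3, ∀ x ∈ S2, sd i (fun y => y k) x = tang x i k :=
      fun i k x hx => sd_coord hx i k
    have hs0 : ∀ x, spatial x 0 = 0 := fun x => rfl
    have hss : ∀ x (k : Fin 3), spatial x k.succ = x k := fun x k => rfl
    -- If either index is the time index, both terms of the leading coefficient contain the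
    -- vanishing limit of `X^0/r` or its derivative. Only genuine rotations of `S²` survive.
    refine Fin.cases ?_ (fun k => ?_) μ
    · simp only [hz, hs0, mul_zero, zero_mul, sub_zero, Finset.sum_const_zero]
      exact sphereIntegral_zero
    · refine Fin.cases ?_ (fun l => ?_) ν
      · simp only [hz, hs0, mul_zero, zero_mul, sub_zero, Finset.sum_const_zero]
        exact sphereIntegral_zero
      · rw [← sphereIntegral_leading_rotation a hρ.smooth hu hφ hα hρ0 hα0 l k]
        refine sphereIntegral_congr fun x hx => ?_
        simp only [hs _ _ x hx, hss]
        rw [sum_rotation_tang, mul_one]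

/-- Convergence of the conserved quantities of linear Killing fields. -/
lemma exists_tendsto_conservedQuantity {A : ℝ → Matrix (Fin 4) (Fin 4) ℝ}
    (hA : ∀ᶠ r in atTop, IsLorentz (A r)) (hAlim : ∃ A₀, Tendsto A atTop (𝓝 A₀))
    {a : Vec4} (hT : ∀ μ, Tendsto (fun r => T₀ r μ) atTop (𝓝 (a μ)))
    (hrad : ∀ r, (S r).Radial)
    (hdet : ∀ᶠ r in atTop, ∀ x ∈ S2, (gram ((S r).rescale r).induced x).det ≠ 0)
    (hρ : ∀ᶠ r in atTop, ∀ x ∈ S2,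
      massDensity (S r) (X r) (T₀ r) x = (r ^ 2)⁻¹ * scaledDensity S X T₀ r x)
    (hX : ∀ᶠ r in atTop, SphereSmooth (X r))
    (hE : ∀ ν, (∀ᶠ r in atTop, ContinuousOn (energyDensity S X T₀ ν r) S2) ∧
      ∃ L, Tendsto (fun r => r * sphereIntegral (energyDensity S X T₀ ν r)) atTop (𝓝 L))
    (hR : ∀ μ ν, (∀ᶠ r in atTop, ContinuousOn (rotationDensity S X T₀ μ ν r) S2) ∧
      ∃ L, Tendsto (fun r => r * sphereIntegral (rotationDensity S X T₀ μ ν r)) atTop (𝓝 L))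
    {K : Vec4 → Vec4} {M : Matrix (Fin 4) (Fin 4) ℝ} (hK : IsLinearKilling K M) :
    ∃ L, Tendsto (fun r => conservedQuantity (S r) (X r) (T₀ r) (pushField (A r) K))
      atTop (𝓝 L) := by
  obtain ⟨A₀, hA₀⟩ := hAlim
  choose hEc LE hLE using hE
  choose hRc LR hLR using hR
  have hC : Tendsto (fun r => pushMatrix (A r) M) atTop (𝓝 (pushMatrix A₀ M)) := by
    have hcont : Continuous fun B => pushMatrix B M := by
      unfold pushMatrix
      fun_prop
    exact (hcont.tendsto A₀).comp hA₀
  have hCe : ∀ μ ν, Tendsto (fun r => pushMatrix (A r) M μ ν) atTop (𝓝 (pushMatrix A₀ M μ ν)) :=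
    fun μ ν => tendsto_pi_nhds.mp (tendsto_pi_nhds.mp hC μ) ν
  have hlim := ((tendsto_finsetSum Finset.univ fun μ _ => tendsto_finsetSum Finset.univ fun ν _ =>
    ((hCe μ ν).mul (hT μ)).mul (hLE ν)).add
    (tendsto_finsetSum Finset.univ fun μ _ => tendsto_finsetSum Finset.univ fun ν _ =>
      ((hCe μ ν).div_const 2).mul (hLR μ ν))).const_mul (-1 / (8 * Real.pi))
  refine ⟨_, hlim.congr' ?_⟩
  filter_upwards [hA, hdet, hρ, hX, eventually_all.mpr hEc,
    eventually_all.mpr fun μ => eventually_all.mpr (hRc μ), eventually_gt_atTop 0]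
    with r h1 h2 h3 h4 h5 h6 hr
  exact (conservedQuantity_eq hr hK h1 (hrad r) h2 h3
    (fun μ x hx => (h4.apply μ).sDiff hx) h5 h6).symm

end Conserved

end CWY

/-! ### Finiteness of the total center of mass and angular momentum -/

theorem proposition7p1 {M : Type*} [TopologicalSpace M] [T2Space M] [SecondCountableTopology M]
    [ChartedSpace E3 M] [IsManifold 𝓘(ℝ, E3) ∞ M]
    (D : InitialDataSet M) (Φ : OpenPartialHomeomorph M E3) (hD : D.IsAsymptoticallyFlat Φ)
    -- the family of optimal isometric embeddings of the coordinate spheres, with its observers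
    (X : ℝ → E3 → Vec4) (T₀ : ℝ → Vec4)
    (hopt : ∀ᶠ r in atTop, IsOptimalIsometricEmbedding (D.coordSphere Φ r) (X r) (T₀ r))
    (hX : HasEmbeddingExpansion X) (hT₀ : HasObserverExpansion T₀)
    -- Lorentz transformations with `T₀(r) = A(r)(∂/∂X^0)`
    (A : ℝ → Matrix (Fin 4) (Fin 4) ℝ)
    (hA : ∀ᶠ r in atTop, IsLorentz (A r) ∧ A r *ᵥ Pi.single 0 1 = T₀ r)
    (hAlim : ∃ A₀, Tendsto A atTop (𝓝 A₀))
    -- the leading coefficients `ρ^{(-2)}` and `α_H^{(-1)}`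
    (ρ₂ : E3 → ℝ)
    (hρ₂ : ∀ x ∈ Metric.sphere (0 : E3) 1, Tendsto
      (fun r => r ^ 2 * massDensity (D.coordSphere Φ r) (X r) (T₀ r) x) atTop (𝓝 (ρ₂ x)))
    (α₁ : E3 → E3 → ℝ)
    (hα₁ : ∀ x ∈ Metric.sphere (0 : E3) 1, ∀ v : E3, inner ℝ x v = 0 → Tendsto
      (fun r => r * (D.coordSphere Φ r).alphaH x v) atTop (𝓝 (α₁ x v)))
    -- the two conditions
    (hcond₁ : ∀ i : Fin 3, sphereIntegral (fun x => x i * ρ₂ x) = 0)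
    (hcond₂ : ∀ i : Fin 3, sphereIntegral (fun x => x i * roundCurl α₁ x) = 0) :
    (∃ C : Fin 3 → ℝ, IsTotalCenterOfMass (D.coordSphere Φ) X T₀ A
      (1 / (8 * Real.pi) * sphereIntegral ρ₂) C) ∧
    ∃ 𝓙 : Fin 3 → ℝ, IsTotalAngularMomentum (D.coordSphere Φ) X T₀ A 𝓙 := by
  have hP : NormalizedFamily fun r => (D.coordSphere Φ r).rescale r := hD.normalizedFamily
  have hrad : ∀ r, (D.coordSphere Φ r).Radial := InitialDataSet.coordSphere_radial
  have hXs : ∀ᶠ r in atTop, SphereSmooth (X r) := hopt.mono fun r hr => hr.smooth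
  have hU := hX.vEx hXs
  obtain ⟨a, hT⟩ := hT₀.ex
  obtain ⟨ρ, hρ⟩ := exists_ex_scaledDensity hP hU hT
  obtain ⟨u, hu⟩ := exists_ex_scaledAngle hP hU hT
  obtain ⟨φ, hφs, hφ⟩ := exists_potential_alphaH hU
  choose α hα using fun i => (hP.alphaH i).scaled
  have hm := massDensity_eq hP hU hT hrad
  -- The functions `ρ₂` and `α₁` are given only as pointwise limits. Uniqueness of limits identifies
  -- them on the sphere with the smooth leading coefficients of the expansions.
  have hρeq : ∀ x ∈ S2, ρ x = ρ₂ x := fun x hx => by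
    refine hρ.unique hx ((hρ₂ x hx).congr' ?_)
    filter_upwards [hm, eventually_ne_atTop 0] with r hr h0
    rw [hr x hx]
    field_simp
  have hαeq : ∀ i, ∀ x ∈ S2, α₁ x (tang x i) = α i x := fun i x hx => by
    refine ((hα i).unique hx ((hα₁ x hx _ (inner_tang hx i)).congr' ?_)).symm
    filter_upwards [hP.det_ne_zero, eventually_gt_atTop 0] with r hr h0
    rw [SurfaceInSpacetime.alphaH_rescale (hrad r) h0 hr hx]
  have hρ0 : ∀ i : Fin 3, sphereIntegral (fun x => x i * ρ x) = 0 := fun i => by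
    rw [← hcond₁ i]
    exact sphereIntegral_congr fun x hx => by rw [hρeq x hx]
  have hα0 := sphereIntegral_rotation_of_curl (fun i => (hα i).smooth) hαeq hcond₂
  obtain ⟨hE, hR⟩ := exists_tendsto_densities hP hU hρ hu.smooth hφs (fun i => (hα i).smooth)
    (fun i => ex_currentForm hP hU hT hrad hρ hu hφ hα i) hρ0 hα0
  have hconv : ∀ (K : Vec4 → Vec4) B, IsLinearKilling K B → ∃ L, Tendsto (fun r =>
      conservedQuantity (D.coordSphere Φ r) (X r) (T₀ r) (pushField (A r) K)) atTop (𝓝 L) :=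
    fun K B hK => exists_tendsto_conservedQuantity (hA.mono fun r hr => hr.1) hAlim
      -- The observer does not depend on the point of the sphere, so its limit may be read off at
      -- any unit vector.
      (fun μ => (hT 0 μ).tendsto (x := EuclideanSpace.single 0 1) (by simp)) hrad hP.det_ne_zero hm
      hXs hE hR hK
  constructor
  · choose L hL using fun i => hconv _ _ (exists_boostField i).choose_spec
    -- The limits `L i` exist whatever the mass is. If it is zero, the prefactor has the default
    -- value `0`, and the existence of `L i` is the content.
    exact ⟨fun i => 1 / (1 / (8 * Real.pi) * sphereIntegral ρ₂) * L i, fun i => ⟨L i, hL i, rfl⟩⟩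
  · choose L hL using fun j k => hconv _ _ (exists_rotationField j k).choose_spec
    exact ⟨fun i => ∑ j, ∑ k, levi i j k * L j k, fun i => tendsto_finsetSum _ fun j _ =>
      tendsto_finsetSum _ fun k _ => (hL j k).const_mul _⟩
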